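/- Let $\nu$ be an infinite ordinal. **The category.** A $C^*$-seminorm on a complex (not necessarily unital) $*$-algebra $A$ is a seminorm $p$ with $p(ab)\le p(a)p(b)$ and $p(a^*a)=p(a)^2$. An l.m.c.-$C^*$-algebra is a $*$-algebra with a Hausdorff topology which is the coarsest vector space topology making each member of some set of $C^*$-seminorms continuous. It is $\nu$-complete if every map $x:\nu\to A$ which is Cauchy (for every neighbourhood $U$ of $0$ there is $\gamma\in\nu$ with $x(\alpha)-x(\beta)\in U$ for all $\alpha,\beta\ge\gamma$) converges. Let $\mathbb A_\nu$ be the category of $\nu$-complete l.m.c.-$C^*$-algebras and continuous $*$-homomorphisms. **Mapping spaces.** For $A,B\in\mathbb A_\nu$, $\operatorname{Hom}(A,B)$ carries the compact-open topology and is pointed by the zero homomorphism; this gives functors $\operatorname{Hom}(A,-):\mathbb A_\nu\to \mathrm{Top}_*$. Let $\mathrm{Cpt}_*$ be the category of pointed compact Hausdorff spaces. For $X\in\mathrm{Cpt}_*$ and a pointed space $Y$, $C_*(X,Y)$ is the space of basepoint preserving continuous maps with the compact-open topology; for $B\in\mathbb A_\nu$ (pointed by $0$), $C_*(X,B)$ with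 pointwise operations is an object of $\mathbb A_\nu$. For $A\in\mathbb A_\nu$ and $(X,x_0)\in \mathrm{Cpt}_*$ let $A\boxtimes X\in\mathbb A_\nu$ be the universal object with a continuous map $A\times X\to A\boxtimes X$, $(a,x)\mapsto a\boxtimes x$, such that each $a\mapsto a\boxtimes x$ is a $*$-homomorphism and $a\boxtimes x_0=0$; it is functorial in $X$. Let $I=[0,1]$ with basepoint $0$, and $i_1:A\to A\boxtimes I$, $a\mapsto a\boxtimes 1$. **Seminorm extension.** A morphism $f:A\to B$ of $\mathbb A_\nu$ has the seminorm extension property if every continuous $C^*$-seminorm on $A$ is of the form $q\circ f$ with $q$ a continuous $C^*$-seminorm on $B$. The object $A$ has the strong cone seminorm extension property if $i_1:A\boxtimes X\to(A\boxtimes X)\boxtimes I$ has the seminorm extension property for every $X\in\mathrm{Cpt}_*$. **Statement.** Let $\{A_\alpha\}$ be a set of objects of $\mathbb A_\nu$ such that for each $\alpha$: 1. $A_\alpha\boxtimes -$ is a partial left adjoint of $\operatorname{Hom}(A_\alpha,-)$, i.e. there are bijections $\operatorname{Hom}(A_\alpha\boxtimes X,B)\to C_*(X,\operatorname{Hom}(A_\alpha,B))$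 natural in $X\in\mathrm{Cpt}_*$ and $B\in\mathbb A_\nu$; 2. there are homeomorphisms $\operatorname{Hom}(A_\alpha,C_*(X,B))\to C_*(X,\operatorname{Hom}(A_\alpha,B))$ natural in $X\in\mathrm{Cpt}_*$ and $B\in\mathbb A_\nu$; 3. $A_\alpha$ has the strong cone seminorm extension property. Then $\mathbb A_\nu$ has all small limits and colimits, and there is a cofibrantly generated model structure on $\mathbb A_\nu$ in which a morphism $p$ is a fibration (respectively a weak equivalence) if and only if, for every $\alpha$, $\operatorname{Hom}(A_\alpha,p)$ is a Serre fibration (respectively a weak homotopy equivalence), and in which every $A_\alpha$ is cofibrant. Here cofibrantly generated means that there are sets $I$ and $J$ of morphisms such that the sources of the morphisms in $I$ (in $J$) are small relative to the relative $I$-cell ($J$-cell) complexes, the trivial fibrations are exactly the morphisms with the right lifting property with respect to $I$, and the fibrations exactly those with the right lifting property with respect to $J$. -/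

import Mathlib

universe u

open CategoryTheory Topology Filter

namespace LmcCStar

section Algebras

variable (A : Type*) [NonUnitalRing A] [StarRing A] [Module ℂ A]

/-- A `C*`-seminorm on a complex `*`-algebra. -/
structure IsCStarSeminorm {A : Type*} [NonUnitalRing A] [StarRing A] [Module ℂ A]
    (p : Seminorm ℂ A) : Prop where
  mul_le : ∀ a b, p (a * b) ≤ p a * p b
  star_mul_self : ∀ a, p (star a * a) = p a ^ 2

/-- The topology of `A` is the coarsest vector space topology for which all members of some set
of `C*`-seminorms are continuous. -/
def IsLmcCStar [TopologicalSpace A] : Prop :=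
  ∃ S : Set (Seminorm ℂ A), (∀ p ∈ S, IsCStarSeminorm p) ∧
    WithSeminorms (fun p : S => (p : Seminorm ℂ A))

end Algebras

/-- Cauchy `ν`-sequences. -/
def IsNuCauchy (ν : Ordinal.{u}) {A : Type*} [AddGroup A] [TopologicalSpace A]
    (x : ν.ToType → A) : Prop :=
  ∀ U ∈ 𝓝 (0 : A), ∃ γ, ∀ α ≥ γ, ∀ β ≥ γ, x α - x β ∈ U

/-- Convergence of a `ν`-sequence. -/
def NuConverges (ν : Ordinal.{u}) {A : Type*} [TopologicalSpace A]
    (x : ν.ToType → A) (a : A) : Prop :=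
  ∀ U ∈ 𝓝 a, ∃ γ, ∀ α ≥ γ, x α ∈ U

/-- Every Cauchy `ν`-sequence converges. -/
def IsNuComplete (ν : Ordinal.{u}) (A : Type*) [AddGroup A] [TopologicalSpace A] : Prop :=
  ∀ x : ν.ToType → A, IsNuCauchy ν x → ∃ a, NuConverges ν x a

section Lemmas

variable {A : Type*} [NonUnitalRing A] [StarRing A] [Module ℂ A]

theorem IsCStarSeminorm.apply_star {p : Seminorm ℂ A} (hp : IsCStarSeminorm p) (a : A) :
    p (star a) = p a := by
  have key : ∀ b : A, p b ≤ p (star b) := by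
    intro b
    have h1 := hp.mul_le (star b) b
    rw [hp.star_mul_self] at h1
    rcases (apply_nonneg p b).eq_or_lt with h | h
    · rw [← h]; exact apply_nonneg p _
    · nlinarith
  refine le_antisymm ?_ (key a)
  simpa using key (star a)

theorem IsCStarSeminorm.comp {B : Type*} [NonUnitalRing B] [StarRing B] [Module ℂ B]
    {p : Seminorm ℂ B} (hp : IsCStarSeminorm p) (f : A →⋆ₙₐ[ℂ] B) :
    IsCStarSeminorm (p.comp (f : A →ₗ[ℂ] B)) where
  mul_le a b := by simpa using hp.mul_le (f a) (f b)
  star_mul_self a := by simpa [map_star] using hp.star_mul_self (f a)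

theorem isLmcCStar_of_family [TopologicalSpace A] {ι : Type*} (p : ι → Seminorm ℂ A)
    (hp : ∀ i, IsCStarSeminorm (p i)) (h : WithSeminorms p) : IsLmcCStar A := by
  have := h.topologicalAddGroup
  refine ⟨Set.range p, by rintro _ ⟨i, rfl⟩; exact hp i, ?_⟩
  rw [SeminormFamily.withSeminorms_iff_nhds_eq_iInf] at h ⊢
  rw [h]
  exact (iInf_range' (fun q : Seminorm ℂ A => (𝓝 0).comap q) p).symm

theorem isLmcCStar_of_basis [TopologicalSpace A] [IsTopologicalAddGroup A]
    (S : Set (Seminorm ℂ A)) (hS : ∀ p ∈ S, IsCStarSeminorm p ∧ Continuous p)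
    (h : ∀ U ∈ 𝓝 (0 : A), ∃ p ∈ S, ∃ ε > 0, ∀ a, p a < ε → a ∈ U) : IsLmcCStar A := by
  refine ⟨S, fun p hp => (hS p hp).1, ?_⟩
  rw [SeminormFamily.withSeminorms_iff_nhds_eq_iInf]
  refine le_antisymm (le_iInf fun p => ?_) ?_
  · rw [← tendsto_iff_comap]
    exact (hS p.1 p.2).2.tendsto' 0 0 (map_zero _)
  · intro U hU
    obtain ⟨p, hp, ε, hε, hU⟩ := h U hU
    exact mem_iInf_of_mem (⟨p, hp⟩ : S) ⟨Set.Iio ε, Iio_mem_nhds hε, fun a ha => hU a ha⟩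

theorem isLmcCStar_iInf {ι : Type*} {B : ι → Type*} [∀ i, NonUnitalRing (B i)]
    [∀ i, StarRing (B i)] [∀ i, Module ℂ (B i)] [∀ i, TopologicalSpace (B i)]
    (hB : ∀ i, IsLmcCStar (B i)) (f : ∀ i, A →⋆ₙₐ[ℂ] B i) :
    @IsLmcCStar A _ _ _ (⨅ i, TopologicalSpace.induced (f i) inferInstance) := by
  choose S hS hS' using hB
  let _ : TopologicalSpace A := ⨅ i, TopologicalSpace.induced (f i) inferInstance
  refine isLmcCStar_of_family _ ?_
    (withSeminorms_iInf fun i => LinearMap.withSeminorms_induced (hS' i) (f i : A →ₗ[ℂ] B i))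
  rintro ⟨i, p⟩
  exact (hS i p.1 p.2).comp (f i)

theorem isLmcCStar_induced {B : Type*} [NonUnitalRing B] [StarRing B] [Module ℂ B]
    [TopologicalSpace B] (hB : IsLmcCStar B) (f : A →⋆ₙₐ[ℂ] B) :
    @IsLmcCStar A _ _ _ (TopologicalSpace.induced f inferInstance) := by
  have := isLmcCStar_iInf (ι := Unit) (fun _ => hB) (fun _ => f)
  rwa [iInf_const] at this

theorem IsCStarSeminorm.sup {p q : Seminorm ℂ A} (hp : IsCStarSeminorm p)
    (hq : IsCStarSeminorm q) : IsCStarSeminorm (p ⊔ q) where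
  mul_le a b := by
    simp only [Seminorm.sup_apply]
    refine max_le ((hp.mul_le a b).trans ?_) ((hq.mul_le a b).trans ?_) <;> gcongr <;> simp
  star_mul_self a := by
    simp only [Seminorm.sup_apply, hp.star_mul_self, hq.star_mul_self]
    rcases le_total (p a) (q a) with h | h
    · rw [max_eq_right h, max_eq_right (by gcongr)]
    · rw [max_eq_left h, max_eq_left (by gcongr)]

theorem IsCStarSeminorm.finsetSup {ι : Type*} (p : ι → Seminorm ℂ A)
    (hp : ∀ i, IsCStarSeminorm (p i)) (s : Finset ι) : IsCStarSeminorm (s.sup p) := by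
  classical
  induction s using Finset.induction_on with
  | empty => exact ⟨by simp, by simp⟩
  | insert i s _ ih => rw [Finset.sup_insert]; exact (hp i).sup ih

variable [TopologicalSpace A]

theorem IsLmcCStar.exists_seminorm (h : IsLmcCStar A) {U : Set A} (hU : U ∈ 𝓝 (0 : A)) :
    ∃ p : Seminorm ℂ A, IsCStarSeminorm p ∧ Continuous p ∧ ∃ ε > 0, ∀ a, p a < ε → a ∈ U := by
  obtain ⟨S, hS, h⟩ := h
  obtain ⟨⟨s, ε⟩, hε, hs⟩ := h.hasBasis_zero_ball.mem_iff.1 hU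
  have := h.topologicalAddGroup
  refine ⟨s.sup fun p : S => (p : Seminorm ℂ A), IsCStarSeminorm.finsetSup (fun p : S => (p : Seminorm ℂ A)) (fun p => hS p.1 p.2) s,
    Seminorm.continuous_finsetSup fun p _ => h.continuous_seminorm p, ε, hε, fun a ha => hs ?_⟩
  rwa [Seminorm.mem_ball_zero]

theorem IsLmcCStar.isTopologicalAddGroup (h : IsLmcCStar A) : IsTopologicalAddGroup A := by
  obtain ⟨S, -, h⟩ := h
  exact h.topologicalAddGroup

theorem IsLmcCStar.continuousSMul (h : IsLmcCStar A) : ContinuousSMul ℂ A := by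
  obtain ⟨S, -, h⟩ := h
  exact h.continuousSMul

theorem IsLmcCStar.continuousStar (h : IsLmcCStar A) : ContinuousStar A := by
  obtain ⟨S, hS, h⟩ := h
  refine ⟨continuous_iff_continuousAt.2 fun a => ?_⟩
  rw [ContinuousAt, h.tendsto_nhds]
  intro p ε hε
  filter_upwards [(h.tendsto_nhds id a).1 tendsto_id p ε hε] with b hb
  rwa [← star_sub, (hS p.1 p.2).apply_star]

theorem IsLmcCStar.continuousMul (h : IsLmcCStar A) : ContinuousMul A := by
  obtain ⟨S, hS, h⟩ := h
  have := h.topologicalAddGroup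
  refine ⟨continuous_iff_continuousAt.2 fun ⟨a, b⟩ => ?_⟩
  rw [ContinuousAt, h.tendsto_nhds]
  intro p ε hε
  have hp := h.continuous_seminorm p
  have hg : Continuous fun x : A × A =>
      p.1 (x.1 - a) * p.1 (x.2 - b) + p.1 (x.1 - a) * p.1 b + p.1 a * p.1 (x.2 - b) := by
    fun_prop
  have h0 := hg.tendsto' (a, b) 0 (by simp)
  filter_upwards [h0.eventually (Iio_mem_nhds hε)] with x hx
  refine lt_of_le_of_lt ?_ hx
  have e : x.1 * x.2 - a * b = (x.1 - a) * (x.2 - b) + (x.1 - a) * b + a * (x.2 - b) := by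
    simp only [sub_mul, mul_sub]; abel
  rw [e]
  have hm := (hS p.1 p.2).mul_le
  refine (map_add_le_add p.1 _ _).trans (add_le_add ((map_add_le_add p.1 _ _).trans ?_) (hm _ _))
  exact add_le_add (hm _ _) (hm _ _)

end Lemmas

/-- An object of the category `𝔸_ν`: a Hausdorff, `ν`-complete l.m.c.-`C*`-algebra
(not necessarily unital). -/
structure ANu (ν : Ordinal.{u}) where
  carrier : Type u
  [nonUnitalRing : NonUnitalRing carrier]
  [starRing : StarRing carrier]
  [module : Module ℂ carrier]
  [isScalarTower : IsScalarTower ℂ carrier carrier]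
  [smulCommClass : SMulCommClass ℂ carrier carrier]
  [starModule : StarModule ℂ carrier]
  [topologicalSpace : TopologicalSpace carrier]
  [t2Space : T2Space carrier]
  isLmcCStar : IsLmcCStar carrier
  isNuComplete : IsNuComplete ν carrier

namespace ANu

variable {ν : Ordinal.{u}}

instance : CoeSort (ANu ν) (Type u) := ⟨carrier⟩

attribute [instance] nonUnitalRing starRing module isScalarTower smulCommClass starModule
  topologicalSpace t2Space

instance (A : ANu ν) : IsTopologicalAddGroup A := A.isLmcCStar.isTopologicalAddGroup
instance (A : ANu ν) : ContinuousSMul ℂ A := A.isLmcCStar.continuousSMul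
instance (A : ANu ν) : ContinuousStar A := A.isLmcCStar.continuousStar
instance (A : ANu ν) : ContinuousMul A := A.isLmcCStar.continuousMul
instance (A : ANu ν) : IsTopologicalRing A where

/-- Continuous `*`-homomorphisms. -/
structure Hom (A B : ANu ν) where
  toStarHom : A →⋆ₙₐ[ℂ] B
  continuous' : Continuous toStarHom

instance (A B : ANu ν) : FunLike (Hom A B) A B where
  coe f := f.toStarHom
  coe_injective := by
    rintro ⟨f, _⟩ ⟨g, _⟩ h
    congr
    exact DFunLike.coe_injective h

instance : Category (ANu ν) where
  Hom A B := Hom A B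
  id A := ⟨NonUnitalStarAlgHom.id ℂ A, continuous_id⟩
  comp f g := ⟨g.toStarHom.comp f.toStarHom, g.continuous'.comp f.continuous'⟩

instance (A B : ANu ν) : FunLike (A ⟶ B) A B := inferInstanceAs (FunLike (Hom A B) A B)

theorem Hom.continuous {A B : ANu ν} (f : A ⟶ B) : Continuous f := f.continuous'

@[ext] theorem hom_ext {A B : ANu ν} {f g : A ⟶ B} (h : ∀ a, f a = g a) : f = g :=
  DFunLike.ext _ _ h

@[simp] theorem id_apply {A : ANu ν} (a : A) : (𝟙 A : A ⟶ A) a = a := rfl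
@[simp] theorem comp_apply {A B C : ANu ν} (f : A ⟶ B) (g : B ⟶ C) (a : A) :
    (f ≫ g) a = g (f a) := rfl

/-- The zero homomorphism. -/
instance (A B : ANu ν) : Zero (A ⟶ B) := ⟨⟨0, continuous_const⟩⟩

@[simp] theorem zero_apply {A B : ANu ν} (a : A) : (0 : A ⟶ B) a = 0 := rfl

theorem hom_zero {A B : ANu ν} (f : A ⟶ B) : f 0 = 0 := _root_.map_zero f.toStarHom

/-- `Hom(A, B)` carries the compact-open topology. -/
instance (A B : ANu ν) : TopologicalSpace (A ⟶ B) :=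
  TopologicalSpace.induced (fun f => (⟨f, Hom.continuous f⟩ : C(A, B))) inferInstance

end ANu

/-! ### Pointed spaces -/

/-- Pointed topological spaces. -/
structure PtTop where
  carrier : Type u
  [topologicalSpace : TopologicalSpace carrier]
  base : carrier

namespace PtTop

instance : CoeSort PtTop.{u} (Type u) := ⟨carrier⟩

attribute [instance] topologicalSpace

/-- Basepoint preserving continuous maps. -/
structure Hom (X Y : PtTop.{u}) where
  toMap : C(X, Y)
  map_base' : toMap X.base = Y.base

instance (X Y : PtTop.{u}) : FunLike (Hom X Y) X Y where
  coe f := f.toMap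
  coe_injective := by
    rintro ⟨f, _⟩ ⟨g, _⟩ h
    congr
    exact DFunLike.coe_injective h

instance : Category PtTop.{u} where
  Hom X Y := Hom X Y
  id X := ⟨ContinuousMap.id X, rfl⟩
  comp f g := ⟨g.toMap.comp f.toMap, by simp [f.map_base', g.map_base']⟩

instance (X Y : PtTop.{u}) : FunLike (X ⟶ Y) X Y := inferInstanceAs (FunLike (Hom X Y) X Y)

/-- The underlying continuous map. -/
def Hom.toContinuousMap {X Y : PtTop.{u}} (f : X ⟶ Y) : C(X, Y) := f.toMap

theorem Hom.continuous {X Y : PtTop.{u}} (f : X ⟶ Y) : Continuous f := f.toMap.continuous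

theorem Hom.map_base {X Y : PtTop.{u}} (f : X ⟶ Y) : f X.base = Y.base := f.map_base'

@[ext] theorem hom_ext {X Y : PtTop.{u}} {f g : X ⟶ Y} (h : ∀ x, f x = g x) : f = g :=
  DFunLike.ext _ _ h

@[simp] theorem comp_apply {X Y Z : PtTop.{u}} (f : X ⟶ Y) (g : Y ⟶ Z) (x : X) :
    (f ≫ g) x = g (f x) := rfl

/-- The pointed mapping space, with the compact-open topology. -/
instance (X Y : PtTop.{u}) : TopologicalSpace (X ⟶ Y) :=
  TopologicalSpace.induced Hom.toContinuousMap inferInstance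

end PtTop

/-- Pointed compact Hausdorff spaces. -/
structure PtCpt extends PtTop.{u} where
  [compactSpace : CompactSpace carrier]
  [t2Space : T2Space carrier]

namespace PtCpt

instance : CoeSort PtCpt.{u} (Type u) := ⟨fun X => X.carrier⟩

attribute [instance] compactSpace t2Space

instance : Category PtCpt.{u} where
  Hom X Y := X.toPtTop ⟶ Y.toPtTop
  id X := 𝟙 X.toPtTop
  comp f g := f ≫ g

/-- The inclusion of pointed compact spaces into pointed spaces. -/
def incl : PtCpt.{u} ⥤ PtTop.{u} where
  obj X := X.toPtTop
  map f := f

instance (X Y : PtCpt.{u}) : FunLike (X ⟶ Y) X Y :=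
  inferInstanceAs (FunLike (X.toPtTop ⟶ Y.toPtTop) X Y)

/-- The unit interval with basepoint `0`. -/
def interval : PtCpt.{u} where
  carrier := ULift.{u} unitInterval
  base := ⟨0⟩

end PtCpt

variable {ν : Ordinal.{u}}

/-- The functor `Hom(A, -)` to pointed spaces; the basepoint is the zero homomorphism. -/
def homFunctor (A : ANu ν) : ANu ν ⥤ PtTop.{u} where
  obj B := { carrier := A ⟶ B, base := 0 }
  map {B B'} g :=
    { toMap :=
        { toFun := fun f => f ≫ g
          continuous_toFun := by
            refine continuous_induced_rng.2 ?_
            have h : Continuous fun f : A ⟶ B => (⟨f, ANu.Hom.continuous f⟩ : C(A, B)) :=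
              continuous_induced_dom
            exact (ContinuousMap.continuous_postcomp
              (⟨g, ANu.Hom.continuous g⟩ : C(B, B'))).comp h }
      map_base' := by
        apply ANu.hom_ext
        intro a
        exact ANu.hom_zero g }

/-! ### The algebra of pointed continuous maps -/

/-- The subalgebra of `C(X, B)` of maps vanishing at the basepoint. -/
def ptMapSubalgebra (X : PtCpt.{u}) (B : ANu ν) : NonUnitalStarSubalgebra ℂ C(X, B) where
  carrier := {f | f X.base = 0}
  add_mem' {f g} hf hg := by simp_all
  zero_mem' := by simp
  mul_mem' {f g} hf hg := by simp_all
  smul_mem' c f hf := by simp_all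
  star_mem' {f} hf := by simp_all

section PtMap

variable (X : PtCpt.{u}) (B : ANu ν)

theorem ptMap_bddAbove (p : Seminorm ℂ B) (hp : Continuous p) (f : C(X, B)) :
    BddAbove (Set.range fun x => p (f x)) :=
  (isCompact_range (hp.comp f.continuous)).bddAbove

/-- The seminorm `f ↦ sup_x p (f x)`. -/
noncomputable def supSeminorm (p : Seminorm ℂ B) (hp : Continuous p) : Seminorm ℂ C(X, B) :=
  Seminorm.of (fun f => ⨆ x, p (f x))
    (fun f g => by
      have : Nonempty X := ⟨X.base⟩
      exact ciSup_le fun x => (map_add_le_add p (f x) (g x)).trans (add_le_add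
        (le_ciSup (ptMap_bddAbove X B p hp f) x) (le_ciSup (ptMap_bddAbove X B p hp g) x)))
    (fun c f => by
      simp only [ContinuousMap.smul_apply, map_smul_eq_mul]
      exact (Real.mul_iSup_of_nonneg (norm_nonneg c) _).symm)

theorem supSeminorm_le_iff (p : Seminorm ℂ B) (hp : Continuous p) (f : C(X, B)) (r : ℝ) :
    supSeminorm X B p hp f ≤ r ↔ ∀ x, p (f x) ≤ r := by
  have : Nonempty X := ⟨X.base⟩
  exact ciSup_le_iff (ptMap_bddAbove X B p hp f)

theorem le_supSeminorm (p : Seminorm ℂ B) (hp : Continuous p) (f : C(X, B)) (x : X) :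
    p (f x) ≤ supSeminorm X B p hp f := (supSeminorm_le_iff X B p hp f _).1 le_rfl x

theorem supSeminorm_isCStar (p : Seminorm ℂ B) (hp : Continuous p) (h : IsCStarSeminorm p) :
    IsCStarSeminorm (supSeminorm X B p hp) where
  mul_le f g := by
    rw [supSeminorm_le_iff]
    intro x
    exact (h.mul_le _ _).trans (mul_le_mul (le_supSeminorm X B p hp f x)
      (le_supSeminorm X B p hp g x) (apply_nonneg _ _) (apply_nonneg _ _))
  star_mul_self f := by
    refine le_antisymm ?_ ?_
    · rw [supSeminorm_le_iff]
      intro x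
      have := h.star_mul_self (f x)
      calc p ((star f * f) x) = p (f x) ^ 2 := this
        _ ≤ _ := by gcongr; exact le_supSeminorm X B p hp f x
    · have h1 : supSeminorm X B p hp f ≤ Real.sqrt (supSeminorm X B p hp (star f * f)) := by
        rw [supSeminorm_le_iff]
        intro x
        apply Real.le_sqrt_of_sq_le
        rw [← h.star_mul_self]
        exact le_supSeminorm X B p hp (star f * f) x
      calc _ ≤ Real.sqrt (supSeminorm X B p hp (star f * f)) ^ 2 := by gcongr
        _ = _ := Real.sq_sqrt (apply_nonneg _ _)

theorem supSeminorm_continuous (p : Seminorm ℂ B) (hp : Continuous p) :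
    Continuous (supSeminorm X B p hp) := by
  refine Seminorm.continuous (r := 1) ?_
  have hU : {b : B | p b < 1 / 2} ∈ 𝓝 (0 : B) :=
    (hp.tendsto' 0 0 (map_zero p)).eventually (Iio_mem_nhds (by norm_num))
  have hb : {f : C(X, B) | Set.MapsTo f Set.univ {b : B | p b < 1 / 2}} ∈ 𝓝 (0 : C(X, B)) :=
    ((𝓝 (0 : B)).basis_sets).nhds_continuousMapConst.mem_of_mem
      (i := (Set.univ, {b : B | p b < 1 / 2})) ⟨isCompact_univ, hU⟩
  refine mem_of_superset hb ?_
  intro f hf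
  rw [Seminorm.mem_ball_zero]
  refine lt_of_le_of_lt ((supSeminorm_le_iff X B p hp f (1 / 2)).2 fun x => ?_) (by norm_num)
  exact le_of_lt (hf (Set.mem_univ x))

theorem isLmcCStar_continuousMap : IsLmcCStar C(X, B) := by
  refine isLmcCStar_of_basis {q | ∃ p : Seminorm ℂ B, ∃ hp : Continuous p, IsCStarSeminorm p ∧
    q = supSeminorm X B p hp} ?_ ?_
  · rintro _ ⟨p, hp, h, rfl⟩
    exact ⟨supSeminorm_isCStar X B p hp h, supSeminorm_continuous X B p hp⟩
  · intro U hU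
    obtain ⟨⟨K, V⟩, ⟨-, hV⟩, hKV⟩ :=
      ((𝓝 (0 : B)).basis_sets).nhds_continuousMapConst.mem_iff.1 hU
    obtain ⟨p, hpc, hp, ε, hε, h⟩ := B.isLmcCStar.exists_seminorm hV
    exact ⟨_, ⟨p, hp, hpc, rfl⟩, ε, hε, fun f hf => hKV fun x _ =>
      h _ ((le_supSeminorm X B p hp f x).trans_lt hf)⟩

theorem isNuComplete_ptMap : IsNuComplete ν (ptMapSubalgebra X B) := by
  intro f hf
  have hf' : ∀ (p : Seminorm ℂ B), Continuous p → ∀ ε > 0, ∃ γ, ∀ α ≥ γ, ∀ β ≥ γ, ∀ x,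
      p ((f α).1 x - (f β).1 x) < ε := by
    intro p hp ε hε
    have hU : {g : ptMapSubalgebra X B | supSeminorm X B p hp g.1 < ε} ∈
        𝓝 (0 : ptMapSubalgebra X B) :=
      (((supSeminorm_continuous X B p hp).comp continuous_subtype_val).tendsto' (0 : ptMapSubalgebra X B) 0
        (map_zero (supSeminorm X B p hp))).eventually (Iio_mem_nhds hε)
    obtain ⟨γ, hγ⟩ := hf _ hU
    exact ⟨γ, fun α hα β hβ x =>
      (le_supSeminorm X B p hp ((f α).1 - (f β).1) x).trans_lt (hγ α hα β hβ)⟩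
  have hlim : ∀ x, ∃ b, NuConverges ν (fun α => (f α).1 x) b := by
    intro x
    refine B.isNuComplete _ fun U hU => ?_
    obtain ⟨p, -, hp, ε, hε, h⟩ := B.isLmcCStar.exists_seminorm hU
    obtain ⟨γ, hγ⟩ := hf' p hp ε hε
    exact ⟨γ, fun α hα β hβ => h _ (hγ α hα β hβ x)⟩
  choose g hg using hlim
  have hunif : ∀ (p : Seminorm ℂ B), Continuous p → ∀ ε > 0, ∃ γ, ∀ α ≥ γ, ∀ x,
      p ((f α).1 x - g x) < ε := by
    intro p hp ε hε
    obtain ⟨γ, hγ⟩ := hf' p hp (ε / 2) (half_pos hε)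
    refine ⟨γ, fun α hα x => ?_⟩
    have hc : Continuous fun b : B => p (b - g x) := by fun_prop
    obtain ⟨δ, hδ⟩ := hg x {b | p (b - g x) < ε / 2}
      ((hc.tendsto' (g x) 0 (by simp)).eventually (Iio_mem_nhds (half_pos hε)))
    have h1 := hγ α hα (max γ δ) (le_max_left _ _) x
    have h2 : p ((f (max γ δ)).1 x - g x) < ε / 2 := hδ _ (le_max_right _ _)
    calc p ((f α).1 x - g x)
        = p (((f α).1 x - (f (max γ δ)).1 x) + ((f (max γ δ)).1 x - g x)) := by
          rw [sub_add_sub_cancel]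
      _ ≤ _ := map_add_le_add p _ _
      _ < ε := by linarith
  obtain ⟨S, -, hS⟩ := id B.isLmcCStar
  have hgc : Continuous g := by
    refine continuous_iff_continuousAt.2 fun x => ?_
    rw [ContinuousAt, hS.tendsto_nhds]
    intro p ε hε
    have hp := hS.continuous_seminorm p
    obtain ⟨γ, hγ⟩ := hunif p hp (ε / 3) (by positivity)
    have hc : Continuous fun y => p.1 ((f γ).1 y - (f γ).1 x) := by
      have := (f γ).1.continuous
      fun_prop
    filter_upwards [(hc.tendsto' x 0 (by simp)).eventually
      (Iio_mem_nhds (show 0 < ε / 3 by positivity))] with y hy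
    have h1 := hγ γ le_rfl y
    have h2 := hγ γ le_rfl x
    have hy' : p.1 ((f γ).1 y - (f γ).1 x) < ε / 3 := hy
    rw [map_sub_rev] at h1
    calc p.1 (g y - g x)
        = p.1 ((g y - (f γ).1 y) + ((f γ).1 y - (f γ).1 x) + ((f γ).1 x - g x)) := by
          congr 1; abel
      _ ≤ p.1 (g y - (f γ).1 y) + p.1 ((f γ).1 y - (f γ).1 x) + p.1 ((f γ).1 x - g x) :=
          (map_add_le_add p.1 _ _).trans (by gcongr; exact map_add_le_add p.1 _ _)
      _ < ε := by linarith
  have hg0 : g X.base = 0 := by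
    by_contra h0
    have hU : ({0}ᶜ : Set B) ∈ 𝓝 (g X.base) := isOpen_compl_singleton.mem_nhds h0
    obtain ⟨γ, hγ⟩ := hg X.base _ hU
    exact hγ γ le_rfl (f γ).2
  refine ⟨⟨⟨g, hgc⟩, hg0⟩, fun U hU => ?_⟩
  have hsub : Continuous fun h : ptMapSubalgebra X B =>
      h + (⟨⟨g, hgc⟩, hg0⟩ : ptMapSubalgebra X B) := by
    refine Continuous.subtype_mk ?_ _
    exact (continuous_subtype_val.add continuous_const)
  have hU' := (hsub.tendsto' 0 _ (zero_add _)) hU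
  rw [mem_map, nhds_subtype_eq_comap] at hU'
  obtain ⟨V, hV, hVU⟩ := hU'
  obtain ⟨q, ⟨⟨K, W⟩, ⟨-, hW⟩, hKW⟩⟩ : ∃ q : Unit, ∃ KW : Set X × Set B,
      (IsCompact KW.1 ∧ KW.2 ∈ 𝓝 (0 : B)) ∧ {h : C(X, B) | Set.MapsTo h KW.1 KW.2} ⊆ V :=
    ⟨(), ((𝓝 (0 : B)).basis_sets).nhds_continuousMapConst.mem_iff.1 hV⟩
  obtain ⟨p, -, hp, ε, hε, h⟩ := B.isLmcCStar.exists_seminorm hW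
  obtain ⟨γ, hγ⟩ := hunif p hp ε hε
  refine ⟨γ, fun α hα => ?_⟩
  have := hVU (a := f α - ⟨⟨g, hgc⟩, hg0⟩) (hKW fun x _ => h _ (hγ α hα x))
  simpa using this

/-- The algebra `C_*(X, B)` of pointed continuous maps with the compact-open topology. -/
def ptMapAlg : ANu ν where
  carrier := ptMapSubalgebra X B
  t2Space := inferInstanceAs (T2Space {f : C(X, B) // f X.base = 0})
  isLmcCStar := isLmcCStar_induced (isLmcCStar_continuousMap X B)
    (NonUnitalStarSubalgebraClass.subtype (R := ℂ) (ptMapSubalgebra X B))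
  isNuComplete := isNuComplete_ptMap X B

end PtMap

/-- Functoriality of `C_*(X, B)`, contravariant in `X` and covariant in `B`. -/
def ptMapAlgMap {X X' : PtCpt.{u}} {B B' : ANu ν} (h : X' ⟶ X) (g : B ⟶ B') :
    ptMapAlg X B ⟶ ptMapAlg X' B' where
  toStarHom :=
    { toFun := fun f => ⟨((⟨g, ANu.Hom.continuous g⟩ : C(B, B')).comp f.1).comp
          (PtTop.Hom.toContinuousMap h), by
        have h1 := PtTop.Hom.map_base h
        have h2 : f.1 X.base = 0 := f.2
        change g (f.1 (h X'.base)) = 0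
        exact (congrArg (fun y => g (f.1 y)) h1).trans
          ((congrArg g h2).trans (ANu.hom_zero g))⟩
      map_smul' := fun c f => Subtype.ext (ContinuousMap.ext fun x =>
        map_smul g.toStarHom c (f.1 (h x)))
      map_zero' := Subtype.ext (ContinuousMap.ext fun x => map_zero g.toStarHom)
      map_add' := fun f f' => Subtype.ext (ContinuousMap.ext fun x =>
        map_add g.toStarHom (f.1 (h x)) (f'.1 (h x)))
      map_mul' := fun f f' => Subtype.ext (ContinuousMap.ext fun x =>
        map_mul g.toStarHom (f.1 (h x)) (f'.1 (h x)))
      map_star' := fun f => Subtype.ext (ContinuousMap.ext fun x =>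
        map_star g.toStarHom (f.1 (h x))) }
  continuous' := by
    refine Continuous.subtype_mk ?_ _
    exact (ContinuousMap.continuous_precomp _).comp
      ((ContinuousMap.continuous_postcomp _).comp continuous_subtype_val)

/-! ### Algebras given by generators and relations -/

section Universal

variable {G : Type u}

/-- Representations of generators `G` subject to relations: a relation is given by saying which maps
`G → B` satisfy it. -/
structure Rep (Rel : ∀ B : ANu ν, (G → B) → Prop) where
  alg : ANu ν
  map : G → alg
  rel : Rel alg map

variable (Rel : ∀ B : ANu ν, (G → B) → Prop)

/-- The tautological element of the product of all representations given by a generator. -/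
def Rep.gen (g : G) : ∀ R : Rep Rel, R.alg := fun R => R.map g

/-- The smallest `*`-subalgebra of the product of all representations which contains the
generators and is closed under limits of convergent `ν`-sequences. -/
def universalSubalgebra : NonUnitalStarSubalgebra ℂ (∀ R : Rep Rel, R.alg) :=
  sInf {S | (∀ g, Rep.gen Rel g ∈ S) ∧
    ∀ x : ν.ToType → (∀ R : Rep Rel, R.alg), (∀ α, x α ∈ S) → ∀ y, NuConverges ν x y → y ∈ S}

theorem gen_mem_universalSubalgebra (g : G) : Rep.gen Rel g ∈ universalSubalgebra Rel := by
  rw [universalSubalgebra, NonUnitalStarAlgebra.mem_sInf]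
  exact fun S hS => hS.1 g

theorem universalSubalgebra_closed (x : ν.ToType → (∀ R : Rep Rel, R.alg))
    (hx : ∀ α, x α ∈ universalSubalgebra Rel) (y : ∀ R : Rep Rel, R.alg)
    (h : NuConverges ν x y) : y ∈ universalSubalgebra Rel := by
  rw [universalSubalgebra, NonUnitalStarAlgebra.mem_sInf]
  intro S hS
  refine hS.2 x (fun α => ?_) y h
  have := hx α
  rw [universalSubalgebra, NonUnitalStarAlgebra.mem_sInf] at this
  exact this S hS

theorem universalSubalgebra_le (S : NonUnitalStarSubalgebra ℂ (∀ R : Rep Rel, R.alg))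
    (h1 : ∀ g, Rep.gen Rel g ∈ S)
    (h2 : ∀ x : ν.ToType → (∀ R : Rep Rel, R.alg), (∀ α, x α ∈ S) →
      ∀ y, NuConverges ν x y → y ∈ S) : universalSubalgebra Rel ≤ S :=
  sInf_le ⟨h1, h2⟩

/-- Formal expressions in the generators; they bound the size of the universal algebra. -/
inductive FormalExpr (ν : Ordinal.{u}) (G : Type u) : Type u
  | gen : G → FormalExpr ν G
  | zero : FormalExpr ν G
  | add : FormalExpr ν G → FormalExpr ν G → FormalExpr ν G
  | mul : FormalExpr ν G → FormalExpr ν G → FormalExpr ν G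
  | smul : ℂ → FormalExpr ν G → FormalExpr ν G
  | star : FormalExpr ν G → FormalExpr ν G
  | lim : (ν.ToType → FormalExpr ν G) → FormalExpr ν G

open Classical in
/-- Evaluation of a formal expression in the product of all representations. -/
noncomputable def FormalExpr.eval : FormalExpr ν G → (∀ R : Rep Rel, R.alg)
  | .gen g => Rep.gen Rel g
  | .zero => 0
  | .add s t => s.eval + t.eval
  | .mul s t => s.eval * t.eval
  | .smul c t => c • t.eval
  | .star t => Star.star t.eval
  | .lim s => if h : ∃ y, NuConverges ν (fun α => (s α).eval) y then h.choose else 0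

theorem nuConverges_unique {A : Type*} [TopologicalSpace A] [T2Space A] {x : ν.ToType → A}
    {a b : A} (ha : NuConverges ν x a) (hb : NuConverges ν x b) : a = b := by
  by_contra h
  obtain ⟨U, V, hU, hV, haU, hbV, hUV⟩ := t2_separation h
  obtain ⟨γ, hγ⟩ := ha U (hU.mem_nhds haU)
  obtain ⟨δ, hδ⟩ := hb V (hV.mem_nhds hbV)
  exact Set.disjoint_left.1 hUV (hγ (max γ δ) (le_max_left _ _)) (hδ _ (le_max_right _ _))

theorem universalSubalgebra_small : Small.{u} (universalSubalgebra Rel) := by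
  let S : NonUnitalStarSubalgebra ℂ (∀ R : Rep Rel, R.alg) :=
    { carrier := Set.range (FormalExpr.eval Rel)
      zero_mem' := ⟨.zero, rfl⟩
      add_mem' := by rintro _ _ ⟨s, rfl⟩ ⟨t, rfl⟩; exact ⟨.add s t, rfl⟩
      mul_mem' := by rintro _ _ ⟨s, rfl⟩ ⟨t, rfl⟩; exact ⟨.mul s t, rfl⟩
      smul_mem' := by rintro c _ ⟨t, rfl⟩; exact ⟨.smul c t, rfl⟩
      star_mem' := by rintro _ ⟨t, rfl⟩; exact ⟨.star t, rfl⟩ }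
  have hle : universalSubalgebra Rel ≤ S := by
    refine universalSubalgebra_le Rel S (fun g => ⟨.gen g, rfl⟩) fun x hx y hy => ?_
    choose s hs using hx
    have hx' : x = fun α => (s α).eval Rel := funext fun α => (hs α).symm
    subst hx'
    have hex : ∃ y, NuConverges ν (fun α => (s α).eval Rel) y := ⟨y, hy⟩
    refine ⟨.lim s, ?_⟩
    rw [FormalExpr.eval, dif_pos hex]
    exact nuConverges_unique hex.choose_spec hy
  have : Small.{u} (Set.range (FormalExpr.eval Rel)) := small_range _
  exact small_subset (t := (universalSubalgebra Rel : Set _)) (s := Set.range (FormalExpr.eval Rel)) hle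

theorem nuConverges_pi {ι : Type*} {B : ι → Type*} [∀ i, TopologicalSpace (B i)]
    (hν : Nonempty ν.ToType) {x : ν.ToType → ∀ i, B i} {y : ∀ i, B i}
    (h : ∀ i, NuConverges ν (fun α => x α i) (y i)) : NuConverges ν x y := by
  have key : ∀ i, Tendsto (fun α => x α i) atTop (𝓝 (y i)) := fun i U hU => by
    obtain ⟨γ, hγ⟩ := h i U hU
    exact mem_map.2 (mem_of_superset (mem_atTop γ) hγ)
  intro U hU
  have := tendsto_pi_nhds.2 key hU
  rw [mem_map, mem_atTop_sets] at this
  exact this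

theorem NuConverges.map {A B : Type*} [TopologicalSpace A] [TopologicalSpace B]
    {x : ν.ToType → A} {a : A} (h : NuConverges ν x a) {f : A → B} (hf : Continuous f) :
    NuConverges ν (fun α => f (x α)) (f a) :=
  fun _ hU => h _ (hf.continuousAt hU)

theorem isLmcCStar_universalSubalgebra : IsLmcCStar (universalSubalgebra Rel) := by
  have := isLmcCStar_iInf (fun R : Rep Rel => R.alg.isLmcCStar) (fun R : Rep Rel =>
    ({ toFun := fun x => x.1 R
       map_smul' := fun _ _ => rfl
       map_zero' := rfl
       map_add' := fun _ _ => rfl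
       map_mul' := fun _ _ => rfl
       map_star' := fun _ => rfl } : universalSubalgebra Rel →⋆ₙₐ[ℂ] R.alg))
  convert! this using 1
  change TopologicalSpace.induced _ (⨅ R, _) = _
  rw [induced_iInf]
  simp only [induced_compose]
  rfl

theorem isNuComplete_universalSubalgebra : IsNuComplete ν (universalSubalgebra Rel) := by
  intro x hx
  have hc : ∀ R : Rep Rel, Continuous fun y : universalSubalgebra Rel => y.1 R :=
    fun R => (continuous_apply R).comp continuous_subtype_val
  have h : ∀ R : Rep Rel, ∃ y, NuConverges ν (fun α => (x α).1 R) y := fun R =>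
    R.alg.isNuComplete _ fun U hU => hx _ (((hc R).tendsto' 0 0 rfl) hU)
  choose y hy using h
  have hν : Nonempty ν.ToType := by
    obtain ⟨γ, -⟩ := hx _ univ_mem
    exact ⟨γ⟩
  have hy' : NuConverges ν (fun α => (x α).1) y := nuConverges_pi hν hy
  refine ⟨⟨y, universalSubalgebra_closed Rel _ (fun α => (x α).2) y hy'⟩, fun U hU => ?_⟩
  rw [nhds_subtype_eq_comap] at hU
  obtain ⟨V, hV, hVU⟩ := hU
  obtain ⟨γ, hγ⟩ := hy' V hV
  exact ⟨γ, fun α hα => hVU (hγ α hα)⟩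

end Universal

section Transport

variable {A : Type*} [NonUnitalRing A] [StarRing A] [Module ℂ A]
    [IsScalarTower ℂ A A] [SMulCommClass ℂ A A] [StarModule ℂ A] [TopologicalSpace A] [T2Space A]
    {T : Type u} (e : T ≃ A) (h1 : IsLmcCStar A) (h2 : IsNuComplete ν A)

/-- Transport of the structure of an object of `𝔸_ν` along a bijection with a small type. -/
noncomputable def ANu.ofEquiv : ANu ν :=
  letI : NonUnitalRing T := e.nonUnitalRing
  letI : Module ℂ T := e.module ℂ
  letI : TopologicalSpace T := .induced e inferInstance
  letI : StarRing T :=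
    { star := fun a => e.symm (star (e a))
      star_involutive := fun a => by simp
      star_mul := fun a b => by
        change e.symm (star (e (e.symm _))) = e.symm (e (e.symm _) * e (e.symm _))
        simp
      star_add := fun a b => by
        change e.symm (star (e (e.symm _))) = e.symm (e (e.symm _) + e (e.symm _))
        simp }
  letI φ : T →⋆ₙₐ[ℂ] A :=
    { toFun := e
      map_smul' := fun c a => e.apply_symm_apply _
      map_zero' := e.apply_symm_apply _
      map_add' := fun a b => e.apply_symm_apply _
      map_mul' := fun a b => e.apply_symm_apply _
      map_star' := fun a => e.apply_symm_apply _ }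
  { carrier := T
    isScalarTower := ⟨fun c a b => e.injective (by
      change φ _ = φ _
      simp only [smul_eq_mul, map_mul, map_smul, smul_mul_assoc])⟩
    smulCommClass := ⟨fun c a b => e.injective (by
      change φ _ = φ _
      simp only [smul_eq_mul, map_mul, map_smul, mul_smul_comm])⟩
    starModule := ⟨fun c a => e.injective (by
      change φ _ = φ _
      simp only [map_star, map_smul, star_smul])⟩
    t2Space := (Topology.IsEmbedding.induced e.injective).t2Space
    isLmcCStar := isLmcCStar_induced h1 φ
    isNuComplete := fun x hx => by
      obtain ⟨a, ha⟩ := h2 (fun α => e (x α)) fun U hU => by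
        obtain ⟨γ, hγ⟩ := hx (φ ⁻¹' U)
          ((continuous_induced_dom (f := φ)).tendsto' 0 0 (map_zero φ) hU)
        exact ⟨γ, fun α hα β hβ => by
          have := hγ α hα β hβ
          rwa [Set.mem_preimage, map_sub] at this⟩
      refine ⟨e.symm a, fun U hU => ?_⟩
      rw [nhds_induced] at hU
      obtain ⟨V, hV, hVU⟩ := hU
      rw [e.apply_symm_apply] at hV
      obtain ⟨γ, hγ⟩ := ha V hV
      exact ⟨γ, fun α hα => hVU (hγ α hα)⟩ }

/-- The bijection along which the structure is transported, as a `*`-isomorphism. -/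
noncomputable def ANu.ofEquivHom : ANu.ofEquiv e h1 h2 →⋆ₙₐ[ℂ] A where
  toFun := e
  map_smul' _ _ := e.apply_symm_apply _
  map_zero' := e.apply_symm_apply _
  map_add' _ _ := e.apply_symm_apply _
  map_mul' _ _ := e.apply_symm_apply _
  map_star' _ := e.apply_symm_apply _

theorem ANu.isInducing_ofEquivHom : IsInducing (ANu.ofEquivHom e h1 h2) := ⟨rfl⟩

theorem ANu.bijective_ofEquivHom : Function.Bijective (ANu.ofEquivHom e h1 h2) := e.bijective

end Transport

section UniversalAlgebra

variable {G : Type u} (Rel : ∀ B : ANu ν, (G → B) → Prop)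

/-- The `ν`-complete l.m.c.-`C*`-algebra with generators `G` and relations `Rel`. -/
noncomputable def universalAlg : ANu ν :=
  haveI := universalSubalgebra_small Rel
  ANu.ofEquiv (equivShrink.{u} (universalSubalgebra Rel)).symm (isLmcCStar_universalSubalgebra Rel)
    (isNuComplete_universalSubalgebra Rel)

/-- The canonical isomorphism of `universalAlg` with `universalSubalgebra`. -/
noncomputable def universalHom : universalAlg Rel →⋆ₙₐ[ℂ] universalSubalgebra Rel :=
  haveI := universalSubalgebra_small Rel
  ANu.ofEquivHom _ _ _

theorem isInducing_universalHom : IsInducing (universalHom Rel) :=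
  haveI := universalSubalgebra_small Rel
  ANu.isInducing_ofEquivHom _ _ _

theorem bijective_universalHom : Function.Bijective (universalHom Rel) :=
  haveI := universalSubalgebra_small Rel
  ANu.bijective_ofEquivHom _ _ _

/-- The image of a generator. -/
noncomputable def universalGen (g : G) : universalAlg Rel :=
  ((bijective_universalHom Rel).2 ⟨Rep.gen Rel g, gen_mem_universalSubalgebra Rel g⟩).choose

theorem universalHom_gen (g : G) : (universalHom Rel (universalGen Rel g)).1 = Rep.gen Rel g :=
  congrArg Subtype.val
    ((bijective_universalHom Rel).2 ⟨Rep.gen Rel g, gen_mem_universalSubalgebra Rel g⟩).choose_spec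

variable {Rel}

/-- The homomorphism out of the universal algebra determined by a representation. -/
noncomputable def universalLift {B : ANu ν} (f : G → B) (hf : Rel B f) : universalAlg Rel ⟶ B where
  toStarHom :=
    { toFun := fun a => (universalHom Rel a).1 ⟨B, f, hf⟩
      map_smul' := fun c a => by rw [map_smul]; rfl
      map_zero' := by rw [map_zero]; rfl
      map_add' := fun a b => by rw [map_add]; rfl
      map_mul' := fun a b => by rw [map_mul]; rfl
      map_star' := fun a => by rw [map_star]; rfl }
  continuous' := (continuous_apply (⟨B, f, hf⟩ : Rep Rel)).comp
    (continuous_subtype_val.comp (isInducing_universalHom Rel).continuous)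

theorem universalLift_gen {B : ANu ν} (f : G → B) (hf : Rel B f) (g : G) :
    universalLift f hf (universalGen Rel g) = f g :=
  congrFun (universalHom_gen Rel g) ⟨B, f, hf⟩

theorem universal_hom_ext {B : ANu ν} {φ ψ : universalAlg Rel ⟶ B}
    (h : ∀ g, φ (universalGen Rel g) = ψ (universalGen Rel g)) : φ = ψ := by
  let E : NonUnitalStarSubalgebra ℂ (universalAlg Rel) :=
    { carrier := {a | φ a = ψ a}
      zero_mem' := (ANu.hom_zero φ).trans (ANu.hom_zero ψ).symm
      add_mem' := fun {a b} ha hb => (map_add φ.toStarHom a b).trans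
        ((congrArg₂ (· + ·) ha hb).trans (map_add ψ.toStarHom a b).symm)
      mul_mem' := fun {a b} ha hb => (map_mul φ.toStarHom a b).trans
        ((congrArg₂ (· * ·) ha hb).trans (map_mul ψ.toStarHom a b).symm)
      smul_mem' := fun c {a} ha => (map_smul φ.toStarHom c a).trans
        ((congrArg (c • ·) ha).trans (map_smul ψ.toStarHom c a).symm)
      star_mem' := fun {a} ha => (map_star φ.toStarHom a).trans
        ((congrArg star ha).trans (map_star ψ.toStarHom a).symm) }
  let i : universalAlg Rel →⋆ₙₐ[ℂ] (∀ R : Rep Rel, R.alg) :=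
    (NonUnitalStarSubalgebraClass.subtype (R := ℂ) (universalSubalgebra Rel)).comp
      (universalHom Rel)
  have hi : IsInducing i := IsInducing.subtypeVal.comp (isInducing_universalHom Rel)
  have hle : universalSubalgebra Rel ≤ E.map i := by
    refine universalSubalgebra_le Rel _ (fun g => ⟨universalGen Rel g, h g, ?_⟩) ?_
    · exact universalHom_gen Rel g
    · intro x hx y hy
      choose a ha hax using hx
      have hyU : y ∈ universalSubalgebra Rel := by
        refine universalSubalgebra_closed Rel x (fun α => ?_) y hy
        have := (universalHom Rel (a α)).2
        exact hax α ▸ this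
      obtain ⟨b, hb⟩ := (bijective_universalHom Rel).2 ⟨y, hyU⟩
      have hib : i b = y := congrArg Subtype.val hb
      have hab : NuConverges ν a b := by
        intro U hU
        rw [hi.nhds_eq_comap] at hU
        obtain ⟨V, hV, hVU⟩ := hU
        rw [hib] at hV
        obtain ⟨γ, hγ⟩ := hy V hV
        refine ⟨γ, fun α hα => hVU ?_⟩
        have := hγ α hα
        rw [← hax α] at this
        exact this
      refine ⟨b, ?_, hib⟩
      have h1 := hab.map (ANu.Hom.continuous φ)
      have h2 := hab.map (ANu.Hom.continuous ψ)
      have : (fun α => φ (a α)) = fun α => ψ (a α) := funext ha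
      rw [this] at h1
      exact nuConverges_unique h1 h2
  ext a
  obtain ⟨b, hb, hba⟩ := hle (universalHom Rel a).2
  have : b = a := (bijective_universalHom Rel).1 (Subtype.ext hba)
  exact this ▸ hb

end UniversalAlgebra

/-! ### The pointed tensor of an algebra with a pointed compact space -/

/-- The relations defining `A ⊠ X`: the map is jointly continuous, a `*`-homomorphism
in the first variable, and zero on the basepoint of `X`. -/
structure IsPtBimorphism {A : ANu ν} {X : PtCpt.{u}} (B : ANu ν) (f : A × X → B) : Prop where
  continuous : Continuous f
  map_base : ∀ a, f (a, X.base) = 0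
  map_add : ∀ a b x, f (a + b, x) = f (a, x) + f (b, x)
  map_smul : ∀ (c : ℂ) a x, f (c • a, x) = c • f (a, x)
  map_mul : ∀ a b x, f (a * b, x) = f (a, x) * f (b, x)
  map_star : ∀ a x, f (star a, x) = star (f (a, x))

/-- The object `A ⊠ X` of `𝔸_ν`: it is generated by copies of `A` indexed by the points of `X`,
with the copy at the basepoint being zero, subject to the relation that the canonical map from
`A × X` is continuous. -/
noncomputable def ptTensor (A : ANu ν) (X : PtCpt.{u}) : ANu ν :=
  universalAlg (fun B => IsPtBimorphism (A := A) (X := X) B)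

/-- The canonical map `A × X → A ⊠ X`. -/
noncomputable def ptTensorMk (A : ANu ν) (X : PtCpt.{u}) : A × X → ptTensor A X :=
  universalGen _

theorem isPtBimorphism_universalGen {A : ANu ν} {X : PtCpt.{u}}
    (Rel : ∀ B : ANu ν, (A × X → B) → Prop) (hRel : ∀ B f, Rel B f → IsPtBimorphism B f) :
    IsPtBimorphism (universalAlg Rel) (universalGen Rel) := by
  have key : ∀ g, (universalHom Rel (universalGen Rel g)).1 = Rep.gen Rel g := universalHom_gen Rel
  have hinj : ∀ {s t : universalAlg Rel},
      (universalHom Rel s).1 = (universalHom Rel t).1 → s = t :=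
    fun h => (bijective_universalHom Rel).1 (Subtype.ext h)
  constructor
  · refine (isInducing_universalHom Rel).continuous_iff.2 ?_
    refine continuous_induced_rng.2 (continuous_pi fun R => ?_)
    have : (fun g => (universalHom Rel (universalGen Rel g)).1 R) = R.map :=
      funext fun g => congrFun (key g) R
    exact this ▸ (hRel _ _ R.rel).continuous
  · intro a
    refine hinj ?_
    rw [map_zero]
    exact (key _).trans (funext fun R => (hRel _ _ R.rel).map_base a)
  · intro a b x
    refine hinj ?_
    rw [map_add]
    refine (key _).trans ((funext fun R => (hRel _ _ R.rel).map_add a b x).trans ?_)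
    exact (congrArg₂ (· + ·) (key (a, x)) (key (b, x))).symm
  · intro c a x
    refine hinj ?_
    rw [map_smul]
    refine (key _).trans ((funext fun R => (hRel _ _ R.rel).map_smul c a x).trans ?_)
    exact (congrArg (c • ·) (key (a, x))).symm
  · intro a b x
    refine hinj ?_
    rw [map_mul]
    refine (key _).trans ((funext fun R => (hRel _ _ R.rel).map_mul a b x).trans ?_)
    exact (congrArg₂ (· * ·) (key (a, x)) (key (b, x))).symm
  · intro a x
    refine hinj ?_
    rw [map_star]
    refine (key _).trans ((funext fun R => (hRel _ _ R.rel).map_star a x).trans ?_)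
    exact (congrArg star (key (a, x))).symm

theorem ptTensorMk_isPtBimorphism (A : ANu ν) (X : PtCpt.{u}) :
    IsPtBimorphism (ptTensor A X) (ptTensorMk A X) :=
  isPtBimorphism_universalGen _ fun _ _ h => h

/-- The universal property of `A ⊠ X`. -/
noncomputable def ptTensorLift {A : ANu ν} {X : PtCpt.{u}} {B : ANu ν} (f : A × X → B)
    (hf : IsPtBimorphism B f) : ptTensor A X ⟶ B :=
  universalLift (Rel := fun B => IsPtBimorphism (A := A) (X := X) B) f hf

theorem ptTensorLift_mk {A : ANu ν} {X : PtCpt.{u}} {B : ANu ν} (f : A × X → B)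
    (hf : IsPtBimorphism B f) (t : A × X) : ptTensorLift f hf (ptTensorMk A X t) = f t :=
  universalLift_gen (Rel := fun B => IsPtBimorphism (A := A) (X := X) B) f hf t

theorem ptTensor_hom_ext {A : ANu ν} {X : PtCpt.{u}} {B : ANu ν} {φ ψ : ptTensor A X ⟶ B}
    (h : ∀ t, φ (ptTensorMk A X t) = ψ (ptTensorMk A X t)) : φ = ψ :=
  universal_hom_ext h

theorem IsPtBimorphism.precomp {A : ANu ν} {X Y : PtCpt.{u}} {B : ANu ν} {f : A × Y → B}
    (hf : IsPtBimorphism B f) (h : X ⟶ Y) :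
    IsPtBimorphism (X := X) B (fun t : A × X => f (t.1, h t.2)) where
  continuous := hf.continuous.comp
    (continuous_fst.prodMk ((PtTop.Hom.continuous h).comp continuous_snd))
  map_base a := by
    have h1 : h X.base = Y.base := PtTop.Hom.map_base h
    change f (a, h X.base) = 0
    rw [h1, hf.map_base]
  map_add a b x := hf.map_add a b (h x)
  map_smul c a x := hf.map_smul c a (h x)
  map_mul a b x := hf.map_mul a b (h x)
  map_star a x := hf.map_star a (h x)

/-- The functor `A ⊠ -` from pointed compact spaces to `𝔸_ν`. -/
noncomputable def ptTensorFunctor (A : ANu ν) : PtCpt.{u} ⥤ ANu ν where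
  obj X := ptTensor A X
  map {X Y} h := ptTensorLift (fun t : A × X => ptTensorMk A Y (t.1, h t.2))
    ((ptTensorMk_isPtBimorphism A Y).precomp h)
  map_id X := ptTensor_hom_ext fun t => ptTensorLift_mk _ _ t
  map_comp {X Y Z} h k := ptTensor_hom_ext fun t => by
    rw [ANu.comp_apply, ptTensorLift_mk, ptTensorLift_mk, ptTensorLift_mk]
    rfl

/-- The homomorphism `A → A ⊠ X`, `a ↦ a ⊠ x`, attached to a point `x` of `X`. -/
noncomputable def ptTensorAt (A : ANu ν) (X : PtCpt.{u}) (x : X) : A ⟶ ptTensor A X where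
  toStarHom :=
    { toFun := fun a => ptTensorMk A X (a, x)
      map_smul' := fun c a => (ptTensorMk_isPtBimorphism A X).map_smul c a x
      map_zero' := by
        have := (ptTensorMk_isPtBimorphism A X).map_smul 0 0 x
        rwa [zero_smul, zero_smul] at this
      map_add' := fun a b => (ptTensorMk_isPtBimorphism A X).map_add a b x
      map_mul' := fun a b => (ptTensorMk_isPtBimorphism A X).map_mul a b x
      map_star' := fun a => (ptTensorMk_isPtBimorphism A X).map_star a x }
  continuous' := (ptTensorMk_isPtBimorphism A X).continuous.comp (by fun_prop)

/-! ### The three hypotheses on an object -/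

/-- `L` is a partial left adjoint of `R`: there are bijections `Hom(L X, B) ≃ C_*(X, R B)`, natural
in the pointed compact space `X` and in `B`. -/
def IsPartialLeftAdjoint (L : PtCpt.{u} ⥤ ANu ν) (R : ANu ν ⥤ PtTop.{u}) : Prop :=
  ∃ Φ : ∀ (X : PtCpt.{u}) (B : ANu ν), (L.obj X ⟶ B) ≃ (PtCpt.incl.obj X ⟶ R.obj B),
    ∀ (X X' : PtCpt.{u}) (B B' : ANu ν) (h : X' ⟶ X) (g : B ⟶ B') (f : L.obj X ⟶ B),
      Φ X' B' (L.map h ≫ f ≫ g) = PtCpt.incl.map h ≫ Φ X B f ≫ R.map g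

/-- There are homeomorphisms `Hom(A, C_*(X, B)) ≃ C_*(X, Hom(A, B))`, natural in the pointed compact
space `X` and in `B`. -/
def HasNaturalMappingHomeo (A : ANu ν) : Prop :=
  ∃ Φ : ∀ (X : PtCpt.{u}) (B : ANu ν),
      ((homFunctor A).obj (ptMapAlg X B)) ≃ₜ (PtCpt.incl.obj X ⟶ (homFunctor A).obj B),
    ∀ (X X' : PtCpt.{u}) (B B' : ANu ν) (h : X' ⟶ X) (g : B ⟶ B')
      (f : (homFunctor A).obj (ptMapAlg X B)),
      Φ X' B' ((homFunctor A).map (ptMapAlgMap h g) f) =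
        PtCpt.incl.map h ≫ Φ X B f ≫ (homFunctor A).map g

/-- The seminorm extension property: every continuous `C*`-seminorm on the source is the
pullback of a continuous `C*`-seminorm on the target. -/
def HasSEP {A B : ANu ν} (f : A ⟶ B) : Prop :=
  ∀ p : Seminorm ℂ A, IsCStarSeminorm p → Continuous p →
    ∃ q : Seminorm ℂ B, IsCStarSeminorm q ∧ Continuous q ∧ ∀ a, p a = q (f a)

/-- The cone seminorm extension property: `i₁ : A → A ⊠ I` has the seminorm extension property. -/
def HasConeSEP (A : ANu ν) : Prop := HasSEP (ptTensorAt A PtCpt.interval ⟨1⟩)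

/-- The strong cone seminorm extension property. -/
def HasStrongConeSEP (A : ANu ν) : Prop := ∀ X : PtCpt.{u}, HasConeSEP (ptTensor A X)

/-! ### Fibrations and weak equivalences of pointed spaces -/

/-- Serre fibrations: the homotopy lifting property with respect to all cubes. -/
def IsSerreFibration {X Y : PtTop.{u}} (p : X ⟶ Y) : Prop :=
  ∀ (n : ℕ) (f : C(Fin n → unitInterval, X)) (H : C((Fin n → unitInterval) × unitInterval, Y)),
    (∀ t, H (t, 0) = p (f t)) →
      ∃ K : C((Fin n → unitInterval) × unitInterval, X),
        (∀ t, K (t, 0) = f t) ∧ ∀ t, p (K t) = H t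

/-- The map induced on homotopy groups (sets, for `n = 0`) by a continuous map. -/
def homotopyGroupMap {X Y : Type u} [TopologicalSpace X] [TopologicalSpace Y] (f : C(X, Y)) (n : ℕ)
    (x : X) : HomotopyGroup.Pi n X x → HomotopyGroup.Pi n Y (f x) :=
  Quotient.map
    (fun γ => ⟨f.comp γ.1, fun t ht => congrArg f (γ.2 t ht)⟩)
    (fun _ _ h => h.comp_continuousMap f)

/-- Weak homotopy equivalences: isomorphisms on all `π_n`, `n ≥ 0`, for all basepoints. -/
def IsWeakHomotopyEquivalence {X Y : PtTop.{u}} (p : X ⟶ Y) : Prop :=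
  ∀ (n : ℕ) (x : X), Function.Bijective (homotopyGroupMap (PtTop.Hom.toContinuousMap p) n x)

end LmcCStar

/-! ### Cofibrantly generated model structures -/

namespace HomotopicalAlgebra

open CategoryTheory

variable {C : Type*} [Category.{u} C]

/-- `A` is small relative to `W`: for some regular cardinal `κ`, the functor `Hom(A, -)` preserves
the colimits of all continuous `κ`-filtered well-ordered sequences of morphisms in `W`. -/
def IsSmallRelativeTo (A : C) (W : MorphismProperty C) : Prop :=
  ∃ (κ : Cardinal.{u}) (_ : Fact κ.IsRegular),
    ∀ (J : Type u) [LinearOrder J] [SuccOrder J] [OrderBot J] [WellFoundedLT J]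
      [IsCardinalFiltered J κ] (F : J ⥤ C) [F.IsWellOrderContinuous],
      (∀ j, ¬ IsMax j → W (F.map (homOfLE (Order.le_succ j)))) →
        Nonempty (Limits.PreservesColimit F (coyoneda.obj (Opposite.op A)))

/-- Relative `I`-cell complexes: transfinite compositions of pushouts of morphisms in `I`. -/
def relativeCells (I : MorphismProperty C) : MorphismProperty C :=
  MorphismProperty.transfiniteCompositions.{u} I.pushouts

/-- A model structure is cofibrantly generated if there are sets `I` and `J` of morphisms whose
sources are small relative to the relative `I`-cell (resp. `J`-cell) complexes, such that the
trivial fibrations (resp. fibrations) are the morphisms with the right lifting property with respect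
to `I` (resp. `J`). -/
def IsCofibrantlyGenerated (C : Type*) [Category.{u} C] [ModelCategory C] : Prop :=
  ∃ I J : MorphismProperty C,
    MorphismProperty.IsSmall.{u} I ∧ MorphismProperty.IsSmall.{u} J ∧
    (∀ ⦃A B : C⦄ (i : A ⟶ B), I i → IsSmallRelativeTo A (relativeCells I)) ∧
    (∀ ⦃A B : C⦄ (j : A ⟶ B), J j → IsSmallRelativeTo A (relativeCells J)) ∧
    trivialFibrations C = I.rlp ∧ fibrations C = J.rlp

end HomotopicalAlgebra

open CategoryTheory HomotopicalAlgebra LmcCStar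

/-!
The seminorm extension property (`HasSEP`) is what makes cell complexes in `𝔸_ν` manageable. The key
fact is an amalgamation theorem: if `C*`-seminorms on `B` and `C` agree on a common `A`, then `B`
and `C` act on one Hilbert space, compatibly with `A`, with `C` acting isometrically
(`exists_amalgam`). To see this, take universal families of representations of `B` and `C` (the GNS
representations of all positive functionals, `UniversalFamily`). Since positive functionals extend
from `C*`-subalgebras, after passing to sums of sufficiently many copies the two induced
representations of `A` embed into each other, and are therefore unitarily equivalent by the
Schröder-Bernstein argument (`exists_unitary_equiv`). Consequently the morphisms with the seminorm
extension property are stable under cobase change and coproducts; they are stable under transfinite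
composition because a compatible family of seminorms on a chain extends to its colimit
(`exists_seminorm_colimit`).

A morphism with this property is injective, is an embedding, and has an image closed under limits of
`ν`-sequences. Hence the colimit of a chain of such morphisms which is `κ`-filtered, with `κ` larger
than `ν`, is simply the union of its stages (`exists_eq_leg`). This gives the smallness of every
object relative to such cell complexes, and thus the small object argument.

The generating morphisms are `A_i ⊠ (∂Iⁿ)₊ → A_i ⊠ (Iⁿ)₊` and `A_i ⊠ (Iⁿ)₊ → A_i ⊠ (Iⁿ × I)₊`. By the
Yoneda lemma, a natural bijection `Hom(A ⊠ X, B) ≃ C_*(X, Hom(A, B))` of any kind forces the evident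
map to be a bijection (`IsPartialLeftAdjoint.exists_uncurry`), so lifting against the generating
morphisms is topological lifting for the maps `Hom(A_i, p)`. A map is a Serre fibration and a weak
equivalence if and only if it lifts against all `∂Iⁿ ⊆ Iⁿ` (`isWeq_of_hasBoundaryLift`,
`IsWeq.hasBoundaryLift`); thus the two classes of morphisms defined by lifting are the fibrations and
the trivial fibrations. The second kind of generator is a split monomorphism. For the first kind, `Iⁿ`
is the cone over `∂Iⁿ` in radial coordinates, so the inclusion of `A_i ⊠ (∂Iⁿ)₊` in its cone factors
through `A_i ⊠ (Iⁿ)₊`, and the strong cone seminorm extension property applies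
(`hasSEP_cellMap_boundaryIncl`).

Finally, every object is fibrant and has a path object, the algebra of paths
(`rlp_genTrivCof_pathEv`). So a morphism with the left lifting property against fibrations is the
inclusion of a deformation retract, hence a weak equivalence (`isWeq_of_llp`), and the retract
argument yields the model structure (`exists_modelCategory`).
-/

/-! ### The box of a cube and its radial retraction -/

namespace CubeBox

open unitInterval Set

variable {n : ℕ}

/-- The box `Iⁿ × {0} ∪ ∂Iⁿ × I` inside `Iⁿ × I`. -/
def box (n : ℕ) : Set ((Fin n → I) × I) := {z | z.2 = 0 ∨ z.1 ∈ Cube.boundary (Fin n)}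

theorem isClosed_boundary (n : ℕ) : IsClosed (Cube.boundary (Fin n)) := by
  have : Cube.boundary (Fin n) = ⋃ i : Fin n, {y : Fin n → I | y i = 0 ∨ y i = 1} := by
    ext y; simp [Cube.boundary]
  rw [this]
  refine isClosed_iUnion_of_finite fun i => ?_
  exact (isClosed_eq (continuous_apply i) continuous_const).union
    (isClosed_eq (continuous_apply i) continuous_const)

/-- For `z = (x, t)`, the number `λ` such that the ray from the apex `(½, …, ½, 2)` through `z`
leaves the cube, through the box, at the parameter `1 / λ` (the point `z` having parameter `1`). -/
noncomputable def lam (z : (Fin n → I) × I) : ℝ :=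
  max ‖fun i => 2 * (z.1 i : ℝ) - 1‖ ((2 - z.2) / 2)

/-- The ray from the apex `(½, …, ½, 2)` through `z`, with parameter `μ`, clamped to the cube. -/
noncomputable def ray (z : (Fin n → I) × I) (μ : ℝ) : (Fin n → I) × I :=
  (fun i => projIcc 0 1 zero_le_one (1 / 2 + ((z.1 i : ℝ) - 1 / 2) * μ),
    projIcc 0 1 zero_le_one (2 - (2 - z.2) * μ))

theorem continuous_lam : Continuous (lam (n := n)) := by
  unfold lam; fun_prop

theorem continuous_ray : Continuous fun p : ((Fin n → I) × I) × ℝ => ray p.1 p.2 := by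
  unfold ray
  refine Continuous.prodMk (continuous_pi fun i => ?_) ?_ <;>
    exact continuous_projIcc.comp (by fun_prop)

theorem half_le_lam (z : (Fin n → I) × I) : 1 / 2 ≤ lam z :=
  le_max_of_le_right (by have := z.2.2.2; linarith)

theorem lam_pos (z : (Fin n → I) × I) : 0 < lam z := by
  linarith [half_le_lam z]

theorem norm_cube_le (x : Fin n → I) : ‖fun i => 2 * (x i : ℝ) - 1‖ ≤ 1 := by
  rw [pi_norm_le_iff_of_nonneg zero_le_one]
  intro i
  rw [Real.norm_eq_abs, abs_le]
  have := (x i).2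
  constructor <;> linarith [this.1, this.2]

theorem lam_le_one (z : (Fin n → I) × I) : lam z ≤ 1 :=
  max_le (norm_cube_le _) (by have := z.2.2.1; linarith)

theorem norm_cube_of_mem_boundary {x : Fin n → I} (hx : x ∈ Cube.boundary (Fin n)) :
    ‖fun i => 2 * (x i : ℝ) - 1‖ = 1 := by
  refine le_antisymm (norm_cube_le x) ?_
  obtain ⟨i, hi⟩ := hx
  refine le_trans ?_ (norm_le_pi_norm (fun i => 2 * (x i : ℝ) - 1) i)
  rcases hi with hi | hi <;> norm_num [hi]

theorem lam_of_mem_box {z : (Fin n → I) × I} (hz : z ∈ box n) : lam z = 1 := by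
  refine le_antisymm (lam_le_one z) ?_
  rcases hz with hz | hz
  · exact le_max_of_le_right (by simp [hz])
  · exact le_max_of_le_left (norm_cube_of_mem_boundary hz).ge

theorem ray_one (z : (Fin n → I) × I) : ray z 1 = z := by
  ext i <;> simp [ray]

theorem ray_mem_box (z : (Fin n → I) × I) : ray z (1 / lam z) ∈ box n := by
  have hl := lam_pos z
  rcases max_choice ‖fun i => 2 * (z.1 i : ℝ) - 1‖ ((2 - z.2) / 2) with h | h
  · change lam z = _ at h
    right
    by_contra hc
    have hlt : ‖fun i => 2 * (z.1 i : ℝ) - 1‖ < lam z := by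
      rw [pi_norm_lt_iff hl]
      intro i
      by_contra hi
      apply hc
      refine ⟨i, ?_⟩
      rw [not_lt, Real.norm_eq_abs, le_abs'] at hi
      rcases hi with hi | hi
      · left
        refine projIcc_eq_zero.2 ?_
        rw [mul_one_div, ← sub_nonpos, show 1 / 2 + ((z.1 i : ℝ) - 1 / 2) / lam z - 0 =
          (lam z + (2 * (z.1 i : ℝ) - 1)) / (2 * lam z) by field_simp; ring]
        exact div_nonpos_of_nonpos_of_nonneg (by linarith) (by linarith)
      · right
        refine projIcc_eq_one.2 ?_
        rw [mul_one_div, ← sub_nonneg, show 1 / 2 + ((z.1 i : ℝ) - 1 / 2) / lam z - 1 =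
          ((2 * (z.1 i : ℝ) - 1) - lam z) / (2 * lam z) by field_simp; ring]
        exact div_nonneg (by linarith) (by linarith)
    linarith
  · change lam z = _ at h
    left
    refine projIcc_eq_zero.2 (le_of_eq ?_)
    rw [h]
    have : (2 : ℝ) - z.2 ≠ 0 := by linarith [z.2.2.2]
    field_simp
    ring

/-- The radial retraction of the cube onto the box. -/
noncomputable def boxRetract (z : (Fin n → I) × I) : (Fin n → I) × I := ray z (1 / lam z)

theorem continuous_boxRetract : Continuous (boxRetract (n := n)) :=
  continuous_ray.comp (continuous_id.prodMk
    (continuous_const.div continuous_lam fun z => (lam_pos z).ne'))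

theorem boxRetract_mem (z : (Fin n → I) × I) : boxRetract z ∈ box n := ray_mem_box z

theorem boxRetract_of_mem {z : (Fin n → I) × I} (hz : z ∈ box n) : boxRetract z = z := by
  rw [boxRetract, lam_of_mem_box hz, div_one, ray_one]

variable {X Y : Type*} [TopologicalSpace X] [TopologicalSpace Y]

theorem exists_extend_box (a : (Fin n → I) × I → X) (ha : ContinuousOn a (box n)) :
    ∃ F : C((Fin n → I) × I, X), ∀ z ∈ box n, F z = a z :=
  ⟨⟨fun z => a (boxRetract z), ha.comp_continuous continuous_boxRetract boxRetract_mem⟩,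
    fun z hz => congrArg a (boxRetract_of_mem hz)⟩

theorem continuousOn_box {a : (Fin n → I) × I → X}
    (h0 : Continuous fun x : Fin n → I => a (x, 0))
    (h1 : ContinuousOn a {z | z.1 ∈ Cube.boundary (Fin n)}) : ContinuousOn a (box n) := by
  have : box n = {z : (Fin n → I) × I | z.2 = 0} ∪ {z | z.1 ∈ Cube.boundary (Fin n)} := rfl
  rw [this]
  refine ContinuousOn.union_of_isClosed ?_ h1 (isClosed_eq continuous_snd continuous_const)
    ((isClosed_boundary n).preimage continuous_fst)
  refine (h0.comp continuous_fst).continuousOn.congr fun _ hz => ?_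
  exact congrArg a (Prod.ext rfl hz)

/-- The homotopy extension property of `∂Iⁿ ⊆ Iⁿ`. -/
theorem exists_homotopy_extension (f : C(Fin n → I, X)) (h : (Fin n → I) × I → X)
    (hh : ContinuousOn h {z | z.1 ∈ Cube.boundary (Fin n)})
    (h0 : ∀ x ∈ Cube.boundary (Fin n), h (x, 0) = f x) :
    ∃ F : C((Fin n → I) × I, X), (∀ x, F (x, 0) = f x) ∧
      ∀ x ∈ Cube.boundary (Fin n), ∀ t, F (x, t) = h (x, t) := by
  classical
  obtain ⟨F, hF⟩ := exists_extend_box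
    (fun z => if z.1 ∈ Cube.boundary (Fin n) then h z else f z.1) (continuousOn_box (n := n)
      (by
        refine f.continuous.congr fun x => ?_
        by_cases hx : x ∈ Cube.boundary (Fin n) <;> simp [hx, h0])
      (hh.congr fun z hz => if_pos hz))
  refine ⟨F, fun x => ?_, fun x hx t => ?_⟩
  · rw [hF _ (Or.inl rfl)]
    by_cases hx : x ∈ Cube.boundary (Fin n) <;> simp [hx, h0]
  · rw [hF _ (Or.inr hx)]
    simp [hx]

/-! ### Lifting properties against cubes -/

/-- The homotopy lifting property with respect to the cube `Iⁿ`. -/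
def HasHomotopyLift (p : C(X, Y)) (n : ℕ) : Prop :=
  ∀ (f : C(Fin n → I, X)) (H : C((Fin n → I) × I, Y)), (∀ t, H (t, 0) = p (f t)) →
    ∃ K : C((Fin n → I) × I, X), (∀ t, K (t, 0) = f t) ∧ ∀ t, p (K t) = H t

/-- The right lifting property with respect to `∂Iⁿ ⊆ Iⁿ`; a map on `∂Iⁿ` is encoded as a
function on `Iⁿ` which is continuous on `∂Iⁿ`. -/
def HasBoundaryLift (p : C(X, Y)) (n : ℕ) : Prop :=
  ∀ a : (Fin n → I) → X, ContinuousOn a (Cube.boundary (Fin n)) → ∀ b : C(Fin n → I, Y),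
    (∀ x ∈ Cube.boundary (Fin n), p (a x) = b x) →
    ∃ c : C(Fin n → I, X), (∀ x ∈ Cube.boundary (Fin n), c x = a x) ∧ ∀ x, p (c x) = b x

/-- The homeomorphism `Iⁿ⁺¹ ≅ Iⁿ × I` splitting off the first coordinate. -/
def splitFirst (n : ℕ) : (Fin (n + 1) → I) ≃ₜ (Fin n → I) × I where
  toFun x := (fun i => x i.succ, x 0)
  invFun z := Fin.cons z.2 z.1
  left_inv x := Fin.cons_self_tail x
  right_inv z := by simp
  continuous_toFun := by fun_prop
  continuous_invFun := Continuous.finCons (A := fun _ => I) continuous_snd continuous_fst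

/-- The boundary of `Iⁿ × I`. -/
def prodBoundary (n : ℕ) : Set ((Fin n → I) × I) := {z | z ∈ box n ∨ z.2 = 1}

theorem splitFirst_mem (x : Fin (n + 1) → I) :
    splitFirst n x ∈ prodBoundary n ↔ x ∈ Cube.boundary (Fin (n + 1)) := by
  have : x ∈ Cube.boundary (Fin (n + 1)) ↔
      (x 0 = 0 ∨ x 0 = 1) ∨ (fun i => x i.succ) ∈ Cube.boundary (Fin n) := Fin.exists_fin_succ
  rw [this]
  change (x 0 = 0 ∨ _) ∨ x 0 = 1 ↔ _
  tauto

theorem splitFirst_symm_mem (z : (Fin n → I) × I) :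
    (splitFirst n).symm z ∈ Cube.boundary (Fin (n + 1)) ↔ z ∈ prodBoundary n := by
  rw [← splitFirst_mem, Homeomorph.apply_symm_apply]

theorem HasBoundaryLift.prod {p : C(X, Y)} (hp : HasBoundaryLift p (n + 1))
    (a : (Fin n → I) × I → X) (ha : ContinuousOn a (prodBoundary n)) (b : C((Fin n → I) × I, Y))
    (hab : ∀ z ∈ prodBoundary n, p (a z) = b z) :
    ∃ c : C((Fin n → I) × I, X), (∀ z ∈ prodBoundary n, c z = a z) ∧ ∀ z, p (c z) = b z := by
  obtain ⟨c, h1, h2⟩ := hp (a ∘ splitFirst n)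
    (ha.comp (splitFirst n).continuous.continuousOn fun x hx => (splitFirst_mem x).2 hx)
    (b.comp ⟨_, (splitFirst n).continuous⟩) fun x hx => hab _ ((splitFirst_mem x).2 hx)
  refine ⟨c.comp ⟨_, (splitFirst n).symm.continuous⟩, fun z hz => ?_, fun z => ?_⟩
  · simpa using h1 _ ((splitFirst_symm_mem z).2 hz)
  · simpa using h2 ((splitFirst n).symm z)

theorem hasBoundaryLift_succ {p : C(X, Y)}
    (h : ∀ a : (Fin n → I) × I → X, ContinuousOn a (prodBoundary n) →
      ∀ b : C((Fin n → I) × I, Y), (∀ z ∈ prodBoundary n, p (a z) = b z) →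
      ∃ c : C((Fin n → I) × I, X), (∀ z ∈ prodBoundary n, c z = a z) ∧ ∀ z, p (c z) = b z) :
    HasBoundaryLift p (n + 1) := by
  intro a ha b hab
  obtain ⟨c, h1, h2⟩ := h (a ∘ (splitFirst n).symm)
    (ha.comp (splitFirst n).symm.continuous.continuousOn fun z hz => (splitFirst_symm_mem z).2 hz)
    (b.comp ⟨_, (splitFirst n).symm.continuous⟩) fun z hz => hab _ ((splitFirst_symm_mem z).2 hz)
  refine ⟨c.comp ⟨_, (splitFirst n).continuous⟩, fun z hz => ?_, fun z => ?_⟩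
  · simpa using h1 _ ((splitFirst_mem z).2 hz)
  · simpa using h2 (splitFirst n z)

/-- A map with the homotopy lifting property for `Iⁿ⁺¹` has the right lifting property with respect
to the inclusion of the box into `Iⁿ × I`: lift the homotopy which moves the points of the cube
along the rays away from the box, and stop at the moment when the point itself is reached. -/
theorem HasHomotopyLift.box {p : C(X, Y)} (hp : HasHomotopyLift p (n + 1))
    (a : (Fin n → I) × I → X) (ha : ContinuousOn a (box n)) (g : C((Fin n → I) × I, Y))
    (hag : ∀ z ∈ box n, p (a z) = g z) :
    ∃ c : C((Fin n → I) × I, X), (∀ z ∈ box n, c z = a z) ∧ ∀ z, p (c z) = g z := by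
  let e := splitFirst n
  have hinv : Continuous fun z : (Fin n → I) × I => 1 / lam z :=
    continuous_const.div continuous_lam fun z => (lam_pos z).ne'
  have hH : Continuous fun w : (Fin (n + 1) → I) × I =>
      ray (e w.1) (max 1 (1 / lam (e w.1) - w.2)) := by
    refine continuous_ray.comp (f := fun w : (Fin (n + 1) → I) × I =>
      (e w.1, max 1 (1 / lam (e w.1) - (w.2 : ℝ)))) ?_
    have h1 : Continuous fun w : (Fin (n + 1) → I) × I => 1 / lam (e w.1) :=
      hinv.comp (e.continuous.comp continuous_fst)
    have h2 : Continuous fun w : (Fin (n + 1) → I) × I => e w.1 :=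
      e.continuous.comp continuous_fst
    fun_prop
  have hone : ∀ z : (Fin n → I) × I, 1 ≤ 1 / lam z := fun z =>
    (one_le_div (lam_pos z)).2 (lam_le_one z)
  have htwo : ∀ z : (Fin n → I) × I, 1 / lam z ≤ 2 := fun z => by
    rw [div_le_iff₀ (lam_pos z)]; linarith [half_le_lam z]
  obtain ⟨K, hK0, hK⟩ := hp
    ⟨fun x => a (boxRetract (e x)), ha.comp_continuous
      (continuous_boxRetract.comp e.continuous) fun x => boxRetract_mem _⟩
    (g.comp ⟨_, hH⟩) fun x => by
      simp only [ContinuousMap.comp_apply, ContinuousMap.coe_mk, Set.Icc.coe_zero, sub_zero,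
        max_eq_right (hone _)]
      exact (hag _ (boxRetract_mem (e x))).symm
  let φ : (Fin n → I) × I → I := fun z => ⟨1 / lam z - 1, by linarith [hone z],
    by linarith [htwo z]⟩
  have hφ : Continuous φ := Continuous.subtype_mk (hinv.sub continuous_const) _
  refine ⟨⟨fun z => K (e.symm z, φ z), by fun_prop⟩, fun z hz => ?_, fun z => ?_⟩
  · have h0 : φ z = 0 := Subtype.ext (by simp [φ, lam_of_mem_box hz])
    change K (e.symm z, φ z) = a z
    rw [h0, hK0]
    simp [boxRetract_of_mem hz]
  · change p (K (e.symm z, φ z)) = g z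
    rw [hK]
    simp [φ, ray_one]

end CubeBox

namespace CubeBox

open unitInterval Set

variable {n : ℕ} {X Y : Type*} [TopologicalSpace X] [TopologicalSpace Y]

theorem continuousOn_prodBoundary {a : (Fin n → I) × I → X}
    (h0 : Continuous fun x : Fin n → I => a (x, 0))
    (hb : ContinuousOn a {z | z.1 ∈ Cube.boundary (Fin n)})
    (h1 : Continuous fun x : Fin n → I => a (x, 1)) : ContinuousOn a (prodBoundary n) := by
  have : prodBoundary n = box n ∪ {z | z.2 = 1} := rfl
  rw [this]
  refine ContinuousOn.union_of_isClosed (continuousOn_box h0 hb) ?_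
    ((isClosed_eq continuous_snd continuous_const).union
      ((isClosed_boundary n).preimage continuous_fst))
    (isClosed_eq continuous_snd continuous_const)
  exact (h1.comp continuous_fst).continuousOn.congr fun _ hz => congrArg a (Prod.ext rfl hz)

/-- Lifting against `∂Iⁿ ⊆ Iⁿ` in all dimensions gives lifting against the box: lift over the lid,
then over the interior. -/
theorem HasBoundaryLift.box {p : C(X, Y)} (hp : ∀ n, HasBoundaryLift p n)
    (a : (Fin n → I) × I → X) (ha : ContinuousOn a (box n)) (g : C((Fin n → I) × I, Y))
    (hag : ∀ z ∈ CubeBox.box n, p (a z) = g z) :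
    ∃ c : C((Fin n → I) × I, X), (∀ z ∈ CubeBox.box n, c z = a z) ∧ ∀ z, p (c z) = g z := by
  classical
  obtain ⟨l, hl, hl'⟩ := hp n (fun x => a (x, 1))
    (ha.comp (Continuous.continuousOn (by fun_prop)) fun x hx => Or.inr hx)
    (g.comp ⟨fun x => (x, 1), by fun_prop⟩) fun x hx => hag _ (Or.inr hx)
  have key : ∀ z ∈ CubeBox.box n, (if z.2 = 1 then l z.1 else a z) = a z := by
    rintro ⟨x, t⟩ hz
    by_cases ht : t = 1
    · subst ht
      rcases hz with hz | hz
      · exact absurd hz one_ne_zero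
      · simp [hl x hz]
    · simp [ht]
  obtain ⟨c, hc, hc'⟩ := (hp (n + 1)).prod (fun z => if z.2 = 1 then l z.1 else a z)
    (by
      have h2 := ha.congr key
      refine continuousOn_prodBoundary (h2.comp_continuous (by fun_prop) fun x => Or.inl rfl)
        (h2.mono fun z hz => Or.inr hz) ?_
      simpa using l.continuous) g (by
      rintro z (hz | hz)
      · rw [key z hz, hag z hz]
      · have hz' : z.2 = 1 := hz
        rw [if_pos hz']
        refine (hl' z.1).trans ?_
        change g (z.1, 1) = g z
        rw [← hz'])
  exact ⟨c, fun z hz => (hc z (Or.inl hz)).trans (key z hz), hc'⟩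

/-- The inclusion of `Iⁿ × {0}` in `Iⁿ × I` is a retract of the inclusion of the box. -/
theorem HasBoundaryLift.hasHomotopyLift {p : C(X, Y)} (hp : ∀ n, HasBoundaryLift p n) (n : ℕ) :
    HasHomotopyLift p n := by
  intro f H hfH
  let r : (Fin n → I) × I → (Fin n → I) × I := fun z =>
    (fun i => projIcc 0 1 zero_le_one (1 / 2 + ((z.1 i : ℝ) - 1 / 2) * 2),
      projIcc 0 1 zero_le_one (z.2 * min 1 (2 - 2 * ‖fun i => 2 * (z.1 i : ℝ) - 1‖)))
  have hr : Continuous r := by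
    refine Continuous.prodMk (continuous_pi fun i => ?_) ?_ <;>
      exact continuous_projIcc.comp (by fun_prop)
  let s : (Fin n → I) × I → (Fin n → I) × I := fun z =>
    (fun i => projIcc 0 1 zero_le_one (1 / 2 + ((z.1 i : ℝ) - 1 / 2) / 2), z.2)
  have hs : Continuous s := by
    refine Continuous.prodMk (continuous_pi fun i => ?_) continuous_snd
    exact continuous_projIcc.comp (by fun_prop)
  have hrbox : ∀ z ∈ CubeBox.box n, (r z).2 = 0 := by
    rintro z (hz | hz)
    · exact projIcc_eq_zero.2 (by simp [hz])
    · refine projIcc_eq_zero.2 ?_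
      rw [norm_cube_of_mem_boundary hz]
      norm_num
  have hs' : ∀ z : (Fin n → I) × I, ∀ i, ((s z).1 i : ℝ) = 1 / 2 + ((z.1 i : ℝ) - 1 / 2) / 2 := by
    intro z i
    have := (z.1 i).2
    exact congrArg Subtype.val (projIcc_of_mem zero_le_one
      (show 1 / 2 + ((z.1 i : ℝ) - 1 / 2) / 2 ∈ Icc (0 : ℝ) 1 from
        ⟨by linarith [this.1], by linarith [this.2]⟩))
  have hrs : ∀ z, r (s z) = z := by
    intro z
    have hn : ‖fun i => 2 * ((s z).1 i : ℝ) - 1‖ ≤ 1 / 2 := by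
      rw [pi_norm_le_iff_of_nonneg (by norm_num)]
      intro i
      have := (z.1 i).2
      rw [hs', Real.norm_eq_abs, abs_le]
      constructor <;> linarith [this.1, this.2]
    refine Prod.ext (funext fun i => ?_) ?_
    · change projIcc 0 1 zero_le_one (1 / 2 + (((s z).1 i : ℝ) - 1 / 2) * 2) = z.1 i
      rw [hs', show 1 / 2 + (1 / 2 + ((z.1 i : ℝ) - 1 / 2) / 2 - 1 / 2) * 2 = z.1 i by ring]
      exact projIcc_val _ _
    · change projIcc 0 1 zero_le_one
        ((z.2 : ℝ) * min 1 (2 - 2 * ‖fun i => 2 * ((s z).1 i : ℝ) - 1‖)) = z.2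
      rw [min_eq_left (by linarith), mul_one]
      exact projIcc_val _ _
  obtain ⟨c, hc, hc'⟩ := HasBoundaryLift.box hp (fun z => f (r z).1)
    (by fun_prop) (H.comp ⟨r, hr⟩) fun z hz => by
      rw [← hfH]
      exact congrArg H (Prod.ext rfl (hrbox z hz).symm)
  refine ⟨c.comp ⟨s, hs⟩, fun t => ?_, fun z => ?_⟩
  · refine (hc (s (t, 0)) (Or.inl rfl)).trans ?_
    simp [hrs]
  · refine (hc' (s z)).trans ?_
    simp [hrs]

/-- Pairs of spaces which are homeomorphic to `(Iⁿ, ∂Iⁿ)`. -/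
def IsCubePair {Z : Type*} [TopologicalSpace Z] (D : Set Z) (n : ℕ) : Prop :=
  ∃ e : Z ≃ₜ (Fin n → I), ∀ z, e z ∈ Cube.boundary (Fin n) ↔ z ∈ D

theorem isCubePair_cube (n : ℕ) : IsCubePair (Cube.boundary (Fin n)) n :=
  ⟨Homeomorph.refl _, fun _ => Iff.rfl⟩

theorem isCubePair_prod (n : ℕ) : IsCubePair (prodBoundary n) (n + 1) :=
  ⟨(splitFirst n).symm, splitFirst_symm_mem⟩

section Pair

variable {Z : Type*} [TopologicalSpace Z] {D : Set Z}

theorem IsCubePair.exists_homotopy_extension (hD : IsCubePair D n) (f : C(Z, X)) (h : Z × I → X)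
    (hh : ContinuousOn h {z | z.1 ∈ D}) (h0 : ∀ x ∈ D, h (x, 0) = f x) :
    ∃ F : C(Z × I, X), (∀ x, F (x, 0) = f x) ∧ ∀ x ∈ D, ∀ t, F (x, t) = h (x, t) := by
  obtain ⟨e, he⟩ := hD
  have he' : ∀ x, e.symm x ∈ D ↔ x ∈ Cube.boundary (Fin n) := fun x => by
    rw [← he, e.apply_symm_apply]
  obtain ⟨F, hF, hF'⟩ := CubeBox.exists_homotopy_extension (f.comp ⟨_, e.symm.continuous⟩)
    (fun z => h (e.symm z.1, z.2))
    (hh.comp (Continuous.continuousOn (by fun_prop)) fun z hz => (he' z.1).2 hz)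
    (fun x hx => h0 _ ((he' x).2 hx))
  refine ⟨⟨fun z => F (e z.1, z.2), by fun_prop⟩, fun x => ?_, fun x hx t => ?_⟩
  · simpa using hF (e x)
  · simpa using hF' (e x) ((he x).2 hx) t

/-- For a Serre fibration, solvability of a lifting problem against `(Iⁿ, ∂Iⁿ)` only depends on the
homotopy class of the problem. -/
theorem IsCubePair.lift_of_homotopy (hD : IsCubePair D n) {p : C(X, Y)}
    (hp : HasHomotopyLift p (n + 1))
    (A : Z × I → X) (hA : ContinuousOn A {z | z.1 ∈ D}) (B : C(Z × I, Y))
    (hAB : ∀ z, z.1 ∈ D → p (A z) = B z)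
    (c₁ : C(Z, X)) (hc₁ : ∀ x ∈ D, c₁ x = A (x, 1)) (hc₁' : ∀ x, p (c₁ x) = B (x, 1)) :
    ∃ c : C(Z, X), (∀ x ∈ D, c x = A (x, 0)) ∧ ∀ x, p (c x) = B (x, 0) := by
  classical
  obtain ⟨e, he⟩ := hD
  have he' : ∀ x, e.symm x ∈ D ↔ x ∈ Cube.boundary (Fin n) := fun x => by
    rw [← he, e.apply_symm_apply]
  let a : (Fin n → I) × I → X := fun z =>
    if z.1 ∈ Cube.boundary (Fin n) then A (e.symm z.1, σ z.2) else c₁ (e.symm z.1)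
  obtain ⟨c, hc, hc'⟩ := hp.box a (continuousOn_box
    ((c₁.continuous.comp e.symm.continuous).congr fun x => by
      by_cases hx : x ∈ Cube.boundary (Fin n)
      · simp [a, hx, hc₁ _ ((he' x).2 hx)]
      · simp [a, hx])
    (ContinuousOn.congr (hA.comp (Continuous.continuousOn (f := fun z : (Fin n → I) × I =>
      (e.symm z.1, σ z.2)) (by fun_prop)) fun z hz => (he' z.1).2 hz) fun z hz => if_pos hz))
    ⟨fun z => B (e.symm z.1, σ z.2), by fun_prop⟩ (by
      rintro ⟨x, t⟩ hz
      by_cases hx : x ∈ Cube.boundary (Fin n)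
      · simp [a, hx, hAB (e.symm x, σ t) ((he' x).2 hx)]
      · rcases hz with hz | hz
        · have : t = 0 := hz
          subst this
          simp [a, hx, hc₁']
        · exact absurd hz hx)
  refine ⟨⟨fun z => c (e z, 1), by fun_prop⟩, fun x hx => ?_, fun x => ?_⟩
  · have := hc (e x, 1) (Or.inr ((he x).2 hx))
    simpa [a, (he x).2 hx] using this
  · simpa using hc' (e x, 1)

end Pair

end CubeBox

namespace CubeBox

open unitInterval Set Topology.Homotopy LmcCStar

variable {n : ℕ} {X Y Z : Type u} [TopologicalSpace X] [TopologicalSpace Y] [TopologicalSpace Z]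

/-! ### Weak homotopy equivalences -/

/-- The image of a generalized loop under a continuous map. -/
def genLoopMap (p : C(X, Y)) {x : X} (γ : Ω^ (Fin n) X x) : Ω^ (Fin n) Y (p x) :=
  ⟨p.comp γ.1, fun t ht => congrArg p (γ.2 t ht)⟩

theorem genLoop_homotopic_iff {x : X} {γ γ' : Ω^ (Fin n) X x} :
    GenLoop.Homotopic γ γ' ↔ ∃ F : C((Fin n → I) × I, X), (∀ t, F (t, 0) = γ t) ∧
      (∀ t, F (t, 1) = γ' t) ∧ ∀ t ∈ Cube.boundary (Fin n), ∀ s, F (t, s) = x := by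
  constructor
  · rintro ⟨H⟩
    refine ⟨⟨fun z => H (z.2, z.1), by fun_prop⟩, fun t => H.apply_zero t, fun t => H.apply_one t,
      fun t ht s => ?_⟩
    exact (H.eq_fst s ht).trans (γ.2 t ht)
  · rintro ⟨F, h0, h1, hF⟩
    exact ⟨{ toFun := fun z => F (z.2, z.1)
             map_zero_left := h0
             map_one_left := h1
             prop' := fun s t ht => (hF t ht s).trans (γ.2 t ht).symm }⟩

theorem bijective_homotopyGroupMap_iff (p : C(X, Y)) (n : ℕ) (x : X) :
    Function.Bijective (homotopyGroupMap p n x) ↔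
      (∀ α α' : Ω^ (Fin n) X x, GenLoop.Homotopic (genLoopMap p α) (genLoopMap p α') →
        GenLoop.Homotopic α α') ∧
      ∀ β : Ω^ (Fin n) Y (p x), ∃ α : Ω^ (Fin n) X x, GenLoop.Homotopic (genLoopMap p α) β := by
  refine and_congr ⟨fun h α α' hα => ?_, fun h => ?_⟩ ⟨fun h β => ?_, fun h => ?_⟩
  · exact Quotient.exact (h (a₁ := ⟦α⟧) (a₂ := ⟦α'⟧) (Quotient.sound hα))
  · rintro ⟨α⟩ ⟨α'⟩ hα
    exact Quotient.sound (h α α' (Quotient.exact hα))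
  · obtain ⟨⟨α⟩, hα⟩ := h ⟦β⟧
    exact ⟨α, Quotient.exact hα⟩
  · rintro ⟨β⟩
    obtain ⟨α, hα⟩ := h β
    exact ⟨⟦α⟧, Quotient.sound hα⟩

/-- A map inducing bijections on all homotopy groups (sets, in degree `0`). -/
def IsWeq (p : C(X, Y)) : Prop := ∀ n x, Function.Bijective (homotopyGroupMap p n x)

theorem IsWeq.inj {p : C(X, Y)} (hp : IsWeq p) {x : X} {α α' : Ω^ (Fin n) X x}
    (h : GenLoop.Homotopic (genLoopMap p α) (genLoopMap p α')) : GenLoop.Homotopic α α' :=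
  ((bijective_homotopyGroupMap_iff p n x).1 (hp n x)).1 α α' h

theorem IsWeq.surj {p : C(X, Y)} (hp : IsWeq p) {x : X} (β : Ω^ (Fin n) Y (p x)) :
    ∃ α : Ω^ (Fin n) X x, GenLoop.Homotopic (genLoopMap p α) β :=
  ((bijective_homotopyGroupMap_iff p n x).1 (hp n x)).2 β

/-- A map with the right lifting property with respect to the inclusions `∂Iⁿ ⊆ Iⁿ` is a weak
homotopy equivalence. -/
theorem isWeq_of_hasBoundaryLift {p : C(X, Y)} (hp : ∀ n, HasBoundaryLift p n) : IsWeq p := by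
  classical
  intro n x
  rw [bijective_homotopyGroupMap_iff]
  constructor
  · intro α α' h
    rw [genLoop_homotopic_iff] at h ⊢
    obtain ⟨F, h0, h1, hF⟩ := h
    let a : (Fin n → I) × I → X := fun z =>
      if z.2 = 0 then α z.1 else if z.2 = 1 then α' z.1 else x
    have hab : ∀ z : (Fin n → I) × I, z.1 ∈ Cube.boundary (Fin n) → a z = x := by
      intro z hz
      simp only [a]
      split_ifs
      · exact α.2 _ hz
      · exact α'.2 _ hz
      · rfl
    obtain ⟨c, hc, -⟩ := (hp (n + 1)).prod a
      (continuousOn_prodBoundary (α.1.continuous.congr fun t => by simp [a])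
        (continuousOn_const.congr hab) (α'.1.continuous.congr fun t => by simp [a])) F (by
        rintro ⟨t, s⟩ ((hz | hz) | hz)
        · have : s = 0 := hz
          subst this
          exact (congrArg p (if_pos rfl)).trans (h0 t).symm
        · rw [hab _ hz, hF t hz]
        · have : s = 1 := hz
          subst this
          exact (congrArg p ((if_neg one_ne_zero).trans (if_pos rfl))).trans (h1 t).symm)
    refine ⟨c, fun t => ?_, fun t => ?_, fun t ht s => ?_⟩
    · rw [hc _ (Or.inl (Or.inl rfl))]; simp [a]
    · rw [hc _ (Or.inr rfl)]; simp [a]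
    · rw [hc _ (Or.inl (Or.inr ht)), hab _ ht]
  · intro β
    obtain ⟨c, hc, hc'⟩ := hp n (fun _ => x) continuousOn_const β.1 fun t ht => (β.2 t ht).symm
    refine ⟨⟨c, hc⟩, ?_⟩
    have : genLoopMap p (⟨c, hc⟩ : Ω^ (Fin n) X x) = β := GenLoop.ext _ _ hc'
    rw [this]

/-- The straight-line contraction of `Iⁿ × I` to its corner `0`. -/
noncomputable def contr (z : (Fin n → I) × I) (s : I) : (Fin n → I) × I :=
  (fun i => projIcc 0 1 zero_le_one ((z.1 i : ℝ) * (1 - s)), projIcc 0 1 zero_le_one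
    ((z.2 : ℝ) * (1 - s)))

theorem continuous_contr : Continuous fun w : ((Fin n → I) × I) × I => contr w.1 w.2 := by
  refine Continuous.prodMk (continuous_pi fun i => ?_) ?_ <;>
    exact continuous_projIcc.comp (by fun_prop)

theorem contr_zero (z : (Fin n → I) × I) : contr z 0 = z := by
  ext i <;> simp [contr]

theorem contr_one (z : (Fin n → I) × I) : contr z 1 = (fun _ => 0, 0) := by
  ext i <;> simp [contr]

/-- A lifting problem against `(Iⁿ, ∂Iⁿ)` can be solved for a Serre fibration which is a weak
equivalence once the map on the boundary extends over the cube: contracting the cube, one reduces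
to the case where the map on the boundary is constant. -/
theorem IsWeq.lift_of_extends {p : C(X, Y)} (hw : IsWeq p) (hp : ∀ n, HasHomotopyLift p n)
    (c : C(Fin n → I, X)) (b : C(Fin n → I, Y)) (hcb : ∀ x ∈ Cube.boundary (Fin n), p (c x) = b x) :
    ∃ d : C(Fin n → I, X), (∀ x ∈ Cube.boundary (Fin n), d x = c x) ∧ ∀ x, p (d x) = b x := by
  let A : C((Fin n → I) × I, X) := ⟨fun z => c (contr (z.1, 0) z.2).1, by
    have : Continuous fun z : (Fin n → I) × I => (contr (z.1, 0) z.2).1 :=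
      continuous_fst.comp (continuous_contr.comp
        (f := fun z : (Fin n → I) × I => ((z.1, (0 : I)), z.2)) (by fun_prop))
    fun_prop⟩
  have hA0 : ∀ x, A (x, 0) = c x := fun x => by simp [A, contr_zero]
  have hA1 : ∀ x, A (x, 1) = c (fun _ => 0) := fun x => by simp [A, contr_one]
  obtain ⟨B, hB0, hB⟩ := exists_homotopy_extension b (fun z => p (A z)) (by fun_prop)
    (fun x hx => by rw [hA0, hcb x hx])
  obtain ⟨α, hα⟩ := hw.surj (x := c fun _ => 0) (n := n)
    ⟨B.comp ⟨fun x => (x, 1), by fun_prop⟩, fun x hx => by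
      simp [hB x hx, hA1]⟩
  rw [genLoop_homotopic_iff] at hα
  obtain ⟨F, hF0, hF1, hF⟩ := hα
  obtain ⟨e, he, he'⟩ := (isCubePair_cube n).lift_of_homotopy (hp (n + 1))
    (fun _ => c (fun _ => 0)) continuousOn_const (F.comp ⟨fun z => (z.1, σ z.2), by fun_prop⟩)
    (fun z hz => (hF z.1 hz _).symm) α.1 (fun x hx => α.2 x hx) (fun x => by
      change p (α x) = F (x, σ 1)
      rw [unitInterval.symm_one]
      exact (hF0 x).symm)
  obtain ⟨d, hd, hd'⟩ := (isCubePair_cube n).lift_of_homotopy (hp (n + 1)) A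
    A.continuous.continuousOn B (fun z hz => (hB z.1 hz z.2).symm) e
    (fun x hx => by rw [he x hx, hA1]) (fun x => by
      have := he' x
      simp only [ContinuousMap.comp_apply, ContinuousMap.coe_mk, unitInterval.symm_zero, hF1] at this
      exact this)
  exact ⟨d, fun x hx => by rw [hd x hx, hA0], fun x => by rw [hd', hB0]⟩

/-- A Serre fibration which is a weak homotopy equivalence has the right lifting property with
respect to `∂Iⁿ ⊆ Iⁿ`. In positive dimension, the box inside the boundary is contracted first, so
that the boundary map becomes a loop on the lid; it is null homotopic by injectivity of `π_*`. -/
theorem IsWeq.hasBoundaryLift [Nonempty X] {p : C(X, Y)} (hw : IsWeq p)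
    (hp : ∀ n, HasHomotopyLift p n) (n : ℕ) : HasBoundaryLift p n := by
  classical
  rcases n with _ | n
  · intro a ha b hab
    obtain ⟨x⟩ := ‹Nonempty X›
    have hemp : ∀ x, x ∉ Cube.boundary (Fin 0) := fun x ⟨i, _⟩ => i.elim0
    obtain ⟨α, hα⟩ := hw.surj (n := 0) (x := x) ⟨b, fun x hx => absurd hx (hemp x)⟩
    rw [genLoop_homotopic_iff] at hα
    obtain ⟨F, hF0, hF1, -⟩ := hα
    obtain ⟨d, -, hd'⟩ := (isCubePair_cube 0).lift_of_homotopy (hp 1) (fun _ => x)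
      continuousOn_const (F.comp ⟨fun z => (z.1, σ z.2), by fun_prop⟩)
      (fun z hz => absurd hz (hemp _)) α.1 (fun x hx => absurd hx (hemp x)) (fun y => by
        change p (α y) = F (y, σ 1)
        rw [unitInterval.symm_one]
        exact (hF0 y).symm)
    refine ⟨d, fun x hx => absurd hx (hemp x), fun y => ?_⟩
    rw [hd']
    change F (y, σ 0) = b y
    rw [unitInterval.symm_zero]
    exact hF1 y
  · -- `A` is the homotopy which contracts the box along `contr` and extends over the lid; `B` is
    -- an extension of its image in `Y` to the cube, starting at `b`.
    refine hasBoundaryLift_succ fun a ha b hab => ?_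
    obtain ⟨a', ha'⟩ := exists_extend_box a (ha.mono fun z hz => Or.inl hz)
    obtain ⟨l, hl0, hl⟩ := exists_homotopy_extension (n := n) (X := X)
      ⟨fun x => a (x, 1), ha.comp_continuous (by fun_prop) fun x => Or.inr rfl⟩
      (fun z => a' (contr (z.1, 1) z.2))
      (a'.continuous.comp (continuous_contr.comp (f := fun z : (Fin n → I) × I =>
        ((z.1, (1 : I)), z.2)) (by fun_prop))).continuousOn
      (fun x hx => by
        rw [contr_zero]
        exact ha' _ (Or.inr hx))
    let A : ((Fin n → I) × I) × I → X := fun w =>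
      if w.1.2 = 1 then l (w.1.1, w.2) else a' (contr w.1 w.2)
    have hAbox : ∀ w : ((Fin n → I) × I) × I, w.1 ∈ box n → A w = a' (contr w.1 w.2) := by
      rintro ⟨⟨x, t⟩, s⟩ hw
      by_cases ht : t = 1
      · subst ht
        rcases hw with hw | hw
        · exact absurd hw one_ne_zero
        · simp [A, hl x hw]
      · simp [A, ht]
    have hAlid : ∀ x s, A ((x, 1), s) = l (x, s) := fun x s => if_pos rfl
    have hA : ContinuousOn A {w | w.1 ∈ prodBoundary n} := by
      have : {w : ((Fin n → I) × I) × I | w.1 ∈ prodBoundary n} =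
        {w | w.1 ∈ box n} ∪ {w | w.1.2 = 1} := rfl
      rw [this]
      have hc : IsClosed (box n) := (isClosed_eq continuous_snd continuous_const).union
        ((isClosed_boundary n).preimage continuous_fst)
      refine ContinuousOn.union_of_isClosed ?_ ?_ (hc.preimage continuous_fst)
        (isClosed_eq (by fun_prop) continuous_const)
      · exact (a'.continuous.comp continuous_contr).continuousOn.congr hAbox
      · exact ContinuousOn.congr (f := fun w : ((Fin n → I) × I) × I => l (w.1.1, w.2))
          (by fun_prop) fun w hw => if_pos hw
    have hA0 : ∀ z ∈ prodBoundary n, A (z, 0) = a z := by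
      rintro z (hz | hz)
      · rw [hAbox _ hz, contr_zero, ha' z hz]
      · have : z = (z.1, 1) := Prod.ext rfl hz
        rw [this, hAlid, hl0]
        rfl
    obtain ⟨B, hB0, hB⟩ := (isCubePair_prod n).exists_homotopy_extension b (fun w => p (A w))
      (p.continuous.comp_continuousOn hA) (fun z hz => by rw [hA0 z hz, hab z hz])
    -- At time `1` the box is constant at `x₀`, and the lid is a loop `α` whose image is null
    -- homotopic through `B`.
    set x₀ := a' (fun _ => 0, 0) with hx₀
    let α : Ω^ (Fin n) X x₀ := ⟨l.comp ⟨fun x => (x, 1), by fun_prop⟩, fun x hx => by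
      simp [hl x hx, contr_one, hx₀]⟩
    have hbox1 : ∀ z ∈ box n, A (z, 1) = x₀ := fun z hz => by rw [hAbox _ hz, contr_one]
    have hα : GenLoop.Homotopic (GenLoop.const : Ω^ (Fin n) X x₀) α := by
      apply hw.inj
      rw [genLoop_homotopic_iff]
      refine ⟨B.comp ⟨fun z => (z, 1), by fun_prop⟩, fun t => ?_, fun t => ?_, fun t ht s => ?_⟩
      · have h : ((t, 0) : (Fin n → I) × I) ∈ box n := Or.inl rfl
        exact (hB _ (Or.inl h) 1).trans (congrArg p (hbox1 _ h))
      · exact (hB (t, 1) (Or.inr rfl) 1).trans (congrArg p (hAlid t 1))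
      · have h : ((t, s) : (Fin n → I) × I) ∈ box n := Or.inr ht
        exact (hB _ (Or.inl h) 1).trans (congrArg p (hbox1 _ h))
    rw [genLoop_homotopic_iff] at hα
    obtain ⟨F, hF0, hF1, hF⟩ := hα
    have hFA : ∀ z ∈ prodBoundary n, F z = A (z, 1) := by
      rintro ⟨x, t⟩ ((hz | hz) | hz)
      · have : t = 0 := hz
        subst this
        rw [hF0, hbox1 _ (Or.inl hz)]
        rfl
      · rw [hF x hz, hbox1 _ (Or.inr hz)]
      · have : t = 1 := hz
        subst this
        rw [hF1, hAlid]
        rfl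
    obtain ⟨d, hd, hd'⟩ := hw.lift_of_extends (n := n + 1) hp
      (F.comp ⟨_, (splitFirst n).continuous⟩)
      (B.comp ⟨fun x => (splitFirst n x, 1), by fun_prop⟩) (fun x hx => by
        have := (splitFirst_mem x).2 hx
        change p (F (splitFirst n x)) = B (splitFirst n x, 1)
        rw [hFA _ this, hB _ this])
    -- The lift at time `1` is carried back along `A` and `B` to time `0`.
    obtain ⟨c, hc, hc'⟩ := (isCubePair_prod n).lift_of_homotopy (hp (n + 2)) A hA B
      (fun w hw => (hB w.1 hw w.2).symm) (d.comp ⟨_, (splitFirst n).symm.continuous⟩)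
      (fun z hz => by
        have := hd _ ((splitFirst_symm_mem z).2 hz)
        simp only [ContinuousMap.comp_apply, ContinuousMap.coe_mk, Homeomorph.apply_symm_apply]
          at this ⊢
        rw [this, hFA z hz]) (fun z => by
        have := hd' ((splitFirst n).symm z)
        simpa using this)
    exact ⟨c, fun z hz => by rw [hc z hz, hA0 z hz], fun z => by rw [hc', hB0]⟩

end CubeBox

namespace CubeBox

open unitInterval Set Topology.Homotopy LmcCStar

variable {n : ℕ} {X Y Z : Type u} [TopologicalSpace X] [TopologicalSpace Y] [TopologicalSpace Z]

/-! ### Change of basepoint and the two-out-of-three property -/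

variable {x₀ x₁ : X} {γ : C(I, X)}

/-- The generalized loop `α₁` is obtained from `α₀` by moving the basepoint along the path `γ`. -/
def Transports (γ : C(I, X)) (α₀ : Ω^ (Fin n) X x₀) (α₁ : Ω^ (Fin n) X x₁) : Prop :=
  ∃ F : C((Fin n → I) × I, X), (∀ t, F (t, 0) = α₀ t) ∧ (∀ t, F (t, 1) = α₁ t) ∧
    ∀ t ∈ Cube.boundary (Fin n), ∀ s, F (t, s) = γ s

theorem exists_transports (h0 : γ 0 = x₀) (h1 : γ 1 = x₁) (α₀ : Ω^ (Fin n) X x₀) :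
    ∃ α₁ : Ω^ (Fin n) X x₁, Transports γ α₀ α₁ := by
  obtain ⟨F, hF0, hF⟩ := exists_homotopy_extension α₀.1 (fun z => γ z.2) (by fun_prop)
    fun x hx => h0.trans (α₀.2 x hx).symm
  exact ⟨⟨F.comp ⟨fun t => (t, 1), by fun_prop⟩, fun t ht => (hF t ht 1).trans h1⟩, F, hF0,
    fun t => rfl, hF⟩

theorem Transports.symm {α₀ : Ω^ (Fin n) X x₀} {α₁ : Ω^ (Fin n) X x₁} (h : Transports γ α₀ α₁) :
    Transports (γ.comp ⟨σ, continuous_symm⟩) α₁ α₀ := by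
  obtain ⟨F, h0, h1, h⟩ := h
  refine ⟨F.comp ⟨fun z => (z.1, σ z.2), by fun_prop⟩, fun t => ?_, fun t => ?_,
    fun t ht s => h t ht (σ s)⟩
  · change F (t, σ 0) = _
    rw [unitInterval.symm_zero, h1]
  · change F (t, σ 1) = _
    rw [unitInterval.symm_one, h0]

theorem Transports.map {α₀ : Ω^ (Fin n) X x₀} {α₁ : Ω^ (Fin n) X x₁}
    (h : Transports γ α₀ α₁) (p : C(X, Y)) :
    Transports (p.comp γ) (genLoopMap p α₀) (genLoopMap p α₁) := by
  obtain ⟨F, h0, h1, h⟩ := h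
  exact ⟨p.comp F, fun t => congrArg p (h0 t), fun t => congrArg p (h1 t),
    fun t ht s => congrArg p (h t ht s)⟩

/-- Transport is well defined on homotopy classes: the homotopies `α₀ ∼ α₁`, `α₀ ≃ α₀'` and
`α₀' ∼ α₁'` fit together to a map on a box, and the lid of an extension is a homotopy. -/
theorem Transports.homotopic (e0 : γ 0 = x₀) (e1 : γ 1 = x₁) {α₀ α₀' : Ω^ (Fin n) X x₀}
    {α₁ α₁' : Ω^ (Fin n) X x₁} (h : Transports γ α₀ α₁) (h' : Transports γ α₀' α₁')
    (h₀ : GenLoop.Homotopic α₀ α₀') : GenLoop.Homotopic α₁ α₁' := by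
  classical
  rw [genLoop_homotopic_iff] at h₀ ⊢
  obtain ⟨F, hF0, hF1, hF⟩ := h
  obtain ⟨F', hF0', hF1', hF'⟩ := h'
  obtain ⟨G, hG0, hG1, hG⟩ := h₀
  let B : ((Fin n → I) × I) × I → X := fun w =>
    if w.1.2 = 0 then F (w.1.1, w.2) else if w.1.2 = 1 then F' (w.1.1, w.2) else γ w.2
  have hB0 : ∀ x t, B ((x, 0), t) = F (x, t) := fun x t => if_pos rfl
  have hB1 : ∀ x t, B ((x, 1), t) = F' (x, t) := fun x t =>
    (if_neg one_ne_zero).trans (if_pos rfl)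
  have hB : ∀ x ∈ Cube.boundary (Fin n), ∀ s t, B ((x, s), t) = γ t := by
    intro x hx s t
    simp only [B]
    split_ifs
    · exact hF x hx t
    · exact hF' x hx t
    · rfl
  have hBc : ContinuousOn B {w | w.1 ∈ prodBoundary n} := by
    have : {w : ((Fin n → I) × I) × I | w.1 ∈ prodBoundary n} =
      ({w | w.1.2 = 0} ∪ {w | w.1.1 ∈ Cube.boundary (Fin n)}) ∪ {w | w.1.2 = 1} := rfl
    rw [this]
    have c0 : IsClosed {w : ((Fin n → I) × I) × I | w.1.2 = 0} :=
      isClosed_eq (by fun_prop) continuous_const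
    have cb : IsClosed {w : ((Fin n → I) × I) × I | w.1.1 ∈ Cube.boundary (Fin n)} :=
      (isClosed_boundary n).preimage (by fun_prop)
    have c1 : IsClosed {w : ((Fin n → I) × I) × I | w.1.2 = 1} :=
      isClosed_eq (by fun_prop) continuous_const
    refine ContinuousOn.union_of_isClosed (ContinuousOn.union_of_isClosed ?_ ?_ c0 cb) ?_
      (c0.union cb) c1
    · refine ContinuousOn.congr (f := fun w : ((Fin n → I) × I) × I => F (w.1.1, w.2))
        (by fun_prop) ?_
      rintro ⟨⟨x, s⟩, t⟩ (rfl : s = 0)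
      exact hB0 x t
    · refine ContinuousOn.congr (f := fun w : ((Fin n → I) × I) × I => γ w.2) (by fun_prop) ?_
      rintro ⟨⟨x, s⟩, t⟩ hx
      exact hB x hx s t
    · refine ContinuousOn.congr (f := fun w : ((Fin n → I) × I) × I => F' (w.1.1, w.2))
        (by fun_prop) ?_
      rintro ⟨⟨x, s⟩, t⟩ (rfl : s = 1)
      exact hB1 x t
  obtain ⟨E, -, hE⟩ := (isCubePair_prod n).exists_homotopy_extension G B hBc (by
    rintro ⟨x, s⟩ ((hz | hz) | hz)
    · have : s = 0 := hz
      subst this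
      rw [hB0, hF0, hG0]
    · rw [hB x hz, hG x hz, e0]
    · have : s = 1 := hz
      subst this
      rw [hB1, hF0', hG1])
  refine ⟨E.comp ⟨fun z => (z, 1), by fun_prop⟩, fun t => ?_, fun t => ?_, fun t ht s => ?_⟩
  · exact (hE (t, 0) (Or.inl (Or.inl rfl)) 1).trans ((hB0 t 1).trans (hF1 t))
  · exact (hE (t, 1) (Or.inr rfl) 1).trans ((hB1 t 1).trans (hF1' t))
  · exact (hE (t, s) (Or.inl (Or.inr ht)) 1).trans ((hB t ht s 1).trans e1)

/-- Bijectivity on homotopy groups does not depend on the basepoint in its path component. -/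
theorem bijective_homotopyGroupMap_of_path (p : C(X, Y)) (e0 : γ 0 = x₀) (e1 : γ 1 = x₁)
    (h : Function.Bijective (homotopyGroupMap p n x₀)) :
    Function.Bijective (homotopyGroupMap p n x₁) := by
  rw [bijective_homotopyGroupMap_iff] at h ⊢
  have e0' : γ.comp ⟨σ, continuous_symm⟩ 0 = x₁ := by simp [e1]
  have e1' : γ.comp ⟨σ, continuous_symm⟩ 1 = x₀ := by simp [e0]
  constructor
  · intro α α' hα
    obtain ⟨δ, hδ⟩ := exists_transports e0' e1' α
    obtain ⟨δ', hδ'⟩ := exists_transports e0' e1' α'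
    have h0 := h.1 δ δ' (Transports.homotopic (congrArg p e0') (congrArg p e1') (hδ.map p)
      (hδ'.map p) hα)
    exact Transports.homotopic (by simp [e0]) (by simp [e1]) hδ.symm hδ'.symm h0
  · intro β
    obtain ⟨δ, hδ⟩ := exists_transports (γ := p.comp (γ.comp ⟨σ, continuous_symm⟩))
      (congrArg p e0') (congrArg p e1') β
    obtain ⟨α₀, hα₀⟩ := h.2 δ
    obtain ⟨α, hα⟩ := exists_transports e0 e1 α₀
    have hδ' := hδ.symm
    have hc : (p.comp (γ.comp ⟨σ, continuous_symm⟩)).comp ⟨σ, continuous_symm⟩ = p.comp γ := by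
      ext t; simp
    rw [hc] at hδ'
    exact ⟨α, Transports.homotopic (congrArg p e0) (congrArg p e1) (hα.map p) hδ' hα₀⟩

theorem IsWeq.of_precomp [Nonempty X] {p : C(X, Y)} {q : C(Y, Z)} (hp : IsWeq p)
    (hqp : IsWeq (q.comp p)) : IsWeq q := by
  intro n y
  obtain ⟨x⟩ := ‹Nonempty X›
  have hemp : ∀ x, x ∉ Cube.boundary (Fin 0) := fun x ⟨i, _⟩ => i.elim0
  obtain ⟨α, hα⟩ := hp.surj (n := 0) (x := x) ⟨ContinuousMap.const _ y,
    fun x hx => absurd hx (hemp x)⟩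
  rw [genLoop_homotopic_iff] at hα
  obtain ⟨F, hF0, hF1, -⟩ := hα
  set t₀ : Fin 0 → I := fun _ => 0
  refine bijective_homotopyGroupMap_of_path q (x₀ := p (α t₀))
    (γ := F.comp ⟨fun s => (t₀, s), by fun_prop⟩) (hF0 t₀) (hF1 t₀) ?_
  have h := hqp n (α t₀)
  have hp' := hp n (α t₀)
  have hc : homotopyGroupMap (q.comp p) n (α t₀) =
      homotopyGroupMap q n (p (α t₀)) ∘ homotopyGroupMap p n (α t₀) := by
    funext a
    obtain ⟨a⟩ := a
    rfl
  rw [hc] at h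
  exact (Function.Bijective.of_comp_iff _ hp').1 h

theorem IsWeq.comp {p : C(X, Y)} {q : C(Y, Z)} (hp : IsWeq p) (hq : IsWeq q) : IsWeq (q.comp p) := by
  intro n x
  rw [bijective_homotopyGroupMap_iff]
  refine ⟨fun α α' h => hp.inj (hq.inj h), fun β => ?_⟩
  obtain ⟨α, hα⟩ := hq.surj (x := p x) β
  obtain ⟨α', hα'⟩ := hp.surj α
  exact ⟨α', (hα'.comp_continuousMap q).trans hα⟩

theorem IsWeq.of_postcomp {p : C(X, Y)} {q : C(Y, Z)} (hq : IsWeq q) (hqp : IsWeq (q.comp p)) :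
    IsWeq p := by
  intro n x
  rw [bijective_homotopyGroupMap_iff]
  refine ⟨fun α α' h => hqp.inj (h.comp_continuousMap q), fun β => ?_⟩
  obtain ⟨α, hα⟩ := hqp.surj (x := x) (genLoopMap q β)
  exact ⟨α, hq.inj hα⟩

/-- A map with a left inverse `r`, such that `p ∘ r` is homotopic to the identity relative to the
image of `p`, is a weak homotopy equivalence. -/
theorem isWeq_of_deformation {p : C(X, Y)} (r : C(Y, X)) (hr : ∀ x, r (p x) = x) (K : C(Y × I, Y))
    (hK0 : ∀ y, K (y, 0) = p (r y)) (hK1 : ∀ y, K (y, 1) = y)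
    (hK : ∀ x t, K (p x, t) = p x) : IsWeq p := by
  intro n x
  rw [bijective_homotopyGroupMap_iff]
  constructor
  · intro α α' h
    rw [genLoop_homotopic_iff] at h ⊢
    obtain ⟨F, hF0, hF1, hF⟩ := h
    exact ⟨r.comp F, fun t => (congrArg r (hF0 t)).trans (hr _),
      fun t => (congrArg r (hF1 t)).trans (hr _), fun t ht s => (congrArg r (hF t ht s)).trans
        (hr _)⟩
  · intro β
    refine ⟨⟨r.comp β.1, fun t ht => (congrArg r (β.2 t ht)).trans (hr x)⟩, ?_⟩
    rw [genLoop_homotopic_iff]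
    refine ⟨K.comp ⟨fun z => (β z.1, z.2), by fun_prop⟩, fun t => hK0 _, fun t => hK1 _,
      fun t ht s => ?_⟩
    exact (congrArg (fun y => K (y, s)) (β.2 t ht)).trans (hK x s)

end CubeBox

namespace LmcCStar

variable {ν : Ordinal.{u}}

/-! ### Limits and colimits -/

section Construct

variable {A : Type u} [NonUnitalRing A] [StarRing A] [Module ℂ A] [IsScalarTower ℂ A A]
  [SMulCommClass ℂ A A] [StarModule ℂ A] [TopologicalSpace A] [T2Space A]

/-- A `*`-subalgebra which is closed under limits of `ν`-sequences, as an object of `𝔸_ν`. -/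
def ANu.ofSubalgebra (hA : IsLmcCStar A) (hν : IsNuComplete ν A) (S : NonUnitalStarSubalgebra ℂ A)
    (hS : ∀ x : ν.ToType → A, (∀ α, x α ∈ S) → ∀ y, NuConverges ν x y → y ∈ S) : ANu ν where
  carrier := S
  t2Space := inferInstanceAs (T2Space {x // x ∈ S})
  isLmcCStar := isLmcCStar_induced hA (NonUnitalStarSubalgebraClass.subtype (R := ℂ) S)
  isNuComplete x hx := by
    obtain ⟨a, ha⟩ := hν (fun α => (x α : A)) fun U hU => by
      obtain ⟨γ, hγ⟩ := hx (Subtype.val ⁻¹' U)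
        (continuous_subtype_val.tendsto' (0 : S) 0 rfl hU)
      exact ⟨γ, hγ⟩
    refine ⟨⟨a, hS _ (fun α => (x α).2) a ha⟩, fun U hU => ?_⟩
    obtain ⟨V, hV, hVU⟩ := (mem_nhds_induced Subtype.val _ _).1 hU
    obtain ⟨γ, hγ⟩ := ha V hV
    exact ⟨γ, fun α hα => hVU (hγ α hα)⟩

end Construct

theorem isNuComplete_pi {ι : Type*} {B : ι → Type*} [∀ i, AddGroup (B i)]
    [∀ i, TopologicalSpace (B i)] (h : ∀ i, IsNuComplete ν (B i)) : IsNuComplete ν (∀ i, B i) := by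
  intro x hx
  -- For `ν = 0` no sequence is Cauchy.
  have hν : Nonempty ν.ToType := ⟨(hx _ univ_mem).choose⟩
  choose y hy using fun i => h i (fun α => x α i) fun U hU =>
    hx _ ((continuous_apply i).tendsto' 0 0 rfl hU)
  exact ⟨y, nuConverges_pi hν hy⟩

/-- The evaluation of a product of `*`-algebras at an index. -/
def NonUnitalStarAlgHom.piEval {ι : Type*} {B : ι → Type*} [∀ i, NonUnitalRing (B i)]
    [∀ i, StarRing (B i)] [∀ i, Module ℂ (B i)] (i : ι) : (∀ i, B i) →⋆ₙₐ[ℂ] B i where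
  toFun x := x i
  map_smul' _ _ := rfl
  map_zero' := rfl
  map_add' _ _ := rfl
  map_mul' _ _ := rfl
  map_star' _ := rfl

theorem isLmcCStar_pi {ι : Type*} {B : ι → Type*} [∀ i, NonUnitalRing (B i)]
    [∀ i, StarRing (B i)] [∀ i, Module ℂ (B i)] [∀ i, TopologicalSpace (B i)]
    (h : ∀ i, IsLmcCStar (B i)) : IsLmcCStar (∀ i, B i) :=
  isLmcCStar_iInf h fun i => NonUnitalStarAlgHom.piEval i

namespace ANu

theorem hom_add {A B : ANu ν} (f : A ⟶ B) (a b : A) : f (a + b) = f a + f b :=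
  _root_.map_add f.toStarHom a b
theorem hom_sub {A B : ANu ν} (f : A ⟶ B) (a b : A) : f (a - b) = f a - f b :=
  _root_.map_sub f.toStarHom a b
theorem hom_mul {A B : ANu ν} (f : A ⟶ B) (a b : A) : f (a * b) = f a * f b :=
  _root_.map_mul f.toStarHom a b
theorem hom_smul {A B : ANu ν} (f : A ⟶ B) (c : ℂ) (a : A) : f (c • a) = c • f a :=
  _root_.map_smul f.toStarHom c a
theorem hom_star {A B : ANu ν} (f : A ⟶ B) (a : A) : f (star a) = star (f a) :=
  _root_.StarHomClass.map_star f.toStarHom a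

section Limits

variable {J : Type u} [Category.{u} J] (F : J ⥤ ANu ν)

/-- The compatible families, as a `*`-subalgebra of the product. -/
def sectionsSubalgebra : NonUnitalStarSubalgebra ℂ (∀ j, F.obj j) where
  carrier := {x | ∀ ⦃i j : J⦄ (f : i ⟶ j), F.map f (x i) = x j}
  add_mem' hx hy _ _ f := (hom_add _ _ _).trans (congrArg₂ _ (hx f) (hy f))
  zero_mem' _ _ _ := hom_zero _
  mul_mem' hx hy _ _ f := (hom_mul _ _ _).trans (congrArg₂ _ (hx f) (hy f))
  smul_mem' _ _ hx _ _ f := (hom_smul _ _ _).trans (congrArg _ (hx f))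
  star_mem' hx _ _ f := (hom_star _ _).trans (congrArg _ (hx f))

/-- The limit of a diagram in `𝔸_ν`. -/
def limitObj : ANu ν :=
  ofSubalgebra (isLmcCStar_pi fun j => (F.obj j).isLmcCStar)
    (isNuComplete_pi fun j => (F.obj j).isNuComplete) (sectionsSubalgebra F) <| by
    intro x hx y hy i j f
    have h1 := (hy.map (continuous_apply i)).map (Hom.continuous (F.map f))
    have h2 := hy.map (continuous_apply j)
    rw [show (fun α => F.map f (x α i)) = fun α => x α j from funext fun α => hx α f] at h1
    exact nuConverges_unique h1 h2

/-- The projections of the limit. -/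
def limitProj (j : J) : limitObj F ⟶ F.obj j where
  toStarHom := (NonUnitalStarAlgHom.piEval (B := fun j => F.obj j) j).comp
    (NonUnitalStarSubalgebraClass.subtype (R := ℂ) (sectionsSubalgebra F))
  continuous' := (continuous_apply j).comp continuous_subtype_val

/-- The limit cone of a diagram in `𝔸_ν`. -/
def limitCone : Limits.Cone F where
  pt := limitObj F
  π :=
    { app := limitProj F
      naturality := fun _ _ f => ANu.hom_ext fun (x : sectionsSubalgebra F) => (x.2 f).symm }

/-- The map to the limit determined by a cone. -/
def limitLift (s : Limits.Cone F) : s.pt ⟶ limitObj F where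
  toStarHom :=
    { toFun := fun a => (⟨fun j => s.π.app j a, fun _ _ f =>
          DFunLike.congr_fun (s.w f) a⟩ : sectionsSubalgebra F)
      map_smul' := fun c a => Subtype.ext (funext fun j => hom_smul _ _ _)
      map_zero' := Subtype.ext (funext fun j => hom_zero _)
      map_add' := fun a b => Subtype.ext (funext fun j => hom_add _ _ _)
      map_mul' := fun a b => Subtype.ext (funext fun j => hom_mul _ _ _)
      map_star' := fun a => Subtype.ext (funext fun j => hom_star _ _) }
  continuous' := Continuous.subtype_mk (continuous_pi fun j => Hom.continuous (s.π.app j)) _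

/-- The limit cone is a limit. -/
def isLimitLimitCone : Limits.IsLimit (limitCone F) where
  lift := limitLift F
  fac _ _ := rfl
  uniq _ _ h := ANu.hom_ext fun a =>
    Subtype.ext (funext fun j => DFunLike.congr_fun (h j) a)

theorem hasLimits : Limits.HasLimits (ANu ν) :=
  ⟨fun _ _ => ⟨fun F => ⟨⟨⟨limitCone F, isLimitLimitCone F⟩⟩⟩⟩⟩

end Limits

section Colimits

variable {J : Type u} [Category.{u} J] (F : J ⥤ ANu ν)

/-- The relations defining the colimit of a diagram: the restriction of the map on generators to
each algebra of the diagram is a continuous `*`-homomorphism, and these restrictions form a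
cocone. -/
structure IsCoconeMap (B : ANu ν) (f : (Σ j, F.obj j) → B) : Prop where
  continuous : ∀ j, Continuous fun a : F.obj j => f ⟨j, a⟩
  map_add : ∀ j (a b : F.obj j), f ⟨j, a + b⟩ = f ⟨j, a⟩ + f ⟨j, b⟩
  map_smul : ∀ j (c : ℂ) (a : F.obj j), f ⟨j, c • a⟩ = c • f ⟨j, a⟩
  map_mul : ∀ j (a b : F.obj j), f ⟨j, a * b⟩ = f ⟨j, a⟩ * f ⟨j, b⟩
  map_star : ∀ j (a : F.obj j), f ⟨j, star a⟩ = star (f ⟨j, a⟩)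
  map_comp : ∀ ⦃i j : J⦄ (g : i ⟶ j) (a : F.obj i), f ⟨j, F.map g a⟩ = f ⟨i, a⟩

theorem isCoconeMap_universalGen :
    IsCoconeMap F (universalAlg (IsCoconeMap F)) (universalGen (IsCoconeMap F)) := by
  have key : ∀ g, (universalHom (IsCoconeMap F) (universalGen (IsCoconeMap F) g)).1 =
      Rep.gen (IsCoconeMap F) g := universalHom_gen (IsCoconeMap F)
  have hinj : ∀ {s t : universalAlg (IsCoconeMap F)},
      (universalHom (IsCoconeMap F) s).1 = (universalHom (IsCoconeMap F) t).1 → s = t :=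
    fun h => (bijective_universalHom (IsCoconeMap F)).1 (Subtype.ext h)
  constructor
  · intro j
    refine (isInducing_universalHom (IsCoconeMap F)).continuous_iff.2 ?_
    refine continuous_induced_rng.2 (continuous_pi fun R => ?_)
    have : (fun a : F.obj j => (universalHom (IsCoconeMap F)
        (universalGen (IsCoconeMap F) ⟨j, a⟩)).1 R) = fun a => R.map ⟨j, a⟩ :=
      funext fun a => congrFun (key ⟨j, a⟩) R
    exact this ▸ R.rel.continuous j
  · intro j a b
    refine hinj ?_
    rw [_root_.map_add]
    refine (key _).trans ((funext fun R => R.rel.map_add j a b).trans ?_)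
    exact (congrArg₂ (· + ·) (key ⟨j, a⟩) (key ⟨j, b⟩)).symm
  · intro j c a
    refine hinj ?_
    rw [_root_.map_smul]
    refine (key _).trans ((funext fun R => R.rel.map_smul j c a).trans ?_)
    exact (congrArg (c • ·) (key ⟨j, a⟩)).symm
  · intro j a b
    refine hinj ?_
    rw [_root_.map_mul]
    refine (key _).trans ((funext fun R => R.rel.map_mul j a b).trans ?_)
    exact (congrArg₂ (· * ·) (key ⟨j, a⟩) (key ⟨j, b⟩)).symm
  · intro j a
    refine hinj ?_
    rw [StarHomClass.map_star]
    refine (key _).trans ((funext fun R => R.rel.map_star j a).trans ?_)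
    exact (congrArg star (key ⟨j, a⟩)).symm
  · intro i j g a
    refine hinj ?_
    exact (key _).trans ((funext fun R => R.rel.map_comp g a).trans (key _).symm)

/-- The colimit cocone of a diagram in `𝔸_ν`. -/
noncomputable def colimitCocone : Limits.Cocone F where
  pt := universalAlg (IsCoconeMap F)
  ι :=
    { app := fun j =>
        { toStarHom :=
            { toFun := fun a => universalGen (IsCoconeMap F) ⟨j, a⟩
              map_smul' := (isCoconeMap_universalGen F).map_smul j
              map_zero' := by
                have := (isCoconeMap_universalGen F).map_smul j 0 0
                rwa [zero_smul, zero_smul] at this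
              map_add' := (isCoconeMap_universalGen F).map_add j
              map_mul' := (isCoconeMap_universalGen F).map_mul j
              map_star' := (isCoconeMap_universalGen F).map_star j }
          continuous' := (isCoconeMap_universalGen F).continuous j }
      naturality := fun i j g => by
        ext a
        exact (isCoconeMap_universalGen F).map_comp g a }

theorem isCoconeMap_of_cocone (s : Limits.Cocone F) :
    IsCoconeMap F s.pt fun g => s.ι.app g.1 g.2 where
  continuous j := Hom.continuous (s.ι.app j)
  map_add _ _ _ := hom_add _ _ _
  map_smul _ _ _ := hom_smul _ _ _
  map_mul _ _ _ := hom_mul _ _ _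
  map_star _ _ := hom_star _ _
  map_comp i j g a := by
    rw [← s.w g]; rfl

/-- The colimit cocone is a colimit. -/
noncomputable def isColimitColimitCocone : Limits.IsColimit (colimitCocone F) where
  desc s := universalLift (Rel := IsCoconeMap F) _ (isCoconeMap_of_cocone F s)
  fac s j := by
    ext a
    exact universalLift_gen (Rel := IsCoconeMap F) _ (isCoconeMap_of_cocone F s) ⟨j, a⟩
  uniq s m h := by
    refine universal_hom_ext (Rel := IsCoconeMap F) fun ⟨j, a⟩ => ?_
    rw [universalLift_gen]
    exact DFunLike.congr_fun (h j) a

theorem hasColimits : Limits.HasColimits (ANu ν) :=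
  ⟨fun _ _ => ⟨fun F => ⟨⟨⟨colimitCocone F, isColimitColimitCocone F⟩⟩⟩⟩⟩

end Colimits

end ANu

end LmcCStar

namespace LmcCStar

/-! ### Completions of `C*`-seminorms -/

section Completion

open UniformSpace

/-- A seminormed `*`-ring satisfying the `C*`-identity, not necessarily complete or Hausdorff. -/
class PreCStarRing (E : Type*) [NonUnitalSeminormedRing E] [StarRing E] : Prop extends
    NormedStarGroup E where
  norm_star_mul_self' : ∀ a : E, ‖star a * a‖ = ‖a‖ * ‖a‖

variable (E : Type*) [NonUnitalSeminormedRing E]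

/-- The completion of a seminormed `*`-algebra satisfying the `C*`-identity. -/
def CStarCompletion : Type _ := Completion E

noncomputable section

namespace CStarCompletion

open UniformSpace.Completion

instance : NormedAddCommGroup (CStarCompletion E) :=
  inferInstanceAs (NormedAddCommGroup (Completion E))
instance : CompleteSpace (CStarCompletion E) :=
  inferInstanceAs (CompleteSpace (Completion E))

/-- The canonical map to the completion. -/
def of (a : E) : CStarCompletion E := (a : Completion E)

theorem continuous_of : Continuous (of E) := continuous_coe _
theorem of_add (a b : E) : of E (a + b) = of E a + of E b := coe_add a b
theorem of_zero : of E 0 = 0 := coe_zero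
theorem norm_of (a : E) : ‖of E a‖ = ‖a‖ := norm_coe a

theorem isDenseInducing_of : IsDenseInducing (of E) := isDenseInducing_coe

variable {E} in
@[elab_as_elim]
theorem induction {P : CStarCompletion E → Prop} (x) (hc : IsClosed {x | P x})
    (h : ∀ a, P (of E a)) : P x := Completion.induction_on x hc h

variable {E} in
@[elab_as_elim]
theorem induction₂ {P : CStarCompletion E → CStarCompletion E → Prop} (x y)
    (hc : IsClosed {x : CStarCompletion E × CStarCompletion E | P x.1 x.2})
    (h : ∀ a b, P (of E a) (of E b)) : P x y := Completion.induction_on₂ x y hc h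

variable {E} in
@[elab_as_elim]
theorem induction₃ {P : CStarCompletion E → CStarCompletion E → CStarCompletion E → Prop} (x y z)
    (hc : IsClosed {x : CStarCompletion E × CStarCompletion E × CStarCompletion E |
      P x.1 x.2.1 x.2.2})
    (h : ∀ a b c, P (of E a) (of E b) (of E c)) : P x y z := Completion.induction_on₃ x y z hc h

instance : Mul (CStarCompletion E) :=
  ⟨fun x y => ((isDenseInducing_of E).prodMap (isDenseInducing_of E)).extend
    (fun z : E × E => of E (z.1 * z.2)) (x, y)⟩

theorem of_mul (a b : E) : of E (a * b) = of E a * of E b :=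
  (((isDenseInducing_of E).prodMap (isDenseInducing_of E)).extend_eq
    ((continuous_of E).comp continuous_mul) (a, b)).symm

theorem continuous_mul' :
    Continuous fun x : CStarCompletion E × CStarCompletion E => x.1 * x.2 := by
  let i : E →+ CStarCompletion E := ⟨⟨of E, of_zero E⟩, of_add E⟩
  let m := (AddMonoidHom.mul : E →+ E →+ E).compr₂ i
  have hm : Continuous fun x : E × E => m x.1 x.2 :=
    (continuous_of E).comp continuous_mul
  have di : IsDenseInducing i := isDenseInducing_of E
  exact (di.extend_Z_bilin di hm :)

instance : ContinuousMul (CStarCompletion E) := ⟨continuous_mul' E⟩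

instance [NormedSpace ℂ E] : NormedSpace ℂ (CStarCompletion E) :=
  inferInstanceAs (NormedSpace ℂ (Completion E))

instance [NormedSpace ℂ E] : ContinuousConstSMul ℂ (CStarCompletion E) :=
  inferInstanceAs (ContinuousConstSMul ℂ (Completion E))

theorem continuous_smul' [NormedSpace ℂ E] (c : ℂ) :
    Continuous fun x : CStarCompletion E => c • x := continuous_const_smul c

theorem of_smul [NormedSpace ℂ E] (c : ℂ) (a : E) : of E (c • a) = c • of E a := coe_smul c a

instance : NonUnitalNormedRing (CStarCompletion E) where
  __ := (inferInstance : NormedAddCommGroup (CStarCompletion E))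
  left_distrib x y z := by
    refine induction₃ x y z (isClosed_eq (by fun_prop) (by fun_prop)) fun a b c => ?_
    simp only [← of_add, ← of_mul, mul_add]
  right_distrib x y z := by
    refine induction₃ x y z (isClosed_eq (by fun_prop) (by fun_prop)) fun a b c => ?_
    simp only [← of_add, ← of_mul, add_mul]
  zero_mul x := by
    refine induction x (isClosed_eq (by fun_prop) (by fun_prop)) fun a => ?_
    rw [← of_zero, ← of_mul, zero_mul]
  mul_zero x := by
    refine induction x (isClosed_eq (by fun_prop) (by fun_prop)) fun a => ?_
    rw [← of_zero, ← of_mul, mul_zero]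
  mul_assoc x y z := by
    refine induction₃ x y z (isClosed_eq (by fun_prop) (by fun_prop)) fun a b c => ?_
    simp only [← of_mul, mul_assoc]
  norm_mul_le x y := by
    refine induction₂ x y (isClosed_le (by fun_prop) (by fun_prop)) fun a b => ?_
    simp only [← of_mul, norm_of]
    exact norm_mul_le a b


variable [StarRing E]

instance : Star (CStarCompletion E) := ⟨Completion.map (star : E → E)⟩

theorem continuous_star' : Continuous (star : CStarCompletion E → CStarCompletion E) :=
  Completion.continuous_map

variable [PreCStarRing E]

instance : ContinuousStar (CStarCompletion E) := ⟨continuous_star' E⟩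

theorem of_star (a : E) : of E (star a) = star (of E a) :=
  (Completion.map_coe star_isometry.uniformContinuous a).symm

instance : StarRing (CStarCompletion E) where
  star_involutive x := by
    refine induction x (isClosed_eq (by fun_prop) (by fun_prop)) fun a => ?_
    rw [← of_star, ← of_star, star_star]
  star_mul x y := by
    refine induction₂ x y (isClosed_eq (by fun_prop) (by fun_prop)) fun a b => ?_
    simp only [← of_star, ← of_mul, star_mul]
  star_add x y := by
    refine induction₂ x y (isClosed_eq (by fun_prop) (by fun_prop)) fun a b => ?_
    simp only [← of_star, ← of_add, star_add]

variable [NormedSpace ℂ E] [IsScalarTower ℂ E E] [SMulCommClass ℂ E E] [StarModule ℂ E]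

instance : NonUnitalCStarAlgebra (CStarCompletion E) where
  norm_mul_self_le x := by
    refine induction x (isClosed_le (by fun_prop) (by fun_prop)) fun a => ?_
    simp only [← of_star, ← of_mul, norm_of]
    exact (PreCStarRing.norm_star_mul_self' a).ge
  smul_assoc c x y := by
    change c • x * y = c • (x * y)
    refine induction₂ x y (isClosed_eq
      (((continuous_smul' E c).comp continuous_fst).mul continuous_snd)
      ((continuous_smul' E c).comp continuous_mul)) fun a b => ?_
    simp only [← of_smul, ← of_mul, smul_mul_assoc]
  smul_comm c x y := by
    change c • (x * y) = x * c • y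
    refine induction₂ x y (isClosed_eq ((continuous_smul' E c).comp continuous_mul)
      (continuous_fst.mul ((continuous_smul' E c).comp continuous_snd))) fun a b => ?_
    simp only [← of_smul, ← of_mul, mul_smul_comm]
  star_smul c x := by
    refine induction x (isClosed_eq (continuous_star.comp (continuous_smul' E c))
      ((continuous_smul' E (star c)).comp continuous_star)) fun a => ?_
    simp only [← of_smul, ← of_star, star_smul]

/-- The canonical homomorphism to the completion. -/
def ofHom : E →⋆ₙₐ[ℂ] CStarCompletion E where
  toFun := of E
  map_smul' := of_smul E
  map_zero' := of_zero E
  map_add' := of_add E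
  map_mul' := of_mul E
  map_star' := of_star E

theorem norm_ofHom (a : E) : ‖ofHom E a‖ = ‖a‖ := norm_of E a

theorem denseRange_ofHom : DenseRange (ofHom E) := (isDenseInducing_of E).dense

variable {E} in
/-- A homomorphism to a `C*`-algebra which is dominated by the seminorm factors through the completion. -/
theorem exists_lift {D : Type*} [NonUnitalCStarAlgebra D] (φ : E →⋆ₙₐ[ℂ] D)
    (hφ : ∀ a, ‖φ a‖ ≤ ‖a‖) :
    ∃ ψ : CStarCompletion E →⋆ₙₐ[ℂ] D, ∀ a, ψ (ofHom E a) = φ a := by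
  let φ' : E →+ D := φ
  have huc : UniformContinuous φ' :=
    AddMonoidHomClass.uniformContinuous_of_bound φ' 1 fun a => by
      rw [one_mul]; exact hφ a
  let ψ : CStarCompletion E → D := Completion.extension φ'
  have hψ : Continuous ψ := Completion.continuous_extension
  have hof : ∀ a, ψ (of E a) = φ a := fun a => Completion.extension_coe huc a
  refine ⟨{ toFun := ψ, map_smul' := fun c x => ?_, map_zero' := ?_, map_add' := fun x y => ?_,
            map_mul' := fun x y => ?_, map_star' := fun x => ?_ }, hof⟩
  · refine induction x (isClosed_eq (hψ.comp (continuous_smul' E c)) (hψ.const_smul c))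
      fun a => ?_
    rw [← of_smul]
    exact (hof _).trans ((map_smul φ c a).trans (congrArg (c • ·) (hof a).symm))
  · exact (congrArg ψ (of_zero E).symm).trans ((hof _).trans (map_zero φ))
  · refine induction₂ x y (isClosed_eq (by fun_prop) (by fun_prop)) fun a b => ?_
    rw [← of_add]
    exact (hof _).trans ((map_add φ a b).trans (congrArg₂ (· + ·) (hof a).symm (hof b).symm))
  · refine induction₂ x y (isClosed_eq (by fun_prop) (by fun_prop)) fun a b => ?_
    rw [← of_mul]
    exact (hof _).trans ((map_mul φ a b).trans (congrArg₂ (· * ·) (hof a).symm (hof b).symm))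
  · refine induction x (isClosed_eq (by fun_prop) (by fun_prop)) fun a => ?_
    rw [← of_star]
    exact (hof _).trans ((StarHomClass.map_star φ a).trans (congrArg star (hof a).symm))

end CStarCompletion

end

/-- The completion of a complex `*`-algebra with respect to a `C*`-seminorm. -/
theorem IsCStarSeminorm.exists_completion {A : Type u} [NonUnitalRing A] [StarRing A] [Module ℂ A]
    [IsScalarTower ℂ A A] [SMulCommClass ℂ A A] [StarModule ℂ A] {p : Seminorm ℂ A}
    (hp : IsCStarSeminorm p) :
    ∃ (D : Type u) (_ : NonUnitalCStarAlgebra D) (i : A →⋆ₙₐ[ℂ] D),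
      (∀ a, ‖i a‖ = p a) ∧ DenseRange i ∧
      ∀ (D' : Type u) [NonUnitalCStarAlgebra D'] (φ : A →⋆ₙₐ[ℂ] D'), (∀ a, ‖φ a‖ ≤ p a) →
        ∃ ψ : D →⋆ₙₐ[ℂ] D', ∀ a, ψ (i a) = φ a := by
  let _ : NonUnitalSeminormedRing A :=
    { ‹NonUnitalRing A›, p.toAddGroupSeminorm.toSeminormedAddCommGroup with
      norm_mul_le := hp.mul_le }
  let _ : NormedSpace ℂ A := { ‹Module ℂ A› with norm_smul_le := fun c a => (map_smul_eq_mul p c a).le }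
  have _ : PreCStarRing A :=
    { norm_star_le := fun a => (hp.apply_star a).le
      norm_star_mul_self' := fun a => (hp.star_mul_self a).trans (sq (p a)) }
  exact ⟨CStarCompletion A, inferInstance, CStarCompletion.ofHom A,
    CStarCompletion.norm_ofHom A, CStarCompletion.denseRange_ofHom A,
    fun D' _ φ hφ => CStarCompletion.exists_lift φ hφ⟩

end Completion

end LmcCStar

namespace LmcCStar

/-! ### States and their extension -/

section States

open scoped ComplexOrder

variable {E : Type*} [CStarAlgebra E]

/-- A functional on a unital `C*`-algebra attaining its norm at `1` is real on self-adjoint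
elements. -/
theorem im_apply_eq_zero_of_norm_le {ψ : E →ₗ[ℂ] ℂ} {c : ℝ} (hψ : ∀ x, ‖ψ x‖ ≤ c * ‖x‖)
    (h1 : ψ 1 = c) {a : E} (ha : IsSelfAdjoint a) : (ψ a).im = 0 := by
  -- compare `ψ (a + i t)` with `‖a + i t‖² ≤ ‖a‖² + t²` for large real `t`
  have hc : 0 ≤ c ∨ ‖(1 : E)‖ = 0 := by
    by_contra! h
    have := (norm_nonneg _).trans (hψ 1)
    have h2 : 0 < ‖(1 : E)‖ := lt_of_le_of_ne (norm_nonneg _) (Ne.symm h.2)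
    nlinarith [h.1]
  rcases hc with hc | h
  swap
  · have h10 : (1 : E) = 0 := norm_eq_zero.1 h
    rw [← mul_one a, h10, mul_zero, map_zero]; rfl
  have key : ∀ t : ℝ, ((ψ a).im + t * c) ^ 2 ≤ c ^ 2 * (‖a‖ ^ 2 + t ^ 2) := by
    intro t
    set b : E := a + ((t : ℂ) * Complex.I) • (1 : E) with hb
    have hbb : star b * b = a * a + ((t : ℂ) ^ 2) • (1 : E) := by
      have : star b = a - ((t : ℂ) * Complex.I) • (1 : E) := by
        rw [hb, star_add, ha.star_eq, star_smul, star_one, sub_eq_add_neg, ← neg_smul]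
        simp
      rw [this, hb]
      simp only [sub_mul, mul_add, smul_mul_assoc, one_mul, mul_smul_comm, mul_one, smul_sub,
        smul_smul]
      have hI : (t : ℂ) * Complex.I * (t * Complex.I) = -(t : ℂ) ^ 2 := by
        rw [mul_mul_mul_comm, Complex.I_mul_I]; ring
      rw [hI, neg_smul]
      abel
    have hn1 : ‖(1 : E)‖ ≤ 1 := by
      have := CStarRing.norm_star_mul_self (x := (1 : E))
      rw [star_one, mul_one] at this
      by_contra! h
      nlinarith
    have hnb : ‖b‖ ^ 2 ≤ ‖a‖ ^ 2 + t ^ 2 := by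
      rw [sq, ← CStarRing.norm_star_mul_self, hbb]
      refine (norm_add_le _ _).trans (add_le_add ((norm_mul_le _ _).trans (sq _).ge) ?_)
      rw [norm_smul]
      have : ‖(t : ℂ) ^ 2‖ = t ^ 2 := by simp
      rw [this]
      nlinarith [sq_nonneg t]
    have him : (ψ b).im = (ψ a).im + t * c := by
      rw [hb, map_add, map_smul, h1]
      simp
    have h2 : |(ψ b).im| ≤ c * ‖b‖ := (Complex.abs_im_le_norm _).trans (hψ b)
    rw [him] at h2
    have h3 := pow_le_pow_left₀ (abs_nonneg _) h2 2
    rw [sq_abs, mul_pow] at h3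
    exact h3.trans (mul_le_mul_of_nonneg_left hnb (sq_nonneg c))
  rcases hc.eq_or_lt with rfl | hc
  · have := hψ a
    rw [zero_mul] at this
    rw [norm_le_zero_iff.1 this]; rfl
  by_contra hy
  have hyc : 0 < (ψ a).im ^ 2 * c := by positivity
  have := key (c * ‖a‖ ^ 2 / (ψ a).im)
  have h4 : (c * ‖a‖ ^ 2 / (ψ a).im) * (ψ a).im = c * ‖a‖ ^ 2 := by field_simp
  have h5 : 0 < (ψ a).im ^ 2 := by positivity
  have h6 : 0 ≤ c ^ 2 * ‖a‖ ^ 2 := by positivity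
  nlinarith

variable [PartialOrder E] [StarOrderedRing E]

theorem apply_nonneg_of_norm_le {ψ : E →ₗ[ℂ] ℂ} {c : ℝ} (hψ : ∀ x, ‖ψ x‖ ≤ c * ‖x‖)
    (h1 : ψ 1 = c) {a : E} (ha : 0 ≤ a) : 0 ≤ ψ a := by
  have hs : IsSelfAdjoint a := IsSelfAdjoint.of_nonneg ha
  have hle : a ≤ algebraMap ℝ E ‖a‖ := hs.le_algebraMap_norm_self
  rcases subsingleton_or_nontrivial E with h | h
  · rw [Subsingleton.elim a 0, map_zero]
  have hc : 0 ≤ c := by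
    have := (norm_nonneg _).trans (hψ 1)
    rwa [CStarRing.norm_one, mul_one] at this
  have hn : ‖algebraMap ℝ E ‖a‖ - a‖ ≤ ‖a‖ := by
    refine (CStarAlgebra.norm_le_norm_of_nonneg_of_le (sub_nonneg.2 hle)
      (sub_le_self _ ha)).trans ?_
    rw [norm_algebraMap', norm_norm]
  have hd := (hψ (algebraMap ℝ E ‖a‖ - a)).trans (mul_le_mul_of_nonneg_left hn hc)
  have e : ψ (algebraMap ℝ E ‖a‖ - a) = ((‖a‖ * c : ℝ) : ℂ) - ψ a := by
    rw [map_sub, Algebra.algebraMap_eq_smul_one, ← Complex.coe_smul, map_smul, h1]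
    simp
  rw [e] at hd
  have hre := (Complex.abs_re_le_norm _).trans hd
  rw [Complex.sub_re, Complex.ofReal_re] at hre
  rw [Complex.nonneg_iff]
  refine ⟨?_, (im_apply_eq_zero_of_norm_le hψ h1 hs).symm⟩
  have := (abs_le.1 hre).2
  linarith

/-- Positive functionals extend from a `C*`-subalgebra: a norm-preserving extension still attains
its norm at `1`. -/
theorem exists_positive_extension {D : Type*} [CStarAlgebra D] (j : D →⋆ₐ[ℂ] E)
    (hj : Function.Injective j) (φ : D →ₗ[ℂ] ℂ) {c : ℝ} (hφ : ∀ x, ‖φ x‖ ≤ c * ‖x‖)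
    (h1 : φ 1 = c) : ∃ ψ : E →ₚ[ℂ] ℂ, ∀ d, ψ (j d) = φ d := by
  have hc : 0 ≤ c ∨ ‖(1 : D)‖ = 0 := by
    by_contra! h
    have := (norm_nonneg _).trans (hφ 1)
    have h2 : 0 < ‖(1 : D)‖ := lt_of_le_of_ne (norm_nonneg _) (Ne.symm h.2)
    nlinarith [h.1]
  have hjn : ∀ d, ‖j d‖ = ‖d‖ := NonUnitalStarAlgHom.norm_map j hj
  rcases hc with hc | h
  swap
  · refine ⟨0, fun d => ?_⟩
    have h10 : (1 : D) = 0 := norm_eq_zero.1 h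
    rw [← mul_one d, h10, mul_zero, map_zero, map_zero, map_zero]
  let jl : D →ₗ[ℂ] E := (j : D →ₐ[ℂ] E).toLinearMap
  let e : D ≃ₗ[ℂ] LinearMap.range jl := LinearEquiv.ofInjective jl hj
  let φ' : StrongDual ℂ (LinearMap.range jl) :=
    (φ.comp (e.symm : LinearMap.range jl →ₗ[ℂ] D)).mkContinuous c fun x => by
      refine (hφ _).trans (le_of_eq ?_)
      rw [← hjn]
      exact congrArg (fun y : LinearMap.range jl => c * ‖y‖) (e.apply_symm_apply x)
  obtain ⟨g, hg, hgn⟩ := exists_extension_norm_eq (LinearMap.range jl) φ'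
  have hgj : ∀ d, g (j d) = φ d := fun d => by
    have h := hg (e d)
    refine h.trans ?_
    exact congrArg φ (e.symm_apply_apply d)
  have hgc : ∀ x, ‖g x‖ ≤ c * ‖x‖ := fun x => (g.le_opNorm x).trans
    (mul_le_mul_of_nonneg_right (hgn.trans_le (LinearMap.mkContinuous_norm_le _ hc _))
      (norm_nonneg x))
  have hg1 : g 1 = c := by rw [← h1, ← hgj, map_one j]
  exact ⟨PositiveLinearMap.mk₀ g.toLinearMap fun x hx =>
    apply_nonneg_of_norm_le (ψ := g.toLinearMap) hgc hg1 hx, hgj⟩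

/-- The GNS vector of a positive functional. -/
noncomputable def gnsVector (ψ : E →ₚ[ℂ] ℂ) : ψ.GNS := (ψ.toPreGNS 1 : ψ.PreGNS)

theorem inner_gnsVector (ψ : E →ₚ[ℂ] ℂ) (x : E) :
    inner ℂ (gnsVector ψ) (ψ.gnsNonUnitalStarAlgHom x (gnsVector ψ)) = ψ x := by
  simp [gnsVector, PositiveLinearMap.preGNS_inner_def]

end States

end LmcCStar

namespace LmcCStar

/-! ### Universal families of representations -/

section Universal

open scoped ComplexOrder

theorem inner_rep_left {A : Type*} [NonUnitalRing A] [StarRing A] [Module ℂ A] {K : Type*}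
    [NormedAddCommGroup K] [InnerProductSpace ℂ K] [CompleteSpace K] (σ : A →⋆ₙₐ[ℂ] (K →L[ℂ] K))
    (a : A) (x y : K) : inner ℂ (σ a x) y = inner ℂ x (σ (star a) y) := by
  have h : σ (star a) = ContinuousLinearMap.adjoint (σ a) := σ.map_star' a
  rw [h]
  exact (ContinuousLinearMap.adjoint_inner_right _ _ _).symm

theorem inner_rep_star_mul {A : Type*} [NonUnitalRing A] [StarRing A] [Module ℂ A] {K : Type*}
    [NormedAddCommGroup K] [InnerProductSpace ℂ K] [CompleteSpace K] (σ : A →⋆ₙₐ[ℂ] (K →L[ℂ] K))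
    (a b : A) (x y : K) : inner ℂ x (σ (star a * b) y) = inner ℂ (σ a x) (σ b y) := by
  rw [inner_rep_left]
  exact congrArg (fun T : K →L[ℂ] K => inner ℂ x (T y)) (σ.map_mul' (star a) b)

/-- Some state on a `C*`-algebra attains the norm of `star d * d`. -/
theorem exists_positive_norm_apply {E : Type*} [CStarAlgebra E] [PartialOrder E]
    [StarOrderedRing E] [Nontrivial E] (d : E) :
    ∃ ψ : E →ₚ[ℂ] ℂ, ψ 1 = 1 ∧ ‖ψ (star d * d)‖ = ‖d‖ ^ 2 := by
  set a := star d * d with ha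
  have hn : IsSelfAdjoint a := IsSelfAdjoint.star_mul_self d
  have hn' : IsStarNormal a := hn.isStarNormal
  let S := StarAlgebra.elemental ℂ a
  have hS : Nontrivial S := inferInstance
  let g := gelfandStarTransform S
  have hg : ∀ x, ‖g x‖ = ‖x‖ := NonUnitalStarAlgHom.norm_map g g.injective
  let a' : S := ⟨a, StarAlgebra.elemental.self_mem ℂ a⟩
  obtain ⟨χ, -, hχ⟩ := isCompact_univ.exists_isMaxOn Set.univ_nonempty
    (g a').continuous.norm.continuousOn
  have hχa : ‖g a' χ‖ = ‖a‖ := by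
    refine le_antisymm (((g a').norm_coe_le_norm χ).trans (hg a').le) ?_
    refine (hg a').ge.trans ((ContinuousMap.norm_le _ (norm_nonneg _)).2 fun x => ?_)
    exact hχ (Set.mem_univ x)
  let φ : S →ₗ[ℂ] ℂ :=
    { toFun := fun x => g x χ
      map_add' := fun x y => by rw [map_add]; rfl
      map_smul' := fun c x => by rw [map_smul]; rfl }
  obtain ⟨ψ, hψ⟩ := exists_positive_extension (D := S) S.subtype Subtype.val_injective φ (c := 1)
    (fun x => by rw [one_mul, ← hg]; exact (g x).norm_coe_le_norm χ)
    (by change g 1 χ = _; rw [map_one]; simp)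
  refine ⟨ψ, ?_, ?_⟩
  · refine (hψ 1).trans ?_
    change g 1 χ = _
    rw [map_one]; rfl
  · refine (congrArg norm (hψ a')).trans (hχa.trans ?_)
    rw [ha, CStarRing.norm_star_mul_self, sq]

theorem inner_gnsVector_self {E : Type*} [CStarAlgebra E] [PartialOrder E] [StarOrderedRing E]
    (ψ : E →ₚ[ℂ] ℂ) : inner ℂ (gnsVector ψ) (gnsVector ψ) = ψ 1 := by
  rw [← inner_gnsVector]
  simp [gnsVector]

theorem norm_gns_gnsVector_sq {E : Type*} [CStarAlgebra E] [PartialOrder E] [StarOrderedRing E]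
    (ψ : E →ₚ[ℂ] ℂ) (x : E) :
    ‖ψ.gnsNonUnitalStarAlgHom x (gnsVector ψ)‖ ^ 2 = ‖ψ (star x * x)‖ := by
  rw [← inner_gnsVector, inner_rep_star_mul, inner_self_eq_norm_sq_to_K]
  simp

end Universal

variable {B : Type u} [NonUnitalRing B] [StarRing B] [Module ℂ B]

/-- A family of Hilbert space representations dominated by a seminorm `q` which detects `q`, and
in which every vector functional of a representation of an algebra over `B` that is dominated by
`q` is realized. -/
structure UniversalFamily (q : Seminorm ℂ B) where
  Index : Type u
  space : Index → Type u
  [normedAddCommGroup : ∀ i, NormedAddCommGroup (space i)]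
  [innerProductSpace : ∀ i, InnerProductSpace ℂ (space i)]
  [completeSpace : ∀ i, CompleteSpace (space i)]
  rep : ∀ i, B →⋆ₙₐ[ℂ] (space i →L[ℂ] space i)
  norm_rep_le : ∀ i b, ‖rep i b‖ ≤ q b
  le_norm_rep : ∀ b, ∃ i, q b ≤ ‖rep i b‖
  exists_vector : ∀ {A : Type u} [NonUnitalRing A] [StarRing A] [Module ℂ A] [IsScalarTower ℂ A A]
    [SMulCommClass ℂ A A] [StarModule ℂ A] (f : A →⋆ₙₐ[ℂ] B) {K : Type u} [NormedAddCommGroup K]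
    [InnerProductSpace ℂ K] [CompleteSpace K] (σ : A →⋆ₙₐ[ℂ] (K →L[ℂ] K)),
    (∀ a, ‖σ a‖ ≤ q (f a)) → ∀ ξ : K, ∃ i, ∃ η : space i,
      inner ℂ η η = inner ℂ ξ ξ ∧ ∀ a, inner ℂ η (rep i (f a) η) = inner ℂ ξ (σ a ξ)

attribute [instance] UniversalFamily.normedAddCommGroup UniversalFamily.innerProductSpace
  UniversalFamily.completeSpace

open scoped ComplexOrder in
/-- The universal family consists of the GNS representations of the positive functionals on the
unitization of the completion. -/
theorem IsCStarSeminorm.nonempty_universalFamily [IsScalarTower ℂ B B] [SMulCommClass ℂ B B]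
    [StarModule ℂ B] {q : Seminorm ℂ B} (hq : IsCStarSeminorm q) :
    Nonempty (UniversalFamily q) := by
  obtain ⟨D, _, i, hi, -, -⟩ := hq.exists_completion
  let _ : PartialOrder (Unitization ℂ D) := CStarAlgebra.spectralOrder _
  have _ : StarOrderedRing (Unitization ℂ D) := CStarAlgebra.spectralOrderedRing _
  let i' : B →⋆ₙₐ[ℂ] Unitization ℂ D := (Unitization.inrNonUnitalStarAlgHom ℂ D).comp i
  have hi' : ∀ b, ‖i' b‖ = q b := fun b => (Unitization.norm_inr (i b)).trans (hi b)
  refine ⟨{ Index := Unitization ℂ D →ₚ[ℂ] ℂ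
            space := fun ψ => ψ.GNS
            rep := fun ψ => ψ.gnsNonUnitalStarAlgHom.comp i'
            norm_rep_le := fun ψ b => ?_
            le_norm_rep := fun b => ?_
            exists_vector := ?_ }⟩
  · rw [← hi']
    exact NonUnitalStarAlgHom.norm_apply_le ψ.gnsNonUnitalStarAlgHom (i' b)
  · obtain ⟨ψ, h1, hψ⟩ := exists_positive_norm_apply (i' b)
    refine ⟨ψ, ?_⟩
    have hη : ‖gnsVector ψ‖ = 1 := by
      have h2 := inner_gnsVector_self ψ
      rw [h1, inner_self_eq_norm_sq_to_K] at h2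
      have h3 : ‖gnsVector ψ‖ ^ 2 = (1 : ℝ) := Complex.ofReal_injective (by push_cast; exact h2)
      exact (pow_eq_one_iff_of_nonneg (norm_nonneg _) two_ne_zero).1 h3
    have h2 := norm_gns_gnsVector_sq ψ (i' b)
    rw [hψ, hi', pow_left_inj₀ (norm_nonneg _) (apply_nonneg q b) two_ne_zero] at h2
    rw [← h2]
    have := (ψ.gnsNonUnitalStarAlgHom (i' b)).le_opNorm (gnsVector ψ)
    rwa [hη, mul_one] at this
  · -- The completion `D'` of `A` embeds in `D`; extend the vector functional of `ξ`.
    intro A _ _ _ _ _ _ f K _ _ _ σ hσ ξ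
    obtain ⟨D', _, k, hk, hkd, hlift⟩ := (hq.comp f).exists_completion
    obtain ⟨j, hj⟩ := hlift D (i.comp f) fun a => (hi (f a)).le
    obtain ⟨τ, hτ⟩ := hlift (K →L[ℂ] K) σ hσ
    have hjn : ∀ x, ‖j x‖ = ‖x‖ := by
      have hc : Continuous j := (AddMonoidHomClass.lipschitz_of_bound_nnnorm j 1 fun x => by
        rw [one_mul]; exact NonUnitalStarAlgHom.norm_apply_le j x).continuous
      refine fun x => hkd.induction_on x (isClosed_eq hc.norm continuous_norm) fun a => ?_
      rw [hj, hk]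
      exact hi (f a)
    have hjinj : Function.Injective j := (injective_iff_map_eq_zero j).2 fun x hx => by
      rw [← norm_eq_zero, ← hjn, hx, norm_zero]
    let τ' : Unitization ℂ D' →⋆ₐ[ℂ] (K →L[ℂ] K) := Unitization.starLift τ
    let φ : Unitization ℂ D' →ₗ[ℂ] ℂ :=
      { toFun := fun x => inner ℂ ξ (τ' x ξ)
        map_add' := fun x y => by rw [map_add, _root_.add_apply, inner_add_right]
        map_smul' := fun c x => by
          rw [map_smul, _root_.smul_apply, inner_smul_right]; rfl }
    have h1 : φ 1 = ((‖ξ‖ ^ 2 : ℝ) : ℂ) := by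
      change inner ℂ ξ (τ' 1 ξ) = _
      rw [map_one, one_apply_eq_self, inner_self_eq_norm_sq_to_K]
      push_cast; rfl
    obtain ⟨ψ, hψ⟩ := exists_positive_extension (Unitization.starMap j)
      (Unitization.starMap_injective hjinj) φ (c := ‖ξ‖ ^ 2) (fun x => by
        refine (norm_inner_le_norm _ _).trans ?_
        have := ((τ' x).le_opNorm ξ).trans (mul_le_mul_of_nonneg_right
          (NonUnitalStarAlgHom.norm_apply_le τ' x) (norm_nonneg ξ))
        nlinarith [norm_nonneg ξ, mul_le_mul_of_nonneg_left this (norm_nonneg ξ)]) h1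
    refine ⟨ψ, gnsVector ψ, ?_, fun a => ?_⟩
    · rw [inner_gnsVector_self, ← map_one (Unitization.starMap j), hψ, h1,
        inner_self_eq_norm_sq_to_K]
      push_cast; rfl
    · refine (inner_gnsVector ψ (i' (f a))).trans ?_
      have h2 : i' (f a) = Unitization.starMap j (k a : Unitization ℂ D') := by
        rw [Unitization.starMap_inr, hj]; rfl
      rw [h2, hψ]
      change inner ℂ ξ (τ' (k a : Unitization ℂ D') ξ) = _
      have h3 : τ' (k a : Unitization ℂ D') = σ a := by
        rw [← hτ, ← Unitization.starLift_symm_apply_apply, Equiv.symm_apply_apply]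
      rw [h3]

end LmcCStar

namespace LmcCStar

/-! ### Direct sums of representations -/

section DirectSum

variable {I : Type*} {G : I → Type*} [∀ i, NormedAddCommGroup (G i)]
  [∀ i, InnerProductSpace ℂ (G i)]

/-- The diagonal operator on a Hilbert sum given by a bounded family of operators. -/
noncomputable def diagOp (T : ∀ i, G i →L[ℂ] G i) {C : ℝ} (hC : ∀ i, ‖T i‖ ≤ C) :
    lp G 2 →L[ℂ] lp G 2 :=
  have hle : ∀ (x : lp G 2) i, ‖T i (x i)‖ ^ 2 ≤ C ^ 2 * ‖x i‖ ^ 2 := fun x i => by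
    rw [← mul_pow]
    exact pow_le_pow_left₀ (norm_nonneg _) (((T i).le_opNorm _).trans
      (mul_le_mul_of_nonneg_right (hC i) (norm_nonneg _))) 2
  have hsum : ∀ x : lp G 2, Summable fun i => ‖x i‖ ^ 2 := fun x => by
    simpa using (lp.memℓp x).summable (by simp)
  have hsum' : ∀ x : lp G 2, Summable fun i => ‖T i (x i)‖ ^ 2 := fun x =>
    Summable.of_nonneg_of_le (fun i => by positivity) (hle x) ((hsum x).mul_left (C ^ 2))
  LinearMap.mkContinuous
    { toFun := fun x => ⟨fun i => T i (x i), memℓp_gen (by simpa using hsum' x)⟩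
      map_add' := fun x y => by
        ext i; exact map_add (T i) (x i) (y i)
      map_smul' := fun c x => by ext i; simp } |C| fun x => by
    have h1 : ∀ y : lp G 2, ‖y‖ ^ 2 = ∑' i, ‖y i‖ ^ 2 := fun y => by
      simpa using lp.norm_rpow_eq_tsum (p := 2) (by simp) y
    refine (pow_le_pow_iff_left₀ (norm_nonneg _) (by positivity) two_ne_zero).1 ?_
    rw [mul_pow, sq_abs, h1, h1, ← tsum_mul_left]
    exact (hsum' x).tsum_le_tsum (hle x) ((hsum x).mul_left (C ^ 2))

theorem diagOp_apply (T : ∀ i, G i →L[ℂ] G i) {C : ℝ} (hC : ∀ i, ‖T i‖ ≤ C) (x : lp G 2) (i : I) :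
    diagOp T hC x i = T i (x i) := rfl

theorem norm_diagOp_le (T : ∀ i, G i →L[ℂ] G i) {C : ℝ} (hC : ∀ i, ‖T i‖ ≤ C) (h0 : 0 ≤ C) :
    ‖diagOp T hC‖ ≤ C := by
  unfold diagOp
  exact (LinearMap.mkContinuous_norm_le _ (abs_nonneg C) _).trans (abs_of_nonneg h0).le

theorem diagOp_single [DecidableEq I] (T : ∀ i, G i →L[ℂ] G i) {C : ℝ} (hC : ∀ i, ‖T i‖ ≤ C)
    (i : I) (x : G i) : diagOp T hC (lp.single 2 i x) = lp.single 2 i (T i x) := by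
  ext j
  rw [diagOp_apply]
  by_cases h : j = i
  · subst h; simp
  · rw [lp.single_apply_ne _ _ _ h, lp.single_apply_ne _ _ _ h, map_zero]

variable [∀ i, CompleteSpace (G i)] {A : Type*} [NonUnitalRing A] [StarRing A] [Module ℂ A]

/-- The direct sum of a family of representations dominated by a seminorm. -/
noncomputable def sumRep (σ : ∀ i, A →⋆ₙₐ[ℂ] (G i →L[ℂ] G i)) (p : Seminorm ℂ A)
    (h : ∀ i a, ‖σ i a‖ ≤ p a) : A →⋆ₙₐ[ℂ] (lp G 2 →L[ℂ] lp G 2) where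
  toFun a := diagOp (fun i => σ i a) fun i => h i a
  map_smul' c a := by ext x i; simp [diagOp_apply]
  map_zero' := by ext x i; simp [diagOp_apply]
  map_add' a b := by ext x i; simp [diagOp_apply]
  map_mul' a b := by ext x i; simp [diagOp_apply]
  map_star' a := by
    rw [ContinuousLinearMap.star_eq_adjoint, ContinuousLinearMap.eq_adjoint_iff]
    intro x y
    rw [lp.inner_eq_tsum, lp.inner_eq_tsum]
    refine tsum_congr fun i => ?_
    rw [diagOp_apply, diagOp_apply, inner_rep_left, star_star]

theorem norm_sumRep_le (σ : ∀ i, A →⋆ₙₐ[ℂ] (G i →L[ℂ] G i)) (p : Seminorm ℂ A)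
    (h : ∀ i a, ‖σ i a‖ ≤ p a) (a : A) : ‖sumRep σ p h a‖ ≤ p a :=
  norm_diagOp_le _ (fun i => h i a) (apply_nonneg p a)

theorem sumRep_single [DecidableEq I] (σ : ∀ i, A →⋆ₙₐ[ℂ] (G i →L[ℂ] G i)) (p : Seminorm ℂ A)
    (h : ∀ i a, ‖σ i a‖ ≤ p a) (a : A) (i : I) (x : G i) :
    sumRep σ p h a (lp.single 2 i x) = lp.single 2 i (σ i a x) := diagOp_single _ (fun i => h i a) _ _

theorem norm_le_norm_sumRep (σ : ∀ i, A →⋆ₙₐ[ℂ] (G i →L[ℂ] G i)) (p : Seminorm ℂ A)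
    (h : ∀ i a, ‖σ i a‖ ≤ p a) (a : A) (i : I) : ‖σ i a‖ ≤ ‖sumRep σ p h a‖ := by
  classical
  refine ContinuousLinearMap.opNorm_le_bound _ (norm_nonneg _) fun x => ?_
  have := (sumRep σ p h a).le_opNorm (lp.single 2 i x)
  rwa [sumRep_single, lp.norm_single (by simp), lp.norm_single (by simp)] at this

end DirectSum

/-! ### Intertwining isometries -/

section Gram

variable {K H : Type*} [NormedAddCommGroup K] [InnerProductSpace ℂ K] [CompleteSpace K]
  [NormedAddCommGroup H] [InnerProductSpace ℂ H] [CompleteSpace H]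

/-- Two families of vectors with equal Gram matrices are related by an isometry. -/
theorem exists_isometry_of_inner_eq {ι : Type*} (u : ι → K) (w : ι → H)
    (h : ∀ i j, inner ℂ (u i) (u j) = inner ℂ (w i) (w j))
    (hu : ∀ z, (∀ i, inner ℂ (u i) z = 0) → z = 0) :
    ∃ V : K →ₗᵢ[ℂ] H, ∀ i, V (u i) = w i := by
  let U := Finsupp.linearCombination ℂ u
  let W := Finsupp.linearCombination ℂ w
  have hinner : ∀ c d, inner ℂ (U c) (U d) = inner ℂ (W c) (W d) := fun c d => by
    simp only [U, W, Finsupp.linearCombination_apply, Finsupp.sum_inner, Finsupp.inner_sum,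
      inner_smul_left, inner_smul_right, h]
  have hnorm : ∀ c, ‖W c‖ = ‖U c‖ := fun c => by
    rw [@norm_eq_sqrt_re_inner ℂ, @norm_eq_sqrt_re_inner ℂ, hinner]
  have hd : DenseRange U := by
    have h1 : (LinearMap.range U).topologicalClosure = ⊤ := by
      rw [Submodule.topologicalClosure_eq_top_iff, Submodule.eq_bot_iff]
      intro z hz
      refine hu z fun i => ?_
      have := (Submodule.mem_orthogonal _ _).1 hz (U (Finsupp.single i 1)) ⟨_, rfl⟩
      simpa [U] using this
    have := Submodule.dense_iff_topologicalClosure_eq_top.2 h1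
    exact this
  let V := W.extendOfNorm U
  have hV : ∀ c, V (U c) = W c := W.extendOfNorm_eq hd ⟨1, fun c => by rw [hnorm, one_mul]⟩
  refine ⟨⟨V.toLinearMap, fun x => ?_⟩, fun i => ?_⟩
  · refine hd.induction_on x (isClosed_eq V.continuous.norm continuous_norm) fun c => ?_
    exact (congrArg norm (hV c)).trans (hnorm c)
  · have := hV (Finsupp.single i 1)
    simpa [U, W] using this

theorem ContinuousLinearMap.eq_of_total {ι : Type*} {u : ι → K}
    (hu : ∀ z, (∀ i, inner ℂ (u i) z = 0) → z = 0) {P Q : K →L[ℂ] H}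
    (h : ∀ i, P (u i) = Q (u i)) : P = Q := by
  refine sub_eq_zero.1 (ContinuousLinearMap.ext fun x => ?_)
  have h2 : ContinuousLinearMap.adjoint (P - Q) ((P - Q) x) = 0 := hu _ fun y => by
    rw [ContinuousLinearMap.adjoint_inner_right]
    have : (P - Q) (u y) = 0 := sub_eq_zero.2 (h y)
    rw [this, inner_zero_left]
  rw [_root_.zero_apply, ← inner_self_eq_zero (𝕜 := ℂ), ← ContinuousLinearMap.adjoint_inner_right,
    h2, inner_zero_right]

/-- Bessel's inequality bounds the cardinality of an orthogonal family. -/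
theorem nonempty_embedding_of_orthogonal {K : Type*} [NormedAddCommGroup K]
    [InnerProductSpace ℂ K] {δ : Type*} (D : δ → K)
    (hD : ∀ z, (∀ d, inner ℂ (D d) z = 0) → z = 0) (T : Set K) (h0 : (0 : K) ∉ T)
    (hT : ∀ x ∈ T, ∀ y ∈ T, x ≠ y → inner ℂ x y = 0) : Nonempty (T ↪ δ × ℕ) := by
  have hne : ∀ t : T, (t : K) ≠ 0 := fun t h => h0 (h ▸ t.2)
  have hex : ∀ t : T, ∃ d, inner ℂ (D d) (t : K) ≠ 0 := fun t => by
    by_contra! h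
    exact hne t (hD _ h)
  choose d hd using hex
  have ho : Orthonormal ℂ fun t : T => ((‖(t : K)‖⁻¹ : ℝ) : ℂ) • (t : K) := by
    refine ⟨fun t => ?_, fun s t hst => ?_⟩
    · rw [norm_smul, Complex.norm_real, norm_inv, norm_norm]
      exact inv_mul_cancel₀ (norm_ne_zero_iff.2 (hne t))
    · change inner ℂ (_ • (s : K)) (_ • (t : K)) = 0
      rw [inner_smul_left, inner_smul_right, hT _ s.2 _ t.2 fun h => hst (Subtype.ext h),
        mul_zero, mul_zero]
  have hc : ∀ e, {t : T | inner ℂ (D e) (t : K) ≠ 0}.Countable := fun e => by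
    refine ((ho.inner_products_summable (x := D e)).countable_support).mono fun t ht => ?_
    simp only [Function.mem_support, ne_eq, pow_eq_zero_iff two_ne_zero, norm_eq_zero]
    rw [inner_smul_left]
    refine mul_ne_zero ?_ ?_
    · simpa using hne t
    · rwa [← inner_conj_symm, Ne, map_eq_zero]
  choose n hn using fun e => Set.countable_iff_exists_injOn.1 (hc e)
  refine ⟨⟨fun t => (d t, n (d t) t), fun s t h => ?_⟩⟩
  have h1 : d s = d t := congrArg Prod.fst h
  have h2 : n (d s) s = n (d t) t := congrArg Prod.snd h
  rw [← h1] at h2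
  exact hn (d s) (hd s) (h1 ▸ hd t) h2

end Gram

section Cyclic

variable {A : Type*} [NonUnitalRing A] [StarRing A] [Module ℂ A] {K : Type*}
  [NormedAddCommGroup K] [InnerProductSpace ℂ K] [CompleteSpace K] (σ : A →⋆ₙₐ[ℂ] (K →L[ℂ] K))

/-- Every representation is generated by vectors whose cyclic subspaces are mutually orthogonal. -/
theorem exists_orthogonal_cyclic : ∃ T : Set K, (0 : K) ∉ T ∧
    (∀ x ∈ T, ∀ y ∈ T, x ≠ y → inner ℂ x y = 0 ∧ ∀ a, inner ℂ x (σ a y) = 0) ∧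
    ∀ z, (∀ x ∈ T, inner ℂ x z = 0 ∧ ∀ a, inner ℂ (σ a x) z = 0) → z = 0 := by
  obtain ⟨T, hT⟩ := zorn_subset {T : Set K | (0 : K) ∉ T ∧
    ∀ x ∈ T, ∀ y ∈ T, x ≠ y → inner ℂ x y = 0 ∧ ∀ a, inner ℂ x (σ a y) = 0} (by
      intro c hc hch
      refine ⟨⋃₀ c, ⟨?_, ?_⟩, fun s hs => Set.subset_sUnion_of_mem hs⟩
      · rintro ⟨s, hs, h⟩
        exact (hc hs).1 h
      · rintro x ⟨s, hs, hx⟩ y ⟨t, ht, hy⟩ hxy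
        rcases hch.total hs ht with hst | hst
        · exact (hc ht).2 x (hst hx) y hy hxy
        · exact (hc hs).2 x hx y (hst hy) hxy)
  refine ⟨T, hT.prop.1, hT.prop.2, fun z hz => ?_⟩
  by_contra hz0
  have hmem : insert z T ∈ {T : Set K | (0 : K) ∉ T ∧
      ∀ x ∈ T, ∀ y ∈ T, x ≠ y → inner ℂ x y = 0 ∧ ∀ a, inner ℂ x (σ a y) = 0} := by
    refine ⟨?_, ?_⟩
    · rintro (h | h)
      · exact hz0 h.symm
      · exact hT.prop.1 h
    · rintro x (rfl | hx) y (rfl | hy) hxy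
      · exact absurd rfl hxy
      · refine ⟨?_, fun a => ?_⟩
        · rw [← inner_conj_symm, (hz y hy).1, map_zero]
        · rw [← inner_conj_symm, (hz y hy).2, map_zero]
      · refine ⟨(hz x hx).1, fun a => ?_⟩
        have := (hz x hx).2 (star a)
        rwa [inner_rep_left, star_star] at this
      · exact hT.prop.2 x hx y hy hxy
  have hzT : z ∈ T := hT.le_of_ge hmem (Set.subset_insert z T) (Set.mem_insert z T)
  exact hz0 (inner_self_eq_zero.1 (hz z hzT).1)

end Cyclic

namespace UniversalFamily

variable {B : Type u} [NonUnitalRing B] [StarRing B] [Module ℂ B] {q : Seminorm ℂ B}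
  (F : UniversalFamily q) (L : Type u)

/-- The Hilbert sum of copies, indexed by `L`, of all spaces of a universal family. -/
abbrev Sum : Type u := lp (fun x : F.Index × L => F.space x.1) 2

/-- The representation on `F.Sum L`. -/
noncomputable def sumRep : B →⋆ₙₐ[ℂ] (F.Sum L →L[ℂ] F.Sum L) :=
  LmcCStar.sumRep (fun x : F.Index × L => F.rep x.1) q fun x => F.norm_rep_le x.1

theorem norm_sumRep [Nonempty L] (b : B) : ‖F.sumRep L b‖ = q b := by
  refine le_antisymm (norm_sumRep_le _ _ _ b) ?_
  obtain ⟨i, hi⟩ := F.le_norm_rep b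
  exact hi.trans (norm_le_norm_sumRep (fun x : F.Index × L => F.rep x.1) q
    (fun x => F.norm_rep_le x.1) b (i, Classical.arbitrary L))

/-- A representation whose orthogonal families are bounded by `L` embeds into `F.Sum L`. -/
theorem exists_intertwiner {A : Type u} [NonUnitalRing A] [StarRing A] [Module ℂ A]
    [IsScalarTower ℂ A A] [SMulCommClass ℂ A A] [StarModule ℂ A] (f : A →⋆ₙₐ[ℂ] B) {K : Type u}
    [NormedAddCommGroup K] [InnerProductSpace ℂ K] [CompleteSpace K] (σ : A →⋆ₙₐ[ℂ] (K →L[ℂ] K))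
    (hσ : ∀ a, ‖σ a‖ ≤ q (f a))
    (hL : ∀ T : Set K, (0 : K) ∉ T → (∀ x ∈ T, ∀ y ∈ T, x ≠ y → inner ℂ x y = 0) →
      Nonempty (T ↪ L)) :
    ∃ V : K →ₗᵢ[ℂ] F.Sum L, ∀ a x, V (σ a x) = F.sumRep L (f a) (V x) := by
  classical
  obtain ⟨T, h0, hT, hTd⟩ := exists_orthogonal_cyclic σ
  obtain ⟨e⟩ := hL T h0 fun x hx y hy h => (hT x hx y hy h).1
  choose i η hη hηa using fun t : T => F.exists_vector f σ hσ (t : K)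
  -- `none` stands for the cyclic vector itself, which a non-unital algebra need not produce; distinct
  -- cyclic subspaces are sent to distinct copies.
  let u : T × Option A → K := fun x => x.2.elim (x.1 : K) fun a => σ a x.1
  let o : ∀ x : T × Option A, F.space (i x.1) := fun x =>
    x.2.elim (η x.1) fun a => F.rep (i x.1) (f a) (η x.1)
  let w : T × Option A → F.Sum L := fun x =>
    lp.single (E := fun x : F.Index × L => F.space x.1) 2 (i x.1, e x.1) (o x)
  have hw : ∀ a t, F.sumRep L (f a) (w (t, none)) = w (t, some a) := fun a t =>
    sumRep_single (fun x : F.Index × L => F.rep x.1) q (fun x => F.norm_rep_le x.1) (f a)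
      (i t, e t) _
  have hw' : ∀ a b t, F.sumRep L (f a) (w (t, some b)) = w (t, some (a * b)) := fun a b t => by
    rw [← hw, ← hw, map_mul, map_mul]; rfl
  have hgram : ∀ x y, inner ℂ (u x) (u y) = inner ℂ (w x) (w y) := by
    rintro ⟨s, a⟩ ⟨t, b⟩
    by_cases hst : s = t
    · subst hst
      have : inner ℂ (w (s, a)) (w (s, b)) = inner ℂ (o (s, a)) (o (s, b)) := by
        simp only [w]
        rw [lp.inner_single_left, lp.single_apply_self]
      rw [this]
      rcases a with _ | a <;> rcases b with _ | b
      · exact (hη s).symm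
      · exact (hηa s b).symm
      · change inner ℂ (σ a s) _ = inner ℂ (F.rep (i s) (f a) (η s)) (η s)
        rw [inner_rep_left, inner_rep_left, ← StarHomClass.map_star, hηa]; rfl
      · change inner ℂ (σ a s) (σ b s) =
          inner ℂ (F.rep (i s) (f a) (η s)) (F.rep (i s) (f b) (η s))
        rw [← inner_rep_star_mul, ← inner_rep_star_mul, ← StarHomClass.map_star, ← map_mul, hηa]
    · have hne : (s : K) ≠ t := fun h => hst (Subtype.ext h)
      have : inner ℂ (w (s, a)) (w (t, b)) = 0 := by
        simp only [w]
        rw [lp.inner_single_left, lp.single_apply_ne _ _ _ fun h =>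
          hst (e.injective (congrArg Prod.snd h)), inner_zero_right]
      rw [this]
      have h1 := hT s s.2 t t.2 hne
      rcases a with _ | a <;> rcases b with _ | b
      · exact h1.1
      · exact h1.2 b
      · change inner ℂ (σ a s) (t : K) = 0
        rw [inner_rep_left]; exact h1.2 _
      · change inner ℂ (σ a s) (σ b t) = 0
        rw [← inner_rep_star_mul]; exact h1.2 _
  have hu : ∀ z, (∀ x, inner ℂ (u x) z = 0) → z = 0 := fun z hz =>
    hTd z fun x hx => ⟨hz (⟨x, hx⟩, none), fun a => hz (⟨x, hx⟩, some a)⟩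
  obtain ⟨V, hV⟩ := exists_isometry_of_inner_eq u w hgram hu
  refine ⟨V, fun a x => ?_⟩
  have hP : V.toContinuousLinearMap ∘L σ a = F.sumRep L (f a) ∘L V.toContinuousLinearMap := by
    refine ContinuousLinearMap.eq_of_total hu ?_
    rintro ⟨t, _ | b⟩
    · change V (σ a (u (t, none))) = F.sumRep L (f a) (V (u (t, none)))
      rw [hV, hw, ← hV]; rfl
    · change V (σ a (u (t, some b))) = F.sumRep L (f a) (V (u (t, some b)))
      have : σ a (u (t, some b)) = u (t, some (a * b)) := by
        change σ a (σ b t) = σ (a * b) t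
        rw [map_mul]; rfl
      rw [hV, hw', this, hV]
  exact congrArg (fun P : K →L[ℂ] F.Sum L => P x) hP

open Cardinal in
/-- The multiplicity `L` can be taken large enough to embed the orthogonal families of any other sum
of `L` copies of universal representations. -/
theorem nonempty_embedding_of_orthogonal (hL : ℵ₀ ≤ #L) (hF : #(Σ i, F.space i) ≤ #L)
    (T : Set (F.Sum L)) (h0 : (0 : F.Sum L) ∉ T)
    (hT : ∀ x ∈ T, ∀ y ∈ T, x ≠ y → inner ℂ x y = 0) : Nonempty (T ↪ L) := by
  classical
  let D : (Σ x : F.Index × L, F.space x.1) → F.Sum L := fun x =>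
    lp.single (E := fun x : F.Index × L => F.space x.1) 2 x.1 x.2
  obtain ⟨e⟩ := LmcCStar.nonempty_embedding_of_orthogonal D (fun z hz => by
    ext x
    refine inner_self_eq_zero (𝕜 := ℂ).1 ?_
    have := hz ⟨x, z x⟩
    rwa [lp.inner_single_left] at this) T h0 hT
  have h1 : #((Σ x : F.Index × L, F.space x.1) × ℕ) ≤ #L := by
    have h2 : #(Σ x : F.Index × L, F.space x.1) ≤ #((Σ i, F.space i) × L) :=
      mk_le_of_injective (f := fun x => (⟨x.1.1, x.2⟩, x.1.2)) (by
        rintro ⟨⟨i, l⟩, x⟩ ⟨⟨j, m⟩, y⟩ h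
        simp only [Prod.mk.injEq, Sigma.mk.injEq] at h
        obtain ⟨⟨rfl, h1⟩, rfl⟩ := h
        rw [eq_of_heq h1])
    rw [mk_prod, lift_id', mk_nat, lift_aleph0]
    refine (mul_le_mul' (h2.trans ?_) hL).trans (mul_eq_self hL).le
    rw [mk_prod, lift_id, lift_id]
    exact (mul_le_mul' hF le_rfl).trans (mul_eq_self hL).le
  obtain ⟨g⟩ := h1
  exact ⟨e.trans g⟩

end UniversalFamily

end LmcCStar

namespace LmcCStar

/-! ### Amalgamation of seminorms -/

section SchroederBernstein

variable {A : Type*} [NonUnitalRing A] [StarRing A] [Module ℂ A]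
  {K H : Type*} [NormedAddCommGroup K] [InnerProductSpace ℂ K] [CompleteSpace K]
  [NormedAddCommGroup H] [InnerProductSpace ℂ H] [CompleteSpace H]

/-- The Schröder-Bernstein theorem for representations: two representations which embed into each
other are unitarily equivalent. -/
theorem exists_unitary_equiv (σ : A →⋆ₙₐ[ℂ] (K →L[ℂ] K)) (τ : A →⋆ₙₐ[ℂ] (H →L[ℂ] H))
    (V : K →ₗᵢ[ℂ] H) (hV : ∀ a x, V (σ a x) = τ a (V x))
    (W : H →ₗᵢ[ℂ] K) (hW : ∀ a x, W (τ a x) = σ a (W x)) :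
    ∃ U : K ≃ₗᵢ[ℂ] H, ∀ a x, U (σ a x) = τ a (U x) := by
  -- as in the set-theoretic proof, use a fixed point `M` of `M ↦ K ⊖ W (H ⊖ V M)`
  let Φ : Submodule ℂ K →o Submodule ℂ K :=
    ⟨fun M => (((M.map V.toLinearMap)ᗮ).map W.toLinearMap)ᗮ, fun M N h =>
      Submodule.orthogonal_le (Submodule.map_mono (Submodule.orthogonal_le
        (Submodule.map_mono h)))⟩
  obtain ⟨M, hM⟩ : ∃ M, M = Φ.lfp := ⟨_, rfl⟩
  have hfix : (((M.map V.toLinearMap)ᗮ).map W.toLinearMap)ᗮ = M := by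
    rw [hM]; exact Φ.map_lfp
  have hstep : ∀ M : Submodule ℂ K, (∀ a, ∀ x ∈ M, σ a x ∈ M) →
      ∀ a, ∀ y ∈ (M.map V.toLinearMap)ᗮ, τ a y ∈ (M.map V.toLinearMap)ᗮ := by
    intro M h a y hy
    rw [Submodule.mem_orthogonal] at hy ⊢
    rintro _ ⟨x, hx, rfl⟩
    have := hy _ ⟨σ (star a) x, h _ x hx, rfl⟩
    have h2 : V.toLinearMap (σ (star a) x) = τ (star a) (V x) := hV _ _
    rw [h2, inner_rep_left, star_star] at this
    exact this
  have hinv : ∀ a, ∀ x ∈ M, σ a x ∈ M := by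
    rw [hM]
    refine Φ.lfp_induction (p := fun M => ∀ a, ∀ x ∈ M, σ a x ∈ M) ?_ ?_
    · intro M h _ a x hx
      change _ ∈ (((M.map V.toLinearMap)ᗮ).map W.toLinearMap)ᗮ
      change _ ∈ (((M.map V.toLinearMap)ᗮ).map W.toLinearMap)ᗮ at hx
      rw [Submodule.mem_orthogonal] at hx ⊢
      rintro _ ⟨y, hy, rfl⟩
      have := hx _ ⟨τ (star a) y, hstep M h _ y hy, rfl⟩
      have h2 : W.toLinearMap (τ (star a) y) = σ (star a) (W y) := hW _ _
      rw [h2, inner_rep_left, star_star] at this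
      exact this
    · intro s hs a x hx
      have : sSup s ≤ (sSup s).comap (σ a : K →ₗ[ℂ] K) :=
        sSup_le fun N hN x hx => le_sSup hN (hs N hN a x hx)
      exact this hx
  let N : Submodule ℂ H := (M.map V.toLinearMap)ᗮ
  let u : M ⊕ N → K := Sum.elim (fun x => (x : K)) fun y => W y
  let w : M ⊕ N → H := Sum.elim (fun x => V x) fun y => (y : H)
  have hcross : ∀ (x : M) (y : N), inner ℂ (V x) (y : H) = 0 := fun x y =>
    (Submodule.mem_orthogonal _ _).1 y.2 _ ⟨x, x.2, rfl⟩
  have hcross' : ∀ (x : M) (y : N), inner ℂ (W y) (x : K) = 0 := fun x y => by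
    exact (Submodule.mem_orthogonal _ _).1 (hfix.ge x.2) _ ⟨y, y.2, rfl⟩
  have hgram : ∀ i j, inner ℂ (u i) (u j) = inner ℂ (w i) (w j) := by
    rintro (x | y) (x' | y')
    · exact (V.inner_map_map _ _).symm
    · change inner ℂ (x : K) (W y') = inner ℂ (V x) (y' : H)
      rw [hcross, ← inner_conj_symm, hcross', map_zero]
    · change inner ℂ (W y) (x' : K) = inner ℂ (y : H) (V x')
      rw [hcross', ← inner_conj_symm, hcross, map_zero]
    · exact W.inner_map_map _ _
  have hu : ∀ z, (∀ i, inner ℂ (u i) z = 0) → z = 0 := fun z hz => by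
    have hzM : z ∈ M := by
      rw [← hfix, Submodule.mem_orthogonal]
      rintro _ ⟨y, hy, rfl⟩
      exact hz (Sum.inr ⟨y, hy⟩)
    exact inner_self_eq_zero.1 (hz (Sum.inl ⟨z, hzM⟩))
  have hw : ∀ z, (∀ i, inner ℂ (w i) z = 0) → z = 0 := fun z hz => by
    have hzN : z ∈ N := by
      rw [Submodule.mem_orthogonal]
      rintro _ ⟨x, hx, rfl⟩
      exact hz (Sum.inl ⟨x, hx⟩)
    exact inner_self_eq_zero.1 (hz (Sum.inr ⟨z, hzN⟩))
  obtain ⟨U, hU⟩ := exists_isometry_of_inner_eq u w hgram hu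
  obtain ⟨U', hU'⟩ := exists_isometry_of_inner_eq w u (fun i j => (hgram i j).symm) hw
  have hUU' : U.toContinuousLinearMap ∘L U'.toContinuousLinearMap =
      ContinuousLinearMap.id ℂ H := ContinuousLinearMap.eq_of_total hw fun i => by
    change U (U' (w i)) = w i
    rw [hU', hU]
  refine ⟨LinearIsometryEquiv.ofSurjective U fun y => ⟨U' y, DFunLike.congr_fun hUU' y⟩,
    fun a x => ?_⟩
  have hUσ : U.toContinuousLinearMap ∘L σ a = τ a ∘L U.toContinuousLinearMap := by
    refine ContinuousLinearMap.eq_of_total hu ?_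
    rintro (x | y)
    · change U (σ a x) = τ a (U (u (Sum.inl x)))
      rw [hU]
      exact (hU (Sum.inl ⟨σ a x, hinv a x x.2⟩)).trans (hV a x)
    · change U (σ a (W y)) = τ a (U (u (Sum.inr y)))
      rw [hU, ← hW]
      exact hU (Sum.inr ⟨τ a y, hstep M hinv a y y.2⟩)
  exact congrArg (fun P : K →L[ℂ] H => P x) hUσ

end SchroederBernstein

/-- Conjugation of operators by a unitary. -/
noncomputable def conjUnitary {K H : Type*} [NormedAddCommGroup K] [InnerProductSpace ℂ K]
    [CompleteSpace K] [NormedAddCommGroup H] [InnerProductSpace ℂ H] [CompleteSpace H]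
    (U : K ≃ₗᵢ[ℂ] H) : (H →L[ℂ] H) →⋆ₙₐ[ℂ] (K →L[ℂ] K) where
  toFun T := U.symm.toContinuousLinearEquiv.toContinuousLinearMap ∘L T ∘L
    U.toContinuousLinearEquiv.toContinuousLinearMap
  map_smul' c T := by ext x; simp
  map_zero' := by ext x; simp
  map_add' S T := by ext x; simp
  map_mul' S T := by ext x; simp
  map_star' T := by
    rw [ContinuousLinearMap.star_eq_adjoint, ContinuousLinearMap.star_eq_adjoint,
      ContinuousLinearMap.eq_adjoint_iff]
    intro x y
    change inner ℂ (U.symm (ContinuousLinearMap.adjoint T (U x))) y =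
      inner ℂ x (U.symm (T (U y)))
    rw [← U.inner_map_map, ← U.inner_map_map x, U.apply_symm_apply, U.apply_symm_apply,
      ContinuousLinearMap.adjoint_inner_left]

theorem conjUnitary_apply {K H : Type*} [NormedAddCommGroup K] [InnerProductSpace ℂ K]
    [CompleteSpace K] [NormedAddCommGroup H] [InnerProductSpace ℂ H] [CompleteSpace H]
    (U : K ≃ₗᵢ[ℂ] H) (T : H →L[ℂ] H) (x : K) : conjUnitary U T x = U.symm (T (U x)) := rfl

open Cardinal in
/-- Amalgamation of `C*`-seminorms: if `q k` on `B k` and `p` on `C` agree on `A k` for all `k`,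
then `C` and all `B k` act on a common Hilbert space compatibly with the `A k`, with `C` acting
isometrically. -/
theorem exists_amalgam {ι : Type u} {A B : ι → Type u} {C : Type u}
    [∀ k, NonUnitalRing (A k)] [∀ k, StarRing (A k)] [∀ k, Module ℂ (A k)]
    [∀ k, IsScalarTower ℂ (A k) (A k)] [∀ k, SMulCommClass ℂ (A k) (A k)] [∀ k, StarModule ℂ (A k)]
    [∀ k, NonUnitalRing (B k)] [∀ k, StarRing (B k)] [∀ k, Module ℂ (B k)]
    [∀ k, IsScalarTower ℂ (B k) (B k)] [∀ k, SMulCommClass ℂ (B k) (B k)] [∀ k, StarModule ℂ (B k)]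
    [NonUnitalRing C] [StarRing C] [Module ℂ C] [IsScalarTower ℂ C C] [SMulCommClass ℂ C C]
    [StarModule ℂ C] (f : ∀ k, A k →⋆ₙₐ[ℂ] B k) (g : ∀ k, A k →⋆ₙₐ[ℂ] C)
    (q : ∀ k, Seminorm ℂ (B k)) (hq : ∀ k, IsCStarSeminorm (q k)) (p : Seminorm ℂ C)
    (hp : IsCStarSeminorm p) (h : ∀ k a, q k (f k a) = p (g k a)) :
    ∃ (D : Type u) (_ : NonUnitalCStarAlgebra D) (γ : C →⋆ₙₐ[ℂ] D)
      (β : ∀ k, B k →⋆ₙₐ[ℂ] D), (∀ c, ‖γ c‖ = p c) ∧ (∀ k b, ‖β k b‖ ≤ q k b) ∧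
        ∀ k a, β k (f k a) = γ (g k a) := by
  obtain ⟨F⟩ := hp.nonempty_universalFamily
  let G := fun k => Classical.choice (hq k).nonempty_universalFamily
  -- With enough copies, the two representations of each `A k` embed into each other.
  let L : Type u := ULift.{u} ℕ ⊕ (Σ i, F.space i) ⊕ (Σ k i, (G k).space i)
  have hL : ℵ₀ ≤ #L := (aleph0_le_mk (ULift.{u} ℕ)).trans (mk_le_of_injective Sum.inl_injective)
  have hF : #(Σ i, F.space i) ≤ #L :=
    mk_le_of_injective (Sum.inr_injective.comp Sum.inl_injective)
  have hG : ∀ k, #(Σ i, (G k).space i) ≤ #L := fun k =>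
    mk_le_of_injective (f := fun x => (Sum.inr (Sum.inr ⟨k, x⟩) : L)) fun _ _ h =>
      eq_of_heq (Sigma.mk.inj (Sum.inr.inj (Sum.inr.inj h))).2
  have hne : Nonempty L := ⟨Sum.inl ⟨0⟩⟩
  have key : ∀ k, ∃ U : F.Sum L ≃ₗᵢ[ℂ] (G k).Sum L, ∀ a x,
      U (F.sumRep L (g k a) x) = (G k).sumRep L (f k a) (U x) := by
    intro k
    obtain ⟨V, hV⟩ := (G k).exists_intertwiner L (f k) ((F.sumRep L).comp (g k))
      (fun a => (F.norm_sumRep L (g k a)).le.trans (h k a).ge)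
      (F.nonempty_embedding_of_orthogonal L hL hF)
    obtain ⟨W, hW⟩ := F.exists_intertwiner L (g k) (((G k).sumRep L).comp (f k))
      (fun a => ((G k).norm_sumRep L (f k a)).le.trans (h k a).le)
      ((G k).nonempty_embedding_of_orthogonal L hL (hG k))
    exact exists_unitary_equiv ((F.sumRep L).comp (g k)) (((G k).sumRep L).comp (f k)) V hV W hW
  choose U hU using key
  refine ⟨F.Sum L →L[ℂ] F.Sum L, inferInstance, F.sumRep L,
    fun k => (conjUnitary (U k)).comp ((G k).sumRep L), F.norm_sumRep L, fun k b => ?_,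
    fun k a => ?_⟩
  · exact (NonUnitalStarAlgHom.norm_apply_le (conjUnitary (U k)) ((G k).sumRep L b)).trans
      ((G k).norm_sumRep L b).le
  · ext1 x
    change conjUnitary (U k) ((G k).sumRep L (f k a)) x = _
    rw [conjUnitary_apply, ← hU, LinearIsometryEquiv.symm_apply_apply]

end LmcCStar

namespace LmcCStar

variable {ν : Ordinal.{u}}

/-! ### The seminorm extension property for cell complexes -/

/-- A `C*`-algebra as an object of `𝔸_ν`. -/
def ANu.ofCStar (ν : Ordinal.{u}) (D : Type u) [NonUnitalCStarAlgebra D] : ANu ν where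
  carrier := D
  isLmcCStar := isLmcCStar_of_family (fun _ : Fin 1 => normSeminorm ℂ D)
    (fun _ => ⟨norm_mul_le, fun a => (CStarRing.norm_star_mul_self (x := a)).trans (sq _).symm⟩)
    (norm_withSeminorms ℂ D)
  isNuComplete x hx := by
    have hν : Nonempty ν.ToType := ⟨(hx _ univ_mem).choose⟩
    have hc : Cauchy (map x atTop) := by
      refine Metric.cauchy_iff.2 ⟨inferInstance, fun ε hε => ?_⟩
      obtain ⟨γ, hγ⟩ := hx _ (Metric.ball_mem_nhds 0 hε)
      refine ⟨_, image_mem_map (Ici_mem_atTop γ), ?_⟩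
      rintro _ ⟨α, hα, rfl⟩ _ ⟨β, hβ, rfl⟩
      have := hγ α hα β hβ
      rwa [mem_ball_zero_iff, ← dist_eq_norm] at this
    obtain ⟨a, ha⟩ := cauchy_iff_exists_le_nhds.1 hc
    exact ⟨a, fun U hU => mem_atTop_sets.1 (ha hU)⟩

/-- A `*`-homomorphism into a `C*`-algebra dominated by a continuous seminorm is continuous. -/
def ANu.homOfBound {A : ANu ν} {D : Type u} [NonUnitalCStarAlgebra D] (φ : A →⋆ₙₐ[ℂ] D)
    (p : Seminorm ℂ A) (hp : Continuous p) (h : ∀ a, ‖φ a‖ ≤ p a) : A ⟶ ANu.ofCStar ν D where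
  toStarHom := φ
  continuous' := by
    have hc : Continuous fun a : A => (φ a : D) := by
      refine continuous_of_continuousAt_zero (G := A) (M := D) φ ?_
      change Tendsto (fun a => φ a) (𝓝 0) (𝓝 (φ 0))
      rw [map_zero, tendsto_zero_iff_norm_tendsto_zero]
      exact squeeze_zero (fun a => norm_nonneg _) h (hp.tendsto' 0 0 (map_zero p))
    exact hc

/-- The norm of a `C*`-algebra, as a seminorm. -/
noncomputable def cstarNorm (ν : Ordinal.{u}) (D : Type u) [NonUnitalCStarAlgebra D] :
    Seminorm ℂ (ANu.ofCStar ν D) := normSeminorm ℂ D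

theorem ANu.exists_seminorm_ofCStar {A : ANu ν} {D : Type u} [NonUnitalCStarAlgebra D]
    (φ : A ⟶ ANu.ofCStar ν D) :
    ∃ q : Seminorm ℂ A, IsCStarSeminorm q ∧ Continuous q ∧ ∀ a, q a = cstarNorm ν D (φ a) := by
  have h : IsCStarSeminorm (cstarNorm ν D) :=
    ⟨fun a b => norm_mul_le (α := D) a b,
      fun a => (CStarRing.norm_star_mul_self (E := D) (x := a)).trans (sq _).symm⟩
  exact ⟨(cstarNorm ν D).comp (φ.toStarHom : A →ₗ[ℂ] ANu.ofCStar ν D), h.comp φ.toStarHom,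
    (continuous_norm (E := D)).comp (ANu.Hom.continuous φ), fun a => rfl⟩

/-- The morphisms with the seminorm extension property. -/
def sep (ν : Ordinal.{u}) : MorphismProperty (ANu ν) := fun _ _ f => HasSEP f

theorem exists_amalgam_hom {ι : Type u} {A B : ι → ANu ν} {C : ANu ν} (f : ∀ k, A k ⟶ B k)
    (hf : ∀ k, HasSEP (f k)) (g : ∀ k, A k ⟶ C) (p : Seminorm ℂ C) (hp : IsCStarSeminorm p)
    (hpc : Continuous p) :
    ∃ (D : Type u) (_ : NonUnitalCStarAlgebra D) (γ : C ⟶ ANu.ofCStar ν D)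
      (β : ∀ k, B k ⟶ ANu.ofCStar ν D), (∀ c, cstarNorm ν D (γ c) = p c) ∧
        ∀ k, f k ≫ β k = g k ≫ γ := by
  choose q hq hqc hqf using fun k => hf k (p.comp ((g k).toStarHom : A k →ₗ[ℂ] C))
    (hp.comp (g k).toStarHom) (hpc.comp (ANu.Hom.continuous (g k)))
  obtain ⟨D, _, γ, β, hγ, hβ, h⟩ := exists_amalgam (fun k => (f k).toStarHom)
    (fun k => (g k).toStarHom) q hq p hp fun k a => (hqf k a).symm
  exact ⟨D, inferInstance, ANu.homOfBound γ p hpc fun c => (hγ c).le,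
    fun k => ANu.homOfBound (β k) (q k) (hqc k) (hβ k), hγ, fun k => ANu.hom_ext (h k)⟩

instance : (sep ν).IsStableUnderCobaseChange where
  of_isPushout {A A' B B' f g f' g'} sq hf := by
    intro p hp hpc
    obtain ⟨D, _, γ, β, hγ, h⟩ := exists_amalgam_hom (ι := PUnit) (fun _ => f) (fun _ => hf)
      (fun _ => g) p hp hpc
    obtain ⟨q, hq, hqc, hqa⟩ := ANu.exists_seminorm_ofCStar (sq.desc γ (β ⟨⟩) (h ⟨⟩).symm)
    refine ⟨q, hq, hqc, fun a => ?_⟩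
    rw [hqa, ← hγ, ← ANu.comp_apply, sq.inl_desc]

instance : MorphismProperty.IsStableUnderCoproducts.{u} (sep ν) where
  isStableUnderCoproductsOfShape J :=
    { condition := by
        intro X₁ X₂ c₁ c₂ h₁ h₂ f hf φ hφ p hp hpc
        obtain ⟨D, _, γ, β, hγ, h⟩ := exists_amalgam_hom (fun j : J => f.app ⟨j⟩)
          (fun j => hf ⟨j⟩) (fun j => c₁.ι.app ⟨j⟩) p hp hpc
        let t : Limits.Cocone X₂ := ⟨ANu.ofCStar ν D, Discrete.natTrans fun j => β j.as⟩
        have ht : φ ≫ h₂.desc t = γ := h₁.hom_ext fun ⟨j⟩ => by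
          rw [← Category.assoc, hφ, Category.assoc, h₂.fac]
          exact h j
        obtain ⟨q, hq, hqc, hqa⟩ := ANu.exists_seminorm_ofCStar (h₂.desc t)
        refine ⟨q, hq, hqc, fun a => ?_⟩
        rw [hqa, ← hγ, ← ANu.comp_apply, ht] }

theorem HasSEP.comp {A B C : ANu ν} {f : A ⟶ B} {g : B ⟶ C} (hf : HasSEP f) (hg : HasSEP g) :
    HasSEP (f ≫ g) := by
  intro p hp hpc
  obtain ⟨q, hq, hqc, hpq⟩ := hf p hp hpc
  obtain ⟨r, hr, hrc, hqr⟩ := hg q hq hqc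
  exact ⟨r, hr, hrc, fun a => (hpq a).trans (hqr _)⟩

theorem HasSEP.of_comp {A B C : ANu ν} {f : A ⟶ B} {g : B ⟶ C} (h : HasSEP (f ≫ g)) :
    HasSEP f := by
  intro p hp hpc
  obtain ⟨q, hq, hqc, hpq⟩ := h p hp hpc
  exact ⟨q.comp (g.toStarHom : B →ₗ[ℂ] C), hq.comp g.toStarHom, hqc.comp (ANu.Hom.continuous g),
    hpq⟩

theorem HasSEP.of_isIso {A B : ANu ν} (f : A ⟶ B) [IsIso f] : HasSEP f := by
  refine HasSEP.of_comp (g := inv f) ?_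
  rw [IsIso.hom_inv_id]
  exact fun p hp hpc => ⟨p, hp, hpc, fun a => rfl⟩

section Colimit

variable {K : Type u} [LinearOrder K] (F : K ⥤ ANu ν)

/-- The family `x` is compatible from the index `i` on. -/
def IsStableFrom (x : ∀ k, F.obj k) (i : K) : Prop :=
  ∀ k (h : i ≤ k), F.map (homOfLE h) (x i) = x k

variable {F} in
theorem IsStableFrom.mono {x : ∀ k, F.obj k} {i j : K} (h : IsStableFrom F x i) (hij : i ≤ j) :
    IsStableFrom F x j := fun k hk => by
  rw [← h j hij, ← h k (hij.trans hk), ← ANu.comp_apply, ← F.map_comp, homOfLE_comp]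

theorem IsStableFrom.add {x y : ∀ k, F.obj k} {i : K} (hx : IsStableFrom F x i)
    (hy : IsStableFrom F y i) : IsStableFrom F (x + y) i := fun k hk =>
  (ANu.hom_add _ _ _).trans (congrArg₂ _ (hx k hk) (hy k hk))

theorem IsStableFrom.sub {x y : ∀ k, F.obj k} {i : K} (hx : IsStableFrom F x i)
    (hy : IsStableFrom F y i) : IsStableFrom F (x - y) i := fun k hk =>
  (ANu.hom_sub _ _ _).trans (congrArg₂ _ (hx k hk) (hy k hk))

theorem IsStableFrom.mul {x y : ∀ k, F.obj k} {i : K} (hx : IsStableFrom F x i)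
    (hy : IsStableFrom F y i) : IsStableFrom F (x * y) i := fun k hk =>
  (ANu.hom_mul _ _ _).trans (congrArg₂ _ (hx k hk) (hy k hk))

theorem IsStableFrom.smul {x : ∀ k, F.obj k} {i : K} (c : ℂ) (hx : IsStableFrom F x i) :
    IsStableFrom F (c • x) i := fun k hk =>
  (ANu.hom_smul _ _ _).trans (congrArg _ (hx k hk))

theorem IsStableFrom.star {x : ∀ k, F.obj k} {i : K} (hx : IsStableFrom F x i) :
    IsStableFrom F (star x) i := fun k hk =>
  (ANu.hom_star _ _).trans (congrArg _ (hx k hk))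

/-- The families which are eventually compatible. -/
def eventualSubalgebra [Nonempty K] : NonUnitalStarSubalgebra ℂ (∀ k, F.obj k) where
  carrier := {x | ∃ i, IsStableFrom F x i}
  add_mem' := by
    rintro x y ⟨i, hi⟩ ⟨j, hj⟩
    exact ⟨max i j, (hi.mono (le_max_left i j)).add F (hj.mono (le_max_right i j))⟩
  zero_mem' := ⟨Classical.arbitrary K, fun k hk => ANu.hom_zero _⟩
  mul_mem' := by
    rintro x y ⟨i, hi⟩ ⟨j, hj⟩
    exact ⟨max i j, (hi.mono (le_max_left i j)).mul F (hj.mono (le_max_right i j))⟩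
  smul_mem' := by
    rintro c x ⟨i, hi⟩
    exact ⟨i, hi.smul F c⟩
  star_mem' := by
    rintro x ⟨i, hi⟩
    exact ⟨i, hi.star F⟩

open Classical in
/-- The family of images of an element, extended by zero. -/
noncomputable def extendByZero (i : K) (a : F.obj i) (k : K) : F.obj k :=
  if h : i ≤ k then F.map (homOfLE h) a else 0

variable {F} in
theorem extendByZero_of_le {i : K} (a : F.obj i) {k : K} (h : i ≤ k) :
    extendByZero F i a k = F.map (homOfLE h) a := dif_pos h

variable {F} in
theorem extendByZero_of_not_le {i : K} (a : F.obj i) {k : K} (h : ¬ i ≤ k) :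
    extendByZero F i a k = 0 := dif_neg h

theorem isStableFrom_extendByZero (i : K) (a : F.obj i) :
    IsStableFrom F (extendByZero F i a) i := fun k hk => by
  rw [extendByZero_of_le a le_rfl, extendByZero_of_le a hk, ← ANu.comp_apply, ← F.map_comp,
    homOfLE_comp]

/-- Extension by zero as a homomorphism. -/
noncomputable def extendHom [Nonempty K] (i : K) : F.obj i →⋆ₙₐ[ℂ] eventualSubalgebra F where
  toFun a := ⟨extendByZero F i a, i, isStableFrom_extendByZero F i a⟩
  map_smul' c a := Subtype.ext <| funext fun k => by
    change extendByZero F i (c • a) k = c • extendByZero F i a k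
    by_cases h : i ≤ k
    · simp only [extendByZero_of_le _ h, ANu.hom_smul]
    · simp only [extendByZero_of_not_le _ h, smul_zero]
  map_zero' := Subtype.ext <| funext fun k => by
    change extendByZero F i 0 k = 0
    by_cases h : i ≤ k
    · simp only [extendByZero_of_le _ h, ANu.hom_zero]
    · simp only [extendByZero_of_not_le _ h]
  map_add' a b := Subtype.ext <| funext fun k => by
    change extendByZero F i (a + b) k = extendByZero F i a k + extendByZero F i b k
    by_cases h : i ≤ k
    · simp only [extendByZero_of_le _ h, ANu.hom_add]
    · simp only [extendByZero_of_not_le _ h, add_zero]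
  map_mul' a b := Subtype.ext <| funext fun k => by
    change extendByZero F i (a * b) k = extendByZero F i a k * extendByZero F i b k
    by_cases h : i ≤ k
    · simp only [extendByZero_of_le _ h, ANu.hom_mul]
    · simp only [extendByZero_of_not_le _ h, mul_zero]
  map_star' a := Subtype.ext <| funext fun k => by
    change extendByZero F i (star a) k = star (extendByZero F i a k)
    by_cases h : i ≤ k
    · simp only [extendByZero_of_le _ h, ANu.hom_star]
    · simp only [extendByZero_of_not_le _ h, star_zero]

variable {F}

/-- A compatible family of continuous `C*`-seminorms on a chain extends to the colimit: complete
the algebra of eventually compatible families. -/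
theorem exists_seminorm_colimit [Nonempty K] {c : Limits.Cocone F} (hc : Limits.IsColimit c)
    (p : ∀ k, Seminorm ℂ (F.obj k)) (hp : ∀ k, IsCStarSeminorm (p k)) (hpc : ∀ k, Continuous (p k))
    (hcomp : ∀ i k (h : i ≤ k) a, p k (F.map (homOfLE h) a) = p i a) :
    ∃ q : Seminorm ℂ c.pt, IsCStarSeminorm q ∧ Continuous q ∧ ∀ k a, p k a = q (c.ι.app k a) := by
  classical
  let S := eventualSubalgebra F
  let v : S → ℝ := fun x => p x.2.choose (x.1 x.2.choose)
  have hv : ∀ (x : S) i, IsStableFrom F x.1 i → v x = p i (x.1 i) := fun x i hi => by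
    rw [← hcomp i (max i x.2.choose) (le_max_left _ _), hi]
    change p x.2.choose _ = _
    rw [← hcomp x.2.choose (max i x.2.choose) (le_max_right _ _), x.2.choose_spec]
  let P : Seminorm ℂ S := Seminorm.of v
    (by
      rintro ⟨x, i, hi⟩ ⟨y, j, hj⟩
      have hi' := hi.mono (le_max_left i j)
      have hj' := hj.mono (le_max_right i j)
      rw [hv ⟨x, i, hi⟩ _ hi', hv ⟨y, j, hj⟩ _ hj',
        hv (⟨x, i, hi⟩ + ⟨y, j, hj⟩) (max i j) (hi'.add F hj')]
      exact map_add_le_add _ _ _)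
    (by
      rintro a ⟨x, i, hi⟩
      rw [hv ⟨x, i, hi⟩ _ hi, hv (a • ⟨x, i, hi⟩) i (hi.smul F a)]
      exact map_smul_eq_mul _ _ _)
  have hP : IsCStarSeminorm P := by
    refine ⟨?_, ?_⟩
    · rintro ⟨x, i, hi⟩ ⟨y, j, hj⟩
      have hi' := hi.mono (le_max_left i j)
      have hj' := hj.mono (le_max_right i j)
      change v _ ≤ v _ * v _
      rw [hv ⟨x, i, hi⟩ _ hi', hv ⟨y, j, hj⟩ _ hj',
        hv (⟨x, i, hi⟩ * ⟨y, j, hj⟩) (max i j) (hi'.mul F hj')]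
      exact (hp _).mul_le _ _
    · rintro ⟨x, i, hi⟩
      change v _ = v _ ^ 2
      rw [hv ⟨x, i, hi⟩ _ hi, hv (star ⟨x, i, hi⟩ * ⟨x, i, hi⟩) i ((hi.star F).mul F hi)]
      exact (hp _).star_mul_self _
  obtain ⟨D, _, ι, hι, -, -⟩ := hP.exists_completion
  let ε := extendHom F
  have hε : ∀ i a k (h : i ≤ k), (ε i a).1 k = F.map (homOfLE h) a :=
    fun i a k h => extendByZero_of_le a h
  have hεs : ∀ i a, IsStableFrom F (ε i a).1 i := isStableFrom_extendByZero F
  have hPε : ∀ i a, P (ε i a) = p i a := fun i a => by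
    change v _ = _
    rw [hv _ _ (hεs i a), hε i a i le_rfl, hcomp]
  let t : Limits.Cocone F :=
    { pt := ANu.ofCStar ν D
      ι :=
        { app := fun i => ANu.homOfBound (ι.comp (ε i)) (p i) (hpc i) fun a =>
            ((hι _).trans (hPε i a)).le
          naturality := fun i j f => ANu.hom_ext fun a => by
            change ι (ε j (F.map f a)) = ι (ε i a)
            rw [← sub_eq_zero, ← map_sub, ← norm_eq_zero, hι]
            change v _ = 0
            have h1 : IsStableFrom F (ε j (F.map f a) - ε i a).1 j :=
              (hεs _ _).sub F ((hεs i a).mono (leOfHom f))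
            rw [hv _ _ h1]
            change p j ((ε j (F.map f a)).1 j - (ε i a).1 j) = 0
            rw [hε j _ j le_rfl, hε i a j (leOfHom f), ← ANu.comp_apply, ← F.map_comp]
            change p j (F.map f a - F.map f a) = 0
            rw [sub_self, map_zero] } }
  obtain ⟨q, hq, hqc, hqa⟩ := ANu.exists_seminorm_ofCStar (hc.desc t)
  refine ⟨q, hq, hqc, fun k a => ?_⟩
  rw [hqa, ← ANu.comp_apply, hc.fac]
  exact ((hι _).trans (hPε k a)).symm

end Colimit

/-- The contravariant functor of continuous `C*`-seminorms. -/
noncomputable def cstarSeminorms (ν : Ordinal.{u}) : (ANu ν)ᵒᵖ ⥤ Type u where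
  obj A := {p : Seminorm ℂ A.unop // IsCStarSeminorm p ∧ Continuous p}
  map f := ↾fun p => ⟨p.1.comp (f.unop.toStarHom : _ →ₗ[ℂ] _), p.2.1.comp f.unop.toStarHom,
    p.2.2.comp (ANu.Hom.continuous f.unop)⟩

/-- Seminorms are extended along a transfinite composition by well-ordered induction on the functor of
continuous `C*`-seminorms. -/
instance : MorphismProperty.IsStableUnderTransfiniteComposition.{u} (sep ν) where
  isStableUnderTransfiniteCompositionOfShape J _ _ _ _ := ⟨by
    rintro X Y f ⟨h⟩
    let G := h.F.op ⋙ cstarSeminorms ν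
    have d : G.WellOrderInductionData := .ofExists
      (fun j hj p => by
        obtain ⟨q, hq, hqc, hpq⟩ := h.map_mem j hj p.1 p.2.1 p.2.2
        exact ⟨⟨q, hq, hqc⟩, Subtype.ext (Seminorm.ext fun a => (hpq a).symm)⟩)
      (fun j hj x => by
        have hne : Nonempty (Set.Iio j) := ⟨⟨⊥, hj.bot_lt⟩⟩
        obtain ⟨q, hq, hqc, hpq⟩ := exists_seminorm_colimit
          (h.F.isColimitOfIsWellOrderContinuous j hj)
          (fun k => (x.1 (Opposite.op k)).1) (fun k => (x.1 (Opposite.op k)).2.1)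
          (fun k => (x.1 (Opposite.op k)).2.2) (fun i k hik a => by
            have := x.2 (homOfLE hik).op
            exact congrArg (fun y => y.1 a) this)
        exact ⟨⟨q, hq, hqc⟩, fun i hi => Subtype.ext (Seminorm.ext fun a =>
          (hpq ⟨i, hi⟩ a).symm)⟩)
    have hbot : HasSEP (h.incl.app ⊥) := by
      intro p hp hpc
      obtain ⟨s, hs⟩ := d.surjective ⟨p, hp, hpc⟩
      obtain ⟨q, hq, hqc, hpq⟩ := exists_seminorm_colimit h.isColimit
        (fun k => (s.1 (Opposite.op k)).1) (fun k => (s.1 (Opposite.op k)).2.1)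
        (fun k => (s.1 (Opposite.op k)).2.2) (fun i k hik a => by
          have := s.2 (homOfLE hik).op
          exact congrArg (fun y => y.1 a) this)
      refine ⟨q, hq, hqc, fun a => ?_⟩
      rw [← show (s.1 (Opposite.op ⊥)).1 a = p a from congrArg (fun y => y.1 a) hs]
      exact hpq ⊥ a
    have hf : f = h.isoBot.inv ≫ h.incl.app ⊥ := by rw [h.fac]
    rw [hf]
    exact (HasSEP.of_isIso _).comp hbot⟩

end LmcCStar

namespace LmcCStar

variable {ν : Ordinal.{u}}

/-! ### Smallness -/

section

variable {A B C : ANu ν} {i : B ⟶ C}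

theorem HasSEP.injective (hi : HasSEP i) : Function.Injective i := by
  refine (injective_iff_map_eq_zero i.toStarHom).2 fun a ha => by_contra fun h0 => ?_
  obtain ⟨p, hp, hpc, ε, hε, h⟩ := B.isLmcCStar.exists_seminorm
    (isOpen_compl_singleton.mem_nhds (Ne.symm h0) : ({a}ᶜ : Set B) ∈ 𝓝 0)
  obtain ⟨q, -, -, hq⟩ := hi p hp hpc
  refine h a ?_ rfl
  have : i a = 0 := ha
  rwa [hq, this, map_zero]

theorem HasSEP.exists_factor (hi : HasSEP i) (f : A ⟶ C) (h : ∀ a, ∃ b, i b = f a) :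
    ∃ g : A ⟶ B, g ≫ i = f := by
  choose g hg using h
  let g' : A →⋆ₙₐ[ℂ] B :=
    { toFun := g
      map_smul' := fun c a => hi.injective <|
        (hg _).trans ((ANu.hom_smul f c a).trans
          (((ANu.hom_smul i c (g a)).trans (by rw [hg])).symm))
      map_zero' := hi.injective ((hg 0).trans ((ANu.hom_zero f).trans (ANu.hom_zero i).symm))
      map_add' := fun a b => hi.injective <|
        (hg _).trans ((ANu.hom_add f a b).trans (((ANu.hom_add i _ _).trans (by rw [hg, hg])).symm))
      map_mul' := fun a b => hi.injective <|
        (hg _).trans ((ANu.hom_mul f a b).trans (((ANu.hom_mul i _ _).trans (by rw [hg, hg])).symm))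
      map_star' := fun a => hi.injective <|
        (hg _).trans ((ANu.hom_star f a).trans (((ANu.hom_star i _).trans (by rw [hg])).symm)) }
  refine ⟨⟨g', continuous_of_continuousAt_zero g' ?_⟩, ANu.hom_ext hg⟩
  change Tendsto g' (𝓝 0) (𝓝 (g' 0))
  rw [map_zero]
  intro U hU
  obtain ⟨p, hp, hpc, ε, hε, hpU⟩ := B.isLmcCStar.exists_seminorm hU
  obtain ⟨q, hq, hqc, hpq⟩ := hi p hp hpc
  have h0 : Tendsto (fun a => q (f a)) (𝓝 0) (𝓝 0) :=
    (hqc.comp (ANu.Hom.continuous f)).tendsto' 0 0 (by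
      rw [Function.comp_apply, ANu.hom_zero, map_zero])
  rw [mem_map]
  filter_upwards [h0.eventually (Iio_mem_nhds hε)] with a ha
  refine hpU _ ?_
  rw [hpq]
  exact (congrArg q (hg a)).trans_lt ha

/-- A `ν`-sequence whose image under a morphism with the seminorm extension property converges is
itself Cauchy, hence converges. -/
theorem HasSEP.exists_nuConverges (hi : HasSEP i) (x : ν.ToType → B) {c : C}
    (hx : NuConverges ν (fun α => i (x α)) c) : ∃ b, NuConverges ν x b ∧ i b = c := by
  obtain ⟨b, hb⟩ := B.isNuComplete x fun U hU => by
    obtain ⟨p, hp, hpc, ε, hε, hpU⟩ := B.isLmcCStar.exists_seminorm hU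
    obtain ⟨q, hq, hqc, hpq⟩ := hi p hp hpc
    have hc : Continuous fun z : C => q (z - c) := hqc.comp (continuous_id.sub continuous_const)
    obtain ⟨γ, hγ⟩ := hx {z | q (z - c) < ε / 2}
      ((hc.tendsto' c 0 (by simp)).eventually (Iio_mem_nhds (half_pos hε)))
    refine ⟨γ, fun α hα β hβ => hpU _ ?_⟩
    have h1 : q (i (x α) - c) < ε / 2 := hγ α hα
    have h2 : q (i (x β) - c) < ε / 2 := hγ β hβ
    rw [hpq, ANu.hom_sub, ← sub_sub_sub_cancel_right _ _ c]
    exact (map_sub_le_add q _ _).trans_lt (by linarith)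
  exact ⟨b, hb, nuConverges_unique (hb.map (ANu.Hom.continuous i)) hx⟩

end

section Sequential

variable {J : Type u} [LinearOrder J] {κ : Cardinal.{u}} [Fact κ.IsRegular]
  [IsCardinalFiltered J κ] {F : J ⥤ ANu ν} {c : Limits.Cocone F}

theorem exists_forall_le_of_lt {K : Type u} (s : K → J)
    (h : Cardinal.mk K < κ) : ∃ j, ∀ k, s k ≤ j :=
  ⟨IsCardinalFiltered.max s ((hasCardinalLT_iff_cardinal_mk_lt _ _).2 h), fun k =>
    leOfHom (IsCardinalFiltered.toMax s ((hasCardinalLT_iff_cardinal_mk_lt _ _).2 h) k)⟩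

theorem mem_range_of_le (c : Limits.Cocone F) {i j : J} (h : i ≤ j) {x : c.pt}
    (hx : ∃ a, c.ι.app i a = x) : ∃ a, c.ι.app j a = x := by
  obtain ⟨a, rfl⟩ := hx
  exact ⟨F.map (homOfLE h) a, by rw [← ANu.comp_apply, c.w]⟩

/-- The union of the images of the legs is already closed under limits of `ν`-sequences, hence is
the whole colimit. -/
theorem exists_eq_leg (hc : Limits.IsColimit c) (hleg : ∀ j, HasSEP (c.ι.app j))
    (hν : ν.card < κ) (x : c.pt) : ∃ j a, c.ι.app j a = x := by
  have hne : Nonempty J := IsCardinalFiltered.nonempty J κ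
  let S : NonUnitalStarSubalgebra ℂ c.pt :=
    { carrier := {x | ∃ j a, c.ι.app j a = x}
      add_mem' := by
        rintro x y ⟨i, hx⟩ ⟨j, hy⟩
        obtain ⟨a, rfl⟩ := mem_range_of_le c (le_max_left i j) hx
        obtain ⟨b, rfl⟩ := mem_range_of_le c (le_max_right i j) hy
        exact ⟨max i j, a + b, ANu.hom_add _ _ _⟩
      zero_mem' := ⟨Classical.arbitrary J, 0, ANu.hom_zero _⟩
      mul_mem' := by
        rintro x y ⟨i, hx⟩ ⟨j, hy⟩
        obtain ⟨a, rfl⟩ := mem_range_of_le c (le_max_left i j) hx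
        obtain ⟨b, rfl⟩ := mem_range_of_le c (le_max_right i j) hy
        exact ⟨max i j, a * b, ANu.hom_mul _ _ _⟩
      smul_mem' := by
        rintro r x ⟨i, a, rfl⟩
        exact ⟨i, r • a, ANu.hom_smul _ _ _⟩
      star_mem' := by
        rintro x ⟨i, a, rfl⟩
        exact ⟨i, star a, ANu.hom_star _ _⟩ }
  let D : ANu ν := ANu.ofSubalgebra c.pt.isLmcCStar c.pt.isNuComplete S <| by
    intro y hy z hz
    choose j hj using hy
    obtain ⟨k, hk⟩ := exists_forall_le_of_lt (κ := κ) j (by rwa [Cardinal.mk_toType])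
    choose w hw using fun α => mem_range_of_le c (hk α) (hj α)
    obtain ⟨b, -, hb⟩ := (hleg k).exists_nuConverges w (c := z) (by simpa only [hw] using hz)
    exact ⟨k, b, hb⟩
  let incl : D ⟶ c.pt :=
    ⟨NonUnitalStarSubalgebraClass.subtype (R := ℂ) S, continuous_subtype_val⟩
  let t : Limits.Cocone F :=
    { pt := D
      ι :=
        { app := fun j =>
            { toStarHom :=
                { toFun := fun a => (⟨c.ι.app j a, j, a, rfl⟩ : S)
                  map_smul' := fun r a => Subtype.ext (ANu.hom_smul _ _ _)
                  map_zero' := Subtype.ext (ANu.hom_zero _)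
                  map_add' := fun a b => Subtype.ext (ANu.hom_add _ _ _)
                  map_mul' := fun a b => Subtype.ext (ANu.hom_mul _ _ _)
                  map_star' := fun a => Subtype.ext (ANu.hom_star _ _) }
              continuous' := Continuous.subtype_mk (ANu.Hom.continuous (c.ι.app j)) _ }
          naturality := fun i j f => ANu.hom_ext fun a => Subtype.ext (by
            change c.ι.app j (F.map f a) = c.ι.app i a
            rw [← ANu.comp_apply, c.w]) } }
  have hr : hc.desc t ≫ incl = 𝟙 _ := hc.hom_ext fun j => by
    rw [← Category.assoc, hc.fac, Category.comp_id]
    rfl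
  have hx : incl (hc.desc t x) = x := DFunLike.congr_fun hr x
  rw [← hx]
  exact (hc.desc t x : S).2

/-- A homomorphism from an algebra with fewer than `κ` elements to the colimit has its values in the
image of one leg, and factors through it. -/
theorem preservesColimit_coyoneda (hc : Limits.IsColimit c) (hleg : ∀ j, HasSEP (c.ι.app j))
    (hν : ν.card < κ) (A : ANu ν) (hA : Cardinal.mk A < κ) :
    Limits.PreservesColimit F (coyoneda.obj (Opposite.op A)) := by
  have := isFiltered_of_isCardinalFiltered J κ
  refine Limits.preservesColimit_of_preserves_colimit_cocone hc
    (Limits.Types.FilteredColimit.isColimitOf' _ _ ?_ ?_)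
  · intro (f : A ⟶ c.pt)
    choose j a ha using fun x => exists_eq_leg (κ := κ) hc hleg hν (f x)
    obtain ⟨k, hk⟩ := exists_forall_le_of_lt (κ := κ) j hA
    obtain ⟨g, hg⟩ := (hleg k).exists_factor f fun x => mem_range_of_le c (hk x) ⟨a x, ha x⟩
    exact ⟨k, g, hg.symm⟩
  · intro j (g : A ⟶ F.obj j) (g' : A ⟶ F.obj j) h
    have : g = g' := ANu.hom_ext fun a => (hleg j).injective (DFunLike.congr_fun (show
      g ≫ c.ι.app j = g' ≫ c.ι.app j from h) a)
    exact ⟨j, 𝟙 j, by rw [this]⟩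

end Sequential

section

variable {J : Type u} [LinearOrder J] [SuccOrder J] [OrderBot J] [WellFoundedLT J]

theorem preservesColimit_of_sep {κ : Cardinal.{u}} [Fact κ.IsRegular] [IsCardinalFiltered J κ]
    (F : J ⥤ ANu ν) [F.IsWellOrderContinuous]
    (hF : ∀ j, ¬ IsMax j → HasSEP (F.map (homOfLE (Order.le_succ j)))) (hν : ν.card < κ)
    (A : ANu ν) (hA : Cardinal.mk A < κ) :
    Limits.PreservesColimit F (coyoneda.obj (Opposite.op A)) := by
  have := ANu.hasColimits (ν := ν)
  let h : (sep ν).TransfiniteCompositionOfShape J (Limits.colimit.ι F ⊥) :=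
    { F := F
      isoBot := Iso.refl _
      incl := (Limits.colimit.cocone F).ι
      isColimit := Limits.colimit.isColimit F
      fac := by simp
      map_mem := hF }
  exact preservesColimit_coyoneda (κ := κ) (Limits.colimit.isColimit F)
    (fun j => h.mem_incl_app j) hν A hA

end

/-- A regular cardinal which exceeds the size of `ν` and of the members of a given family. -/
theorem exists_regular_cardinal (ν : Ordinal.{u}) {ι : Type u} (A : ι → ANu ν) :
    ∃ κ : Cardinal.{u}, κ.IsRegular ∧ ν.card < κ ∧ ∀ i, Cardinal.mk (A i) < κ := by
  let μ := max Cardinal.aleph0 (max ν.card (⨆ i, Cardinal.mk (A i)))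
  refine ⟨Order.succ μ, Cardinal.isRegular_succ (le_max_left _ _), Order.lt_succ_of_le ?_,
    fun i => Order.lt_succ_of_le ?_⟩
  · exact (le_max_left _ _).trans (le_max_right _ _)
  · exact ((le_ciSup Cardinal.bddAbove_of_small i).trans (le_max_right _ _)).trans
      (le_max_right _ _)

theorem isSmallRelativeTo_of_le_sep (A : ANu ν) {W : MorphismProperty (ANu ν)} (hW : W ≤ sep ν) :
    HomotopicalAlgebra.IsSmallRelativeTo A W := by
  obtain ⟨κ, hκ, hν, hA⟩ := exists_regular_cardinal ν fun _ : PUnit => A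
  have : Fact κ.IsRegular := ⟨hκ⟩
  exact ⟨κ, ⟨hκ⟩, fun J _ _ _ _ _ F _ hF =>
    ⟨preservesColimit_of_sep (κ := κ) F (fun j hj => hW _ (hF j hj)) hν A (hA ⟨⟩)⟩⟩

theorem relativeCells_le_sep {I : MorphismProperty (ANu ν)} (hI : I ≤ sep ν) :
    HomotopicalAlgebra.relativeCells I ≤ sep ν :=
  MorphismProperty.transfiniteCompositions_le_iff.2
    ((MorphismProperty.pushouts_monotone hI).trans MorphismProperty.pushouts_le)

theorem hasSmallObjectArgument_of_le_sep (I : MorphismProperty (ANu ν))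
    [MorphismProperty.IsSmall.{u} I] (hI : I ≤ sep ν) :
    MorphismProperty.HasSmallObjectArgument.{u} I := by
  have hcol := ANu.hasColimits (ν := ν)
  obtain ⟨κ, hκ, hν, hA⟩ := exists_regular_cardinal ν
    fun x : Shrink.{u} I.toSet => ((equivShrink.{u} I.toSet).symm x).1.left
  have : Fact κ.IsRegular := ⟨hκ⟩
  have hne : Nonempty κ.ord.ToType := by
    rw [← Cardinal.mk_ne_zero_iff, Cardinal.mk_ord_toType]
    exact (Cardinal.aleph0_pos.trans_le hκ.aleph0_le).ne'
  let _ : OrderBot κ.ord.ToType := WellFoundedLT.toOrderBot _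
  refine ⟨κ, inferInstance, inferInstance, ?_⟩
  exact
    { preservesColimit := fun {A B X Y} i hi f hf => by
        have hi' : Cardinal.mk A < κ := by
          have := hA (equivShrink.{u} I.toSet ⟨Arrow.mk i, hi⟩)
          rwa [Equiv.symm_apply_apply] at this
        have hle : (MorphismProperty.coproducts.{u} I).pushouts ≤ sep ν := by
          refine (MorphismProperty.pushouts_monotone
            ((MorphismProperty.coproducts_monotone hI).trans ?_)).trans
              MorphismProperty.pushouts_le
          exact MorphismProperty.coproducts_le _
        refine preservesColimit_of_sep (κ := κ) hf.F (fun j hj => hle _ ?_) hν A hi'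
        have := (hf.attachCells j hj).pushouts_coproducts
        simpa using this }

end LmcCStar

namespace LmcCStar

variable {ν : Ordinal.{u}}

/-! ### Homomorphisms out of tensors -/

theorem continuous_hom_iff {T : Type*} [TopologicalSpace T] {A B : ANu ν} {F : T → (A ⟶ B)} :
    Continuous F ↔ Continuous fun t => (⟨F t, ANu.Hom.continuous (F t)⟩ : C(A, B)) :=
  continuous_induced_rng

theorem continuous_hom_of_uncurry {T : Type*} [TopologicalSpace T] {A B : ANu ν} {F : T → (A ⟶ B)}
    (h : Continuous fun z : T × A => F z.1 z.2) : Continuous F :=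
  continuous_hom_iff.2 (ContinuousMap.curry ⟨_, h⟩).continuous

theorem continuous_precomp {A' A B : ANu ν} (g : A' ⟶ A) :
    Continuous fun f : A ⟶ B => g ≫ f :=
  continuous_hom_iff.2 ((ContinuousMap.continuous_precomp
    (⟨g, ANu.Hom.continuous g⟩ : C(A', A))).comp (continuous_hom_iff.1 continuous_id))

theorem continuous_postcomp {A B B' : ANu ν} (g : B ⟶ B') :
    Continuous fun f : A ⟶ B => f ≫ g :=
  PtTop.Hom.continuous ((homFunctor A).map g)

theorem continuous_ptTensorAt (A : ANu ν) (X : PtCpt.{u}) : Continuous (ptTensorAt A X) :=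
  continuous_hom_of_uncurry
    ((ptTensorMk_isPtBimorphism A X).continuous.comp continuous_swap)

theorem ptTensorAt_base (A : ANu ν) (X : PtCpt.{u}) : ptTensorAt A X X.base = 0 :=
  ANu.hom_ext fun a => (ptTensorMk_isPtBimorphism A X).map_base a

theorem ptTensorAt_hom_ext {A : ANu ν} {X : PtCpt.{u}} {B : ANu ν} {f g : ptTensor A X ⟶ B}
    (h : ∀ x, ptTensorAt A X x ≫ f = ptTensorAt A X x ≫ g) : f = g :=
  ptTensor_hom_ext fun t => DFunLike.congr_fun (h t.2) t.1

/-- The homomorphism `A ⊠ X → A ⊠ Y` induced by a pointed map. -/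
noncomputable def ptTensorMap (A : ANu ν) {X Y : PtCpt.{u}} (h : X ⟶ Y) :
    ptTensor A X ⟶ ptTensor A Y :=
  (ptTensorFunctor A).map h

theorem ptTensorAt_map (A : ANu ν) {X Y : PtCpt.{u}} (h : X ⟶ Y) (x : X) :
    ptTensorAt A X x ≫ ptTensorMap A h = ptTensorAt A Y (h x) :=
  ANu.hom_ext fun a => ptTensorLift_mk (fun t : A × X => ptTensorMk A Y (t.1, h t.2))
    ((ptTensorMk_isPtBimorphism A Y).precomp h) (a, x)

/-- The two-point space, based at `false`. -/
abbrev twoPoints : PtCpt.{u} where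
  carrier := ULift.{u} Bool
  base := ⟨false⟩

/-- The pointed map from the two-point space determined by a point. -/
def twoPoints.lift (X : PtTop.{u}) (x : X) : twoPoints.toPtTop ⟶ X where
  toMap := ⟨fun b => bif b.down then x else X.base, by
    exact (continuous_of_discreteTopology (f := fun b : Bool => bif b then x else X.base)).comp
      continuous_uliftDown⟩
  map_base' := rfl

/-- The homomorphism `A ⊠ S⁰ → A`. -/
noncomputable def tensorTwoPoints (A : ANu ν) : ptTensor A twoPoints ⟶ A :=
  ptTensorLift (fun t => bif t.2.down then t.1 else 0)
    { continuous := by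
        refine continuous_iff_continuousAt.2 fun ⟨a, ⟨b⟩⟩ => ?_
        have hb : {t : A × twoPoints.{u} | t.2.down = b} ∈ 𝓝 (a, (⟨b⟩ : twoPoints.{u})) := by
          refine ((isOpen_discrete {b}).preimage
            (continuous_uliftDown.comp continuous_snd)).mem_nhds rfl
        cases b
        · exact continuousAt_const.congr (f := fun _ => (0 : A))
            (by filter_upwards [hb] with t ht; simp_all)
        · exact continuousAt_fst.congr (by filter_upwards [hb] with t ht; simp_all)
      map_base := fun a => rfl
      map_add := by rintro a b ⟨_ | _⟩ <;> simp
      map_smul := by rintro a b ⟨_ | _⟩ <;> simp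
      map_mul := by rintro a b ⟨_ | _⟩ <;> simp
      map_star := by rintro a ⟨_ | _⟩ <;> simp }

theorem ptTensorAt_tensorTwoPoints_true (A : ANu ν) :
    ptTensorAt A twoPoints ⟨true⟩ ≫ tensorTwoPoints A = 𝟙 A :=
  ANu.hom_ext fun a => ptTensorLift_mk (X := twoPoints) (fun t => bif t.2.down then t.1 else 0) _
    (a, (⟨true⟩ : twoPoints))

theorem ptTensorAt_tensorTwoPoints_false (A : ANu ν) :
    ptTensorAt A twoPoints ⟨false⟩ ≫ tensorTwoPoints A = 0 :=
  ANu.hom_ext fun a => ptTensorLift_mk (X := twoPoints) (fun t => bif t.2.down then t.1 else 0) _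
    (a, (⟨false⟩ : twoPoints))

theorem ANu.zero_comp {A B C : ANu ν} (f : B ⟶ C) : (0 : A ⟶ B) ≫ f = 0 :=
  ANu.hom_ext fun _ => ANu.hom_zero f

/-- By naturality, the value at a point of a bijection `Hom(A ⊠ X, B) ≃ C_*(X, Hom(A, B))` is
determined by the case of the two-point space, where the Yoneda lemma shows it to be composition
with an automorphism of `A`; hence every continuous pointed family of homomorphisms is given by a
homomorphism out of `A ⊠ X` in the expected way. -/
theorem IsPartialLeftAdjoint.exists_uncurry {A : ANu ν}
    (h : IsPartialLeftAdjoint (ptTensorFunctor A) (homFunctor A)) {X : PtCpt.{u}} {B : ANu ν}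
    (F : X → (A ⟶ B)) (hF : Continuous F) (hF0 : F X.base = 0) :
    ∃ f : ptTensor A X ⟶ B, ∀ x, ptTensorAt A X x ≫ f = F x := by
  obtain ⟨Φ, hΦ⟩ := h
  let Ψ : ∀ {Y : PtCpt.{u}} {B : ANu ν}, (ptTensor A Y ⟶ B) → Y → (A ⟶ B) :=
    fun {Y B} f => (Φ Y B f).toMap
  have hbase : ∀ {Y : PtCpt.{u}} {B : ANu ν} (f : ptTensor A Y ⟶ B), Ψ f Y.base = 0 :=
    fun {Y B} f => (Φ Y B f).map_base'
  have hinj : ∀ {Y : PtCpt.{u}} {B : ANu ν} (f g : ptTensor A Y ⟶ B),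
      (∀ y, Ψ f y = Ψ g y) → f = g :=
    fun {Y B} f g hfg => (Φ Y B).injective (PtTop.hom_ext hfg)
  have hcomp : ∀ {Y : PtCpt.{u}} {B B' : ANu ν} (f : ptTensor A Y ⟶ B) (g : B ⟶ B') (y : Y),
      Ψ (f ≫ g) y = Ψ f y ≫ g := fun {Y B B'} (f : (ptTensorFunctor A).obj Y ⟶ B) g y => by
    have := congrArg (fun k => k.toMap y) (hΦ Y Y B B' (𝟙 Y) g f)
    rwa [CategoryTheory.Functor.map_id, Category.id_comp] at this
  have hmap : ∀ {Y Z : PtCpt.{u}} {B : ANu ν} (k : Z ⟶ Y) (f : ptTensor A Y ⟶ B) (z : Z),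
      Ψ (ptTensorMap A k ≫ f) z = Ψ f (k z) := fun {Y Z B} k (f : (ptTensorFunctor A).obj Y ⟶ B) z => by
    have := congrArg (fun k => k.toMap z) (hΦ Y Z B B k (𝟙 B) f)
    rwa [CategoryTheory.Functor.map_id, Category.comp_id, Category.comp_id] at this
  -- By the Yoneda lemma the value of `Ψ` at a point is composition with one endomorphism `θ` of `A`,
  -- read off from the two-point space; injectivity of `Ψ` there lets `θ` be cancelled.
  let θ : A ⟶ A := Ψ (tensorTwoPoints A) ⟨true⟩
  have h2 : ∀ {Y : PtCpt.{u}} {B : ANu ν} (f : ptTensor A Y ⟶ B) (y : Y),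
      Ψ f y = θ ≫ ptTensorAt A Y y ≫ f := by
    intro Y B f y
    rw [← hcomp]
    let k : twoPoints ⟶ Y := twoPoints.lift Y.toPtTop y
    have e : tensorTwoPoints A ≫ ptTensorAt A Y y ≫ f = ptTensorMap A k ≫ f := by
      refine ptTensorAt_hom_ext fun b => ?_
      rw [← Category.assoc, ← Category.assoc (ptTensorAt A twoPoints b), ptTensorAt_map]
      obtain ⟨_ | _⟩ := b
      · rw [ptTensorAt_tensorTwoPoints_false, ANu.zero_comp]
        change _ = ptTensorAt A Y Y.base ≫ f
        rw [ptTensorAt_base, ANu.zero_comp]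
      · rw [ptTensorAt_tensorTwoPoints_true, Category.id_comp]
        rfl
    rw [e, hmap]
    rfl
  have h3 : ∀ {B : ANu ν} (g g' : A ⟶ B), θ ≫ g = θ ≫ g' → g = g' := by
    intro B g g' hg
    have : tensorTwoPoints A ≫ g = tensorTwoPoints A ≫ g' := by
      refine hinj _ _ ?_
      rintro ⟨_ | _⟩
      · exact (hbase _).trans (hbase _).symm
      · rwa [hcomp, hcomp]
    have := congrArg (fun k => ptTensorAt A twoPoints ⟨true⟩ ≫ k) this
    rwa [← Category.assoc, ← Category.assoc, ptTensorAt_tensorTwoPoints_true, Category.id_comp,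
      Category.id_comp] at this
  obtain ⟨f, hf⟩ : ∃ f : ptTensor A X ⟶ B, ∀ x, Ψ f x = θ ≫ F x := by
    let F' : X.toPtTop ⟶ (homFunctor A).obj B :=
      { toMap := ⟨fun x => θ ≫ F x, (continuous_precomp θ).comp hF⟩
        map_base' := by
          change θ ≫ F X.base = 0
          rw [hF0]
          rfl }
    obtain ⟨f, hf⟩ := (Φ X B).surjective F'
    exact ⟨f, fun x => congrArg (fun k => k.toMap x) hf⟩
  exact ⟨f, fun x => h3 _ _ (by rw [← h2, hf])⟩

/-! ### Tensors with unpointed spaces -/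

section Cell

variable (X : Type) [TopologicalSpace X] [CompactSpace X] [T2Space X]
  {Y : Type} [TopologicalSpace Y] [CompactSpace Y] [T2Space Y]

/-- A compact Hausdorff space with a disjoint basepoint. -/
def addPoint : PtCpt.{u} where
  carrier := ULift.{u} (X ⊕ Unit)
  base := ⟨Sum.inr ()⟩

variable {X} in
/-- The pointed map from a space with a disjoint basepoint determined by a continuous map. -/
def addPointLift {Z : PtTop.{u}} (φ : C(X, Z)) : (addPoint.{u} X).toPtTop ⟶ Z where
  toMap := ⟨fun x => Sum.elim φ (fun _ => Z.base) x.down,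
    (φ.continuous.sumElim continuous_const).comp continuous_uliftDown⟩
  map_base' := rfl

/-- The inclusion of a space in the same space with a disjoint basepoint. -/
def addPointIncl : C(X, addPoint.{u} X) :=
  ⟨fun x => ⟨Sum.inl x⟩, continuous_uliftUp.comp continuous_inl⟩

/-- The tensor `A ⊠ X₊` with an unpointed space. -/
noncomputable abbrev cell (A : ANu ν) : ANu ν := ptTensor A (addPoint X)

variable {X}

/-- The homomorphism `A → A ⊠ X₊` attached to a point of `X`. -/
noncomputable def cellAt (A : ANu ν) (x : X) : A ⟶ cell X A :=
  ptTensorAt A (addPoint X) (addPointIncl X x)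

theorem continuous_cellAt (A : ANu ν) : Continuous (cellAt A : X → (A ⟶ cell X A)) :=
  (continuous_ptTensorAt A _).comp (addPointIncl X).continuous

theorem cell_hom_ext {A B : ANu ν} {f g : cell X A ⟶ B}
    (h : ∀ x, cellAt A x ≫ f = cellAt A x ≫ g) : f = g := by
  refine ptTensorAt_hom_ext ?_
  rintro ⟨x | x⟩
  · exact h x
  · change ptTensorAt A _ (addPoint X).base ≫ f = ptTensorAt A _ (addPoint X).base ≫ g
    rw [ptTensorAt_base, ANu.zero_comp, ANu.zero_comp]

/-- The homomorphism `A ⊠ X₊ → A ⊠ Y₊` induced by a map. -/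
noncomputable def cellMap (A : ANu ν) (φ : C(X, Y)) : cell X A ⟶ cell Y A :=
  ptTensorMap A
    (addPointLift ((addPointIncl Y).comp φ) : addPoint X ⟶ addPoint Y)

theorem cellAt_cellMap (A : ANu ν) (φ : C(X, Y)) (x : X) :
    cellAt A x ≫ cellMap A φ = cellAt A (φ x) :=
  ptTensorAt_map A _ _

theorem IsPartialLeftAdjoint.exists_cell_hom {A : ANu ν}
    (h : IsPartialLeftAdjoint (ptTensorFunctor A) (homFunctor A)) {B : ANu ν}
    (F : C(X, A ⟶ B)) : ∃ f : cell X A ⟶ B, ∀ x, cellAt A x ≫ f = F x := by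
  obtain ⟨f, hf⟩ := h.exists_uncurry (X := addPoint X)
    (addPointLift (Z := (homFunctor A).obj B) F)
    (PtTop.Hom.continuous (addPointLift (Z := (homFunctor A).obj B) F)) rfl
  exact ⟨f, fun x => hf (addPointIncl X x)⟩

theorem IsPartialLeftAdjoint.hasLiftingProperty_iff {A : ANu ν}
    (h : IsPartialLeftAdjoint (ptTensorFunctor A) (homFunctor A)) {B B' : ANu ν} (p : B ⟶ B')
    (φ : C(X, Y)) :
    HasLiftingProperty (cellMap A φ) p ↔
      ∀ (f : C(X, A ⟶ B)) (g : C(Y, A ⟶ B')), (∀ x, f x ≫ p = g (φ x)) →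
        ∃ l : C(Y, A ⟶ B), (∀ x, l (φ x) = f x) ∧ ∀ y, l y ≫ p = g y := by
  constructor
  · intro hl f g hfg
    obtain ⟨f', hf'⟩ := h.exists_cell_hom f
    obtain ⟨g', hg'⟩ := h.exists_cell_hom g
    have sq : CommSq f' (cellMap A φ) p g' := ⟨cell_hom_ext fun x => by
      rw [← Category.assoc, hf', hfg, ← Category.assoc, cellAt_cellMap, hg']⟩
    refine ⟨⟨fun y => cellAt A y ≫ sq.lift, (continuous_postcomp _).comp (continuous_cellAt A)⟩,
      fun x => ?_, fun y => ?_⟩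
    · change cellAt A (φ x) ≫ sq.lift = f x
      rw [← cellAt_cellMap, Category.assoc, sq.fac_left, hf']
    · change (cellAt A y ≫ sq.lift) ≫ p = g y
      rw [Category.assoc, sq.fac_right, hg']
  · refine fun H => ⟨fun {f g} sq => ?_⟩
    obtain ⟨l, hl, hl'⟩ := H
      ⟨fun x => cellAt A x ≫ f, (continuous_postcomp _).comp (continuous_cellAt A)⟩
      ⟨fun y => cellAt A y ≫ g, (continuous_postcomp _).comp (continuous_cellAt A)⟩
      (fun x => by
        change (cellAt A x ≫ f) ≫ p = cellAt A (φ x) ≫ g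
        rw [Category.assoc, sq.w, ← cellAt_cellMap, Category.assoc])
    obtain ⟨l', hl''⟩ := h.exists_cell_hom l
    refine ⟨⟨⟨l', cell_hom_ext fun x => ?_, cell_hom_ext fun y => ?_⟩⟩⟩
    · rw [← Category.assoc, cellAt_cellMap, hl'', hl]
      rfl
    · rw [← Category.assoc, hl'', hl']
      rfl

end Cell

end LmcCStar

namespace CubeBox

open unitInterval Set

variable {n : ℕ}

/-! ### Radial coordinates on the cube -/

instance (n : ℕ) : CompactSpace (Cube.boundary (Fin n)) :=
  isCompact_iff_compactSpace.1 (isClosed_boundary n).isCompact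

/-- The inclusion `∂Iⁿ → Iⁿ`. -/
def boundaryIncl (n : ℕ) : C(Cube.boundary (Fin n), Fin n → I) := ⟨Subtype.val, by fun_prop⟩

/-- The inclusion `Iⁿ → Iⁿ × I` of the bottom. -/
def bottomIncl (n : ℕ) : C(Fin n → I, (Fin n → I) × I) := ⟨fun t => (t, 0), by fun_prop⟩

/-- The radial parametrization of the cube by the cone over its boundary. -/
noncomputable def radial (n : ℕ) : C(Cube.boundary (Fin n) × I, Fin n → I) where
  toFun z i := ⟨1 / 2 + z.2 * (z.1.1 i - 1 / 2), by
    have h1 := (z.1.1 i).2.1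
    have h2 := (z.1.1 i).2.2
    have h3 := z.2.2.1
    have h4 := z.2.2.2
    constructor <;> nlinarith⟩
  continuous_toFun := continuous_pi fun i => by
    have h : Continuous fun z : Cube.boundary (Fin n) × I => z.1.1 i :=
      (continuous_apply i).comp (continuous_subtype_val.comp continuous_fst)
    fun_prop

theorem radial_apply (z : Cube.boundary (Fin n) × I) (i : Fin n) :
    (radial n z i : ℝ) = 1 / 2 + z.2 * (z.1.1 i - 1 / 2) := rfl

theorem radial_one (u : Cube.boundary (Fin n)) : radial n (u, 1) = u := by
  ext i; rw [radial_apply]; simp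

theorem le_of_radial_eq {z z' : Cube.boundary (Fin n) × I} (h : radial n z = radial n z') :
    (z.2 : ℝ) ≤ z'.2 := by
  obtain ⟨⟨u, i, hi⟩, s⟩ := z
  obtain ⟨⟨u', hu'⟩, s'⟩ := z'
  have h1 := congrArg (fun x => (x i : ℝ)) h
  simp only [radial_apply] at h1 ⊢
  have h2 := (u' i).2.1
  have h3 := (u' i).2.2
  have h4 := s'.2.1
  rcases hi with hi | hi <;> rw [hi] at h1 <;> simp at h1 <;> nlinarith

theorem radial_eq {z z' : Cube.boundary (Fin n) × I} (h : radial n z = radial n z') :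
    z = z' ∨ z.2 = 0 ∧ z'.2 = 0 := by
  have hs : z.2 = z'.2 := Subtype.ext (le_antisymm (le_of_radial_eq h) (le_of_radial_eq h.symm))
  by_cases h0 : z.2 = 0
  · exact Or.inr ⟨h0, hs ▸ h0⟩
  · refine Or.inl (Prod.ext (Subtype.ext (funext fun i => Subtype.ext ?_)) hs)
    have h1 := congrArg (fun x => (x i : ℝ)) h
    simp only [radial_apply, hs] at h1
    have h2 : (z'.2 : ℝ) ≠ 0 := fun h => h0 (hs.trans (Subtype.ext h))
    linarith [mul_left_cancel₀ h2 (add_left_cancel h1)]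

theorem radial_surjective [Nonempty (Cube.boundary (Fin n))] :
    Function.Surjective (radial n) := by
  intro x
  obtain ⟨u₀⟩ := ‹Nonempty (Cube.boundary (Fin n))›
  have hn : Nonempty (Fin n) := ⟨u₀.2.choose⟩
  obtain ⟨k, hk⟩ := Finite.exists_max fun i => |(x i : ℝ) - 1 / 2|
  obtain ⟨m, hm⟩ : ∃ m, m = |(x k : ℝ) - 1 / 2| := ⟨_, rfl⟩
  rw [← hm] at hk
  have hm2 : m ≤ 1 / 2 := by
    rw [hm, abs_le]; constructor <;> linarith [(x k).2.1, (x k).2.2]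
  have hm0 : 0 ≤ m := hm ▸ abs_nonneg _
  rcases hm0.eq_or_lt with h0 | h0
  · refine ⟨(u₀, 0), funext fun i => Subtype.ext ?_⟩
    have := abs_nonpos_iff.1 ((hk i).trans h0.ge)
    rw [radial_apply]
    simp only [Icc.coe_zero, zero_mul]
    linarith
  · have hu : ∀ i, 1 / 2 + ((x i : ℝ) - 1 / 2) / (2 * m) ∈ I := fun i => by
      have := abs_le.1 (hk i)
      have h1 : -(1 / 2) ≤ ((x i : ℝ) - 1 / 2) / (2 * m) := by
        rw [le_div_iff₀ (by linarith)]; linarith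
      have h2 : ((x i : ℝ) - 1 / 2) / (2 * m) ≤ 1 / 2 := by
        rw [div_le_iff₀ (by linarith)]; linarith
      constructor <;> linarith
    refine ⟨(⟨fun i => ⟨_, hu i⟩, k, ?_⟩, ⟨2 * m, by linarith, by linarith⟩),
      funext fun i => Subtype.ext ?_⟩
    · rcases abs_choice ((x k : ℝ) - 1 / 2) with h | h
      · right
        refine Subtype.ext ?_
        change 1 / 2 + ((x k : ℝ) - 1 / 2) / (2 * m) = 1
        rw [← h, ← hm]
        field_simp
        norm_num
      · left
        refine Subtype.ext ?_
        change 1 / 2 + ((x k : ℝ) - 1 / 2) / (2 * m) = 0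
        rw [← neg_eq_iff_eq_neg] at h
        rw [← h, ← hm]
        field_simp
        norm_num
    · rw [radial_apply]
      change 1 / 2 + 2 * m * (1 / 2 + ((x i : ℝ) - 1 / 2) / (2 * m) - 1 / 2) = x i
      field_simp
      ring

/-- A map on the cylinder over `∂Iⁿ` which is constant on the bottom descends to the cube. -/
theorem exists_radial_factor [Nonempty (Cube.boundary (Fin n))] {Z : Type*} [TopologicalSpace Z]
    (G : C(Cube.boundary (Fin n) × I, Z)) (hG : ∀ u u', G (u, 0) = G (u', 0)) :
    ∃ F : C(Fin n → I, Z), ∀ u, F (boundaryIncl n u) = G (u, 1) := by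
  have hq : IsQuotientMap (radial n) :=
    (radial n).continuous.isClosedMap.isQuotientMap (radial n).continuous radial_surjective
  have hf : Function.FactorsThrough G (radial n) := by
    rintro ⟨u, s⟩ ⟨u', s'⟩ h
    rcases radial_eq h with h | ⟨h, h'⟩
    · rw [h]
    · obtain rfl : s = 0 := h
      obtain rfl : s' = 0 := h'
      exact hG u u'
  refine ⟨hq.lift G hf, fun u => ?_⟩
  rw [show boundaryIncl n u = radial n (u, 1) from (radial_one u).symm]
  exact DFunLike.congr_fun (hq.lift_comp G hf) (u, 1)

/-- A lifting problem against `∂Iⁿ ⊆ Iⁿ` may be given by a continuous map defined on the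
boundary only. -/
theorem hasBoundaryLift_iff {X Y : Type*} [TopologicalSpace X] [TopologicalSpace Y] [Nonempty X]
    (p : C(X, Y)) (n : ℕ) :
    HasBoundaryLift p n ↔
      ∀ (f : C(Cube.boundary (Fin n), X)) (g : C(Fin n → I, Y)),
        (∀ x, p (f x) = g (boundaryIncl n x)) →
          ∃ l : C(Fin n → I, X), (∀ x, l (boundaryIncl n x) = f x) ∧ ∀ y, p (l y) = g y := by
  classical
  constructor
  · intro h f g hfg
    have hext : ∀ u : Cube.boundary (Fin n),
        Function.extend Subtype.val f (fun _ => Classical.arbitrary X) u.1 = f u :=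
      fun u => Subtype.val_injective.extend_apply _ _ _
    obtain ⟨l, h1, h2⟩ := h (Function.extend Subtype.val f fun _ => Classical.arbitrary X)
      (by
        rw [continuousOn_iff_continuous_domRestrict]
        exact f.continuous.congr fun u => (hext u).symm) g
      (fun x hx => (congrArg p (hext ⟨x, hx⟩)).trans (hfg ⟨x, hx⟩))
    exact ⟨l, fun u => (h1 u.1 u.2).trans (hext u), h2⟩
  · intro h a ha b hab
    obtain ⟨l, h1, h2⟩ := h ⟨(Cube.boundary (Fin n)).domRestrict a,
      continuousOn_iff_continuous_domRestrict.1 ha⟩ b fun u => hab u.1 u.2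
    exact ⟨l, fun x hx => h1 ⟨x, hx⟩, h2⟩

end CubeBox

namespace LmcCStar

open CubeBox unitInterval

variable {ν : Ordinal.{u}}

/-! ### The generating morphisms -/

/-- Composition with `p`, as a continuous map of spaces of homomorphisms. -/
def homMap (A : ANu ν) {B B' : ANu ν} (p : B ⟶ B') : C(A ⟶ B, A ⟶ B') :=
  ⟨fun f => f ≫ p, continuous_postcomp p⟩

variable {ι : Type u} (A : ι → ANu ν)

/-- The generating cofibrations `A_i ⊠ (∂Iⁿ)₊ → A_i ⊠ (Iⁿ)₊`. -/
def genCof : MorphismProperty (ANu ν) :=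
  .ofHoms fun x : ι × ℕ => cellMap (A x.1) (boundaryIncl x.2)

/-- The generating trivial cofibrations `A_i ⊠ (Iⁿ)₊ → A_i ⊠ (Iⁿ × I)₊`. -/
def genTrivCof : MorphismProperty (ANu ν) :=
  .ofHoms fun x : ι × ℕ => cellMap (A x.1) (bottomIncl x.2)

instance : MorphismProperty.IsSmall.{u} (genCof A) := by
  have : Small.{u} (ι × ℕ) := small_self _
  exact MorphismProperty.isSmall_ofHoms _

instance : MorphismProperty.IsSmall.{u} (genTrivCof A) := by
  have : Small.{u} (ι × ℕ) := small_self _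
  exact MorphismProperty.isSmall_ofHoms _

variable {A}

theorem rlp_genCof_iff (h1 : ∀ i, IsPartialLeftAdjoint (ptTensorFunctor (A i)) (homFunctor (A i)))
    {B B' : ANu ν} (p : B ⟶ B') :
    (genCof A).rlp p ↔ ∀ i n, HasBoundaryLift (homMap (A i) p) n := by
  have key : ∀ i n, HasLiftingProperty (cellMap (A i) (boundaryIncl n)) p ↔
      HasBoundaryLift (homMap (A i) p) n := fun i n => by
    have : Nonempty (A i ⟶ B) := ⟨0⟩
    rw [(h1 i).hasLiftingProperty_iff, hasBoundaryLift_iff]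
    rfl
  refine ⟨fun h i n => (key i n).1 (h _ ⟨(i, n)⟩), ?_⟩
  rintro h _ _ _ ⟨i, n⟩
  exact (key i n).2 (h i n)

theorem rlp_genTrivCof_iff
    (h1 : ∀ i, IsPartialLeftAdjoint (ptTensorFunctor (A i)) (homFunctor (A i)))
    {B B' : ANu ν} (p : B ⟶ B') :
    (genTrivCof A).rlp p ↔ ∀ i n, HasHomotopyLift (homMap (A i) p) n := by
  have key : ∀ i n, HasLiftingProperty (cellMap (A i) (bottomIncl n)) p ↔
      HasHomotopyLift (homMap (A i) p) n := fun i n => by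
    rw [(h1 i).hasLiftingProperty_iff]
    exact ⟨fun h f H hfH => h f H fun t => (hfH t).symm,
      fun h f H hfH => h f H fun t => (hfH t).symm⟩
  refine ⟨fun h i n => (key i n).1 (h _ ⟨(i, n)⟩), ?_⟩
  rintro h _ _ _ ⟨i, n⟩
  exact (key i n).2 (h i n)

theorem rlp_genCof_iff_isWeq
    (h1 : ∀ i, IsPartialLeftAdjoint (ptTensorFunctor (A i)) (homFunctor (A i)))
    {B B' : ANu ν} (p : B ⟶ B') :
    (genCof A).rlp p ↔ (genTrivCof A).rlp p ∧ ∀ i, IsWeq (homMap (A i) p) := by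
  rw [rlp_genCof_iff h1, rlp_genTrivCof_iff h1]
  constructor
  · exact fun h => ⟨fun i => HasBoundaryLift.hasHomotopyLift (h i),
      fun i => isWeq_of_hasBoundaryLift (h i)⟩
  · intro h i n
    have : Nonempty (A i ⟶ B) := ⟨0⟩
    exact (h.2 i).hasBoundaryLift (h.1 i) n

/-- Up to radial coordinates the cube is the cone over its boundary, so the inclusion of
`A ⊠ (∂Iⁿ)₊` in its cone factors through `A ⊠ (Iⁿ)₊`. -/
theorem hasSEP_cellMap_boundaryIncl {A : ANu ν}
    (h1 : IsPartialLeftAdjoint (ptTensorFunctor A) (homFunctor A)) (h3 : HasStrongConeSEP A)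
    (n : ℕ) : HasSEP (cellMap A (boundaryIncl n)) := by
  rcases isEmpty_or_nonempty (Cube.boundary (Fin n)) with hn | hn
  · intro p hp hpc
    -- The tensor with the empty space is zero.
    have h0 : (𝟙 (cell (Cube.boundary (Fin n)) A) : _ ⟶ _) = 0 :=
      cell_hom_ext fun x => isEmptyElim x
    refine ⟨0, ⟨by simp, by simp⟩, continuous_const, fun a => ?_⟩
    have ha : a = 0 := DFunLike.congr_fun h0 a
    rw [ha, map_zero]
    rfl
  · let S := cell (Cube.boundary (Fin n)) A
    let at' : I → (S ⟶ ptTensor S PtCpt.interval) := fun s => ptTensorAt S PtCpt.interval ⟨s⟩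
    have hat : Continuous at' := (continuous_ptTensorAt S PtCpt.interval).comp continuous_uliftUp
    have hG : Continuous fun z : Cube.boundary (Fin n) × I => cellAt A z.1 ≫ at' z.2 := by
      refine continuous_hom_of_uncurry ?_
      have hmk := (ptTensorMk_isPtBimorphism S PtCpt.interval).continuous
      have hmk' := (ptTensorMk_isPtBimorphism A (addPoint (Cube.boundary (Fin n)))).continuous
      have e1 : Continuous fun z : (Cube.boundary (Fin n) × I) × A =>
          (cellAt A z.1.1 z.2 : S) :=
        hmk'.comp (f := fun z : (Cube.boundary (Fin n) × I) × A => (z.2, addPointIncl _ z.1.1))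
          (continuous_snd.prodMk ((addPointIncl _).continuous.comp
            (continuous_fst.comp continuous_fst)))
      exact hmk.comp (f := fun z : (Cube.boundary (Fin n) × I) × A =>
        ((cellAt A z.1.1 z.2 : S), (⟨z.1.2⟩ : PtCpt.interval)))
        (e1.prodMk (continuous_uliftUp.comp (continuous_snd.comp continuous_fst)))
    obtain ⟨F, hF⟩ := exists_radial_factor ⟨_, hG⟩ fun u u' => by
      change cellAt A u ≫ ptTensorAt S PtCpt.interval PtCpt.interval.base =
        cellAt A u' ≫ ptTensorAt S PtCpt.interval PtCpt.interval.base
      rw [ptTensorAt_base]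
      exact ANu.hom_ext fun a => rfl
    obtain ⟨f, hf⟩ := h1.exists_cell_hom F
    have e : cellMap A (boundaryIncl n) ≫ f = ptTensorAt S PtCpt.interval ⟨1⟩ :=
      cell_hom_ext fun u => by
        rw [← Category.assoc, cellAt_cellMap, hf, hF]
        rfl
    have hs : HasSEP (ptTensorAt S PtCpt.interval ⟨1⟩) := h3 _
    rw [← e] at hs
    exact hs.of_comp

/-- The inclusion of the bottom of `Iⁿ × I` is split by the projection. -/
theorem hasSEP_cellMap_bottomIncl (A : ANu ν) (n : ℕ) : HasSEP (cellMap A (bottomIncl n)) := by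
  have e : cellMap A (bottomIncl n) ≫ cellMap A ⟨Prod.fst, continuous_fst⟩ = 𝟙 _ :=
    cell_hom_ext fun x => by
      rw [← Category.assoc, cellAt_cellMap, cellAt_cellMap, Category.comp_id]
      rfl
  have h := HasSEP.of_isIso (𝟙 (cell (Fin n → I) A))
  rw [← e] at h
  exact h.of_comp

theorem genCof_le_sep (h1 : ∀ i, IsPartialLeftAdjoint (ptTensorFunctor (A i)) (homFunctor (A i)))
    (h3 : ∀ i, HasStrongConeSEP (A i)) : genCof A ≤ sep ν := by
  rintro _ _ _ ⟨i, n⟩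
  exact hasSEP_cellMap_boundaryIncl (h1 i) (h3 i) n

theorem genTrivCof_le_sep : genTrivCof A ≤ sep ν := by
  rintro _ _ _ ⟨i, n⟩
  exact hasSEP_cellMap_bottomIncl _ n

end LmcCStar

namespace CubeBox

open unitInterval Set

/-! ### Path objects -/

/-- Extension of a map from three sides of a square, in a family. -/
theorem exists_extend_three_sides {T Y : Type*} [TopologicalSpace T] [LocallyCompactSpace T]
    [TopologicalSpace Y] (f e₀ e₁ : C(T × I, Y)) (h₀ : ∀ t, e₀ (t, 0) = f (t, 0))
    (h₁ : ∀ t, e₁ (t, 0) = f (t, 1)) :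
    ∃ L : C((T × I) × I, Y), (∀ t s, L ((t, 0), s) = f (t, s)) ∧
      (∀ z, L (z, 0) = e₀ z) ∧ ∀ z, L (z, 1) = e₁ z := by
  classical
  let cur : C(T × I, Y) → C(I, C(T, Y)) := fun g => ContinuousMap.curry
    (g.comp ⟨Prod.swap, continuous_swap⟩)
  let h : (Fin 1 → I) × I → C(T, Y) := fun z => if z.1 0 = 0 then cur e₀ z.2 else cur e₁ z.2
  have hh : ContinuousOn h {z | z.1 ∈ Cube.boundary (Fin 1)} := by
    have e : {z : (Fin 1 → I) × I | z.1 ∈ Cube.boundary (Fin 1)} =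
        {z | z.1 0 = 0} ∪ {z | z.1 0 = 1} := by
      ext z
      simp [Cube.boundary]
    have hc : Continuous fun z : (Fin 1 → I) × I => z.1 0 := by fun_prop
    rw [e]
    refine ContinuousOn.union_of_isClosed ?_ ?_ (isClosed_eq hc continuous_const)
      (isClosed_eq hc continuous_const)
    · exact ((cur e₀).continuous.comp continuous_snd).continuousOn.congr fun z hz => if_pos hz
    · refine ((cur e₁).continuous.comp continuous_snd).continuousOn.congr fun z hz => if_neg ?_
      rw [show z.1 0 = 1 from hz]
      exact one_ne_zero
  obtain ⟨F, hF, hF'⟩ := exists_homotopy_extension (n := 1)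
    ((cur f).comp ⟨fun x => x 0, continuous_apply 0⟩) h hh (by
      rintro x ⟨i, hi⟩
      obtain rfl : i = 0 := Subsingleton.elim _ _
      ext t
      rcases hi with hi | hi
      · simp [h, hi, cur, h₀]
      · simp [h, hi, cur, h₁])
  have hconst : Continuous fun s : I => (fun _ => s : Fin 1 → I) := by fun_prop
  refine ⟨⟨fun z => F (fun _ => z.2, z.1.2) z.1.1, ?_⟩, fun t s => ?_, fun z => ?_, fun z => ?_⟩
  · have : Continuous fun z : ((Fin 1 → I) × I) × T => F z.1 z.2 :=
      (ContinuousMap.continuous_uncurry_of_continuous F)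
    exact this.comp (f := fun z : (T × I) × I => ((fun _ => z.2, z.1.2), z.1.1)) (by fun_prop)
  · exact (DFunLike.congr_fun (hF fun _ => s) t)
  · refine (DFunLike.congr_fun (hF' (fun _ => 0) ⟨0, Or.inl rfl⟩ z.2) z.1).trans ?_
    simp [h, cur]
  · refine (DFunLike.congr_fun (hF' (fun _ => 1) ⟨0, Or.inr rfl⟩ z.2) z.1).trans ?_
    simp [h, cur]

end CubeBox

namespace LmcCStar

open CubeBox unitInterval

variable {ν : Ordinal.{u}}

/-- For a compact parameter space, a continuous family of homomorphisms is jointly continuous. -/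
theorem IsPartialLeftAdjoint.continuous_uncurry {A : ANu ν}
    (h : IsPartialLeftAdjoint (ptTensorFunctor A) (homFunctor A)) {B : ANu ν}
    {T : Type} [TopologicalSpace T] [CompactSpace T] [T2Space T] (F : C(T, A ⟶ B)) :
    Continuous fun z : T × A => F z.1 z.2 := by
  obtain ⟨f, hf⟩ := h.exists_cell_hom F
  have : (fun z : T × A => F z.1 z.2) =
      fun z => f (ptTensorMk A (addPoint T) (z.2, addPointIncl T z.1)) := funext fun z => by
    rw [← hf]
    rfl
  rw [this]
  exact (ANu.Hom.continuous f).comp ((ptTensorMk_isPtBimorphism A (addPoint T)).continuous.comp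
    (continuous_snd.prodMk ((addPointIncl T).continuous.comp continuous_fst)))

/-- The algebra of paths in `B`. -/
noncomputable abbrev pathAlg (B : ANu ν) : ANu ν := ptMapAlg (addPoint I) B

/-- The evaluation of paths at a point. -/
def pathEv (B : ANu ν) (s : I) : pathAlg B ⟶ B where
  toStarHom :=
    { toFun := fun γ => (γ : ptMapSubalgebra (addPoint I) B).1 (addPointIncl I s)
      map_smul' := fun _ _ => rfl
      map_zero' := rfl
      map_add' := fun _ _ => rfl
      map_mul' := fun _ _ => rfl
      map_star' := fun _ => rfl }
  continuous' := (continuous_eval_const (F := C(addPoint I, B)) (addPointIncl I s)).comp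
    continuous_subtype_val

theorem continuous_pathEv (B : ANu ν) : Continuous fun z : pathAlg B × I => pathEv B z.2 z.1 :=
  (continuous_eval (F := C(addPoint I, B))).comp
    (f := fun z : pathAlg B × I => (z.1.1, addPointIncl I z.2))
    ((continuous_subtype_val.comp continuous_fst).prodMk
      ((addPointIncl I).continuous.comp continuous_snd))

theorem pathAlg_hom_ext {A B : ANu ν} {f g : A ⟶ pathAlg B}
    (h : ∀ s, f ≫ pathEv B s = g ≫ pathEv B s) : f = g := by
  refine ANu.hom_ext fun a => Subtype.ext (ContinuousMap.ext ?_)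
  rintro ⟨s | s⟩
  · exact DFunLike.congr_fun (h s) a
  · exact (f a).2.trans (g a).2.symm

theorem exists_pathAlg_family {T : Type*} [TopologicalSpace T] {A B : ANu ν}
    (L : T × I → (A ⟶ B)) (hL : Continuous fun z : (T × I) × A => L z.1 z.2) :
    ∃ F : C(T, A ⟶ pathAlg B), ∀ t s, F t ≫ pathEv B s = L (t, s) := by
  have hc : Continuous fun z : (T × A) × addPoint I =>
      Sum.elim (fun s => L (z.1.1, s) z.1.2) (fun _ => 0) z.2.down := by
    have h1 : Continuous fun z : (T × A) × (I ⊕ Unit) =>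
        Sum.elim (fun s => L (z.1.1, s) z.1.2) (fun _ => 0) z.2 := by
      refine Homeomorph.prodSumDistrib.symm.isQuotientMap.continuous_iff.2
        (continuous_sum_dom.2 ⟨?_, continuous_const⟩)
      exact hL.comp (f := fun z : (T × A) × I => ((z.1.1, z.2), z.1.2)) (by fun_prop)
    exact h1.comp (continuous_fst.prodMk (continuous_uliftDown.comp continuous_snd))
  let G : C(T × A, C(addPoint I, B)) := ContinuousMap.curry ⟨_, hc⟩
  let F : T → (A ⟶ pathAlg B) := fun t =>
    { toStarHom :=
        { toFun := fun a => (⟨G (t, a), rfl⟩ : ptMapSubalgebra (addPoint I) B)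
          map_smul' := fun c a => Subtype.ext (ContinuousMap.ext fun x => by
            obtain ⟨s | s⟩ := x
            · exact ANu.hom_smul (L (t, s)) c a
            · exact (smul_zero c).symm)
          map_zero' := Subtype.ext (ContinuousMap.ext fun x => by
            obtain ⟨s | s⟩ := x
            · exact ANu.hom_zero (L (t, s))
            · rfl)
          map_add' := fun a b => Subtype.ext (ContinuousMap.ext fun x => by
            obtain ⟨s | s⟩ := x
            · exact ANu.hom_add (L (t, s)) a b
            · exact (add_zero 0).symm)
          map_mul' := fun a b => Subtype.ext (ContinuousMap.ext fun x => by
            obtain ⟨s | s⟩ := x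
            · exact ANu.hom_mul (L (t, s)) a b
            · exact (mul_zero 0).symm)
          map_star' := fun a => Subtype.ext (ContinuousMap.ext fun x => by
            obtain ⟨s | s⟩ := x
            · exact ANu.hom_star (L (t, s)) a
            · exact (star_zero B).symm) }
      continuous' := Continuous.subtype_mk
        (G.continuous.comp (continuous_const.prodMk continuous_id)) _ }
  exact ⟨⟨F, continuous_hom_of_uncurry (Continuous.subtype_mk G.continuous _)⟩,
    fun t s => rfl⟩

attribute [local instance] ANu.hasLimits

/-- The path algebra is a path object: its endpoint evaluation is a fibration. -/
theorem rlp_genTrivCof_pathEv {ι : Type u} {A : ι → ANu ν}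
    (h1 : ∀ i, IsPartialLeftAdjoint (ptTensorFunctor (A i)) (homFunctor (A i))) (B : ANu ν) :
    (genTrivCof A).rlp (Limits.prod.lift (pathEv B 0) (pathEv B 1)) := by
  rw [rlp_genTrivCof_iff h1]
  intro i n f H hfH
  have hf0 : Continuous fun z : (Fin n → I) × I => f z.1 ≫ pathEv B z.2 :=
    continuous_hom_of_uncurry ((continuous_pathEv B).comp
      (f := fun z : ((Fin n → I) × I) × A i => (f z.1.1 z.2, z.1.2))
      ((((h1 i).continuous_uncurry f).comp
        (f := fun z : ((Fin n → I) × I) × A i => (z.1.1, z.2)) (by fun_prop)).prodMk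
        (by fun_prop)))
  obtain ⟨L, hL, hL0, hL1⟩ := exists_extend_three_sides ⟨_, hf0⟩
    ((homMap (A i) Limits.prod.fst).comp H) ((homMap (A i) Limits.prod.snd).comp H)
    (fun t => by
      change H (t, 0) ≫ Limits.prod.fst = f t ≫ pathEv B 0
      rw [hfH]
      change (f t ≫ _) ≫ _ = _
      rw [Category.assoc, Limits.prod.lift_fst])
    (fun t => by
      change H (t, 0) ≫ Limits.prod.snd = f t ≫ pathEv B 1
      rw [hfH]
      change (f t ≫ _) ≫ _ = _
      rw [Category.assoc, Limits.prod.lift_snd])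
  obtain ⟨F, hF⟩ := exists_pathAlg_family L ((h1 i).continuous_uncurry L)
  refine ⟨F, fun t => pathAlg_hom_ext fun s => by rw [hF, hL]; rfl, fun z => ?_⟩
  change F z ≫ _ = _
  refine Limits.prod.hom_ext ?_ ?_
  · rw [Category.assoc, Limits.prod.lift_fst, hF, hL0]; rfl
  · rw [Category.assoc, Limits.prod.lift_snd, hF, hL1]; rfl

/-- A morphism with the left lifting property against all fibrations is the inclusion of a
deformation retract, since every object is fibrant and has a path object. -/
theorem isWeq_of_llp {ι : Type u} {A : ι → ANu ν}
    (h1 : ∀ i, IsPartialLeftAdjoint (ptTensorFunctor (A i)) (homFunctor (A i))) {B B' : ANu ν}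
    (f : B ⟶ B') (hf : (genTrivCof A).rlp.llp f) (i : ι) : IsWeq (homMap (A i) f) := by
  -- The retraction `r` is a lift against `B ⟶ 0`, the homotopy `H` one against the path object.
  have hT : (genTrivCof A).rlp (Limits.terminal.from B) := by
    rw [rlp_genTrivCof_iff h1]
    exact fun i n g H _ => ⟨g.comp ⟨Prod.fst, continuous_fst⟩, fun t => rfl, fun z =>
      Limits.terminal.hom_ext _ _⟩
  have := hf _ hT
  have sq : CommSq (𝟙 B) f (Limits.terminal.from B) (Limits.terminal.from B') :=
    ⟨Limits.terminal.hom_ext _ _⟩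
  let r : B' ⟶ B := sq.lift
  have hr : f ≫ r = 𝟙 B := sq.fac_left
  obtain ⟨c, hc⟩ := exists_pathAlg_family (T := Unit) (fun _ => f)
    ((ANu.Hom.continuous f).comp continuous_snd)
  have := hf _ (rlp_genTrivCof_pathEv h1 B')
  have sq' : CommSq (c ()) f (Limits.prod.lift (pathEv B' 0) (pathEv B' 1))
      (Limits.prod.lift (r ≫ f) (𝟙 B')) := ⟨by
    rw [Limits.prod.comp_lift, Limits.prod.comp_lift, hc, hc, ← Category.assoc, hr,
      Category.id_comp, Category.comp_id]⟩
  let H : B' ⟶ pathAlg B' := sq'.lift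
  have hH : f ≫ H = c () := sq'.fac_left
  have hH' : H ≫ Limits.prod.lift (pathEv B' 0) (pathEv B' 1) = Limits.prod.lift (r ≫ f) (𝟙 B') :=
    sq'.fac_right
  have hH0 : H ≫ pathEv B' 0 = r ≫ f := by
    rw [← Limits.prod.lift_fst (pathEv B' 0) (pathEv B' 1), ← Category.assoc, hH',
      Limits.prod.lift_fst]
  have hH1 : H ≫ pathEv B' 1 = 𝟙 B' := by
    rw [← Limits.prod.lift_snd (pathEv B' 0) (pathEv B' 1), ← Category.assoc, hH',
      Limits.prod.lift_snd]
  have hG : Continuous fun z : B' × I => pathEv B' z.2 (H z.1) :=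
    (continuous_pathEv B').comp (((ANu.Hom.continuous H).comp continuous_fst).prodMk continuous_snd)
  have hK : Continuous fun z : (A i ⟶ B') × I => z.1 ≫ H ≫ pathEv B' z.2 := by
    have hG' : Continuous fun z : I × B' => pathEv B' z.1 (H z.2) := hG.comp continuous_swap
    exact continuous_hom_iff.2 ((ContinuousMap.continuous_postcomp ⟨_, hG'⟩).comp
      (ContinuousMap.continuous_prodMk_const.comp
        (continuous_snd.prodMk ((continuous_hom_iff.1 continuous_id).comp continuous_fst))))
  refine isWeq_of_deformation (homMap (A i) r) (fun x => ?_) ⟨_, hK⟩ (fun y => ?_) (fun y => ?_)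
    (fun x t => ?_)
  · change (x ≫ f) ≫ r = x
    rw [Category.assoc, hr, Category.comp_id]
  · change y ≫ H ≫ pathEv B' 0 = (y ≫ r) ≫ f
    rw [hH0, Category.assoc]
  · change y ≫ H ≫ pathEv B' 1 = y
    rw [hH1, Category.comp_id]
  · change (x ≫ f) ≫ H ≫ pathEv B' t = x ≫ f
    rw [Category.assoc, ← Category.assoc f, hH, hc]

end LmcCStar

namespace LmcCStar

open CubeBox HomotopicalAlgebra

variable {ν : Ordinal.{u}}

/-! ### The model structure -/

attribute [local instance] ANu.hasLimits ANu.hasColimits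

section

variable {ι : Type u} (A : ι → ANu ν)

/-- The morphisms which induce weak homotopy equivalences on all `Hom(A_i, -)`. -/
def homWeq : MorphismProperty (ANu ν) := fun _ _ f => ∀ i, IsWeq (homMap (A i) f)

instance : (homWeq A).HasTwoOutOfThreeProperty where
  comp_mem _ _ hf hg i := (hf i).comp (hg i)
  of_postcomp _ _ hg hfg i := (hg i).of_postcomp (hfg i)
  of_precomp {X _ _} _ _ hf hfg i :=
    have : Nonempty (A i ⟶ X) := ⟨0⟩
    (hf i).of_precomp (hfg i)

end

variable {ι : Type u} {A : ι → ANu ν}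
  (h1 : ∀ i, IsPartialLeftAdjoint (ptTensorFunctor (A i)) (homFunctor (A i)))

include h1

theorem rlp_genCof_eq : (genCof A).rlp = (genTrivCof A).rlp ⊓ homWeq A := by
  ext B B' p
  exact rlp_genCof_iff_isWeq h1 p

/-- The nontrivial inclusion is the retract argument. -/
theorem llp_rlp_genTrivCof_eq : (genTrivCof A).rlp.llp = (genCof A).rlp.llp ⊓ homWeq A := by
  refine le_antisymm (le_inf ?_ fun B B' f hf i => isWeq_of_llp h1 f hf i) ?_
  · refine MorphismProperty.antitone_llp ?_
    rw [rlp_genCof_eq h1]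
    exact inf_le_left
  · rintro B B' f ⟨hf, hfw⟩
    have := hasSmallObjectArgument_of_le_sep (genTrivCof A) genTrivCof_le_sep
    let d := MorphismProperty.factorizationData (genTrivCof A).rlp.llp (genTrivCof A).rlp f
    have hw : homWeq A d.p := (homWeq A).of_precomp (W' := homWeq A) d.i d.p
      (fun i => isWeq_of_llp h1 d.i d.hi i) (by rwa [d.fac])
    have : HasLiftingProperty f d.p := hf _ (by
      rw [rlp_genCof_eq h1]
      exact ⟨d.hp, hw⟩)
    exact MorphismProperty.of_retract (RetractArrow.ofLeftLiftingProperty d.fac) d.hi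

/-- The model structure with generating cofibrations `genCof A` and generating trivial cofibrations
`genTrivCof A`. -/
theorem exists_modelCategory (h3 : ∀ i, HasStrongConeSEP (A i)) :
    ∃ _ : ModelCategory (ANu ν), fibrations (ANu ν) = (genTrivCof A).rlp ∧
      cofibrations (ANu ν) = (genCof A).rlp.llp ∧ weakEquivalences (ANu ν) = homWeq A := by
  have := hasSmallObjectArgument_of_le_sep (genTrivCof A) genTrivCof_le_sep
  have := hasSmallObjectArgument_of_le_sep (genCof A) (genCof_le_sep h1 h3)
  let _ : CategoryWithFibrations (ANu ν) := ⟨(genTrivCof A).rlp⟩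
  let _ : CategoryWithCofibrations (ANu ν) := ⟨(genCof A).rlp.llp⟩
  let _ : CategoryWithWeakEquivalences (ANu ν) := ⟨homWeq A⟩
  have hw : weakEquivalences (ANu ν) = homWeq A := rfl
  have hf : trivialFibrations (ANu ν) = (genCof A).rlp := (rlp_genCof_eq h1).symm
  have hc : trivialCofibrations (ANu ν) = (genTrivCof A).rlp.llp := (llp_rlp_genTrivCof_eq h1).symm
  have : (weakEquivalences (ANu ν)).HasTwoOutOfThreeProperty :=
    inferInstanceAs (homWeq A).HasTwoOutOfThreeProperty
  have : MorphismProperty.IsWeakFactorizationSystem (cofibrations (ANu ν))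
      (trivialFibrations (ANu ν)) := by
    rw [hf]
    exact ⟨MorphismProperty.rlp_llp_rlp _, rfl,
      inferInstanceAs (MorphismProperty.HasFactorization (genCof A).rlp.llp (genCof A).rlp)⟩
  have : MorphismProperty.IsWeakFactorizationSystem (trivialCofibrations (ANu ν))
      (fibrations (ANu ν)) := by
    rw [hc]
    exact ⟨MorphismProperty.rlp_llp_rlp _, rfl,
      inferInstanceAs (MorphismProperty.HasFactorization (genTrivCof A).rlp.llp (genTrivCof A).rlp)⟩
  exact ⟨ModelCategory.mk' _, rfl, rfl, rfl⟩

end LmcCStar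

theorem mainTheorem4 (ν : Ordinal.{u}) (hν : Cardinal.aleph0 ≤ ν.card)
    {ι : Type u} (A : ι → ANu ν)
    (h1 : ∀ i, IsPartialLeftAdjoint (ptTensorFunctor (A i)) (homFunctor (A i)))
    (h2 : ∀ i, HasNaturalMappingHomeo (A i))
    (h3 : ∀ i, HasStrongConeSEP (A i)) :
    Limits.HasLimits (ANu ν) ∧ Limits.HasColimits (ANu ν) ∧
    ∃ _ : ModelCategory (ANu ν),
      IsCofibrantlyGenerated (ANu ν) ∧
      (∀ (B B' : ANu ν) (p : B ⟶ B'),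
        Fibration p ↔ ∀ i, IsSerreFibration ((homFunctor (A i)).map p)) ∧
      (∀ (B B' : ANu ν) (p : B ⟶ B'),
        WeakEquivalence p ↔ ∀ i, IsWeakHomotopyEquivalence ((homFunctor (A i)).map p)) ∧
      ∀ i, IsCofibrant (A i) := by
  refine ⟨ANu.hasLimits, ANu.hasColimits, ?_⟩
  obtain ⟨hM, hfib, hcof, hweq⟩ := exists_modelCategory h1 h3
  refine ⟨hM, ⟨genCof A, genTrivCof A, inferInstance, inferInstance, ?_, ?_, ?_, hfib⟩, ?_, ?_, ?_⟩
  · exact fun B B' i _ => isSmallRelativeTo_of_le_sep B (relativeCells_le_sep (genCof_le_sep h1 h3))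
  · exact fun B B' i _ => isSmallRelativeTo_of_le_sep B (relativeCells_le_sep genTrivCof_le_sep)
  · rw [trivialFibrations, hfib, hweq, rlp_genCof_eq h1]
  · intro B B' p
    rw [fibration_iff, hfib]
    exact rlp_genTrivCof_iff h1 p
  · intro B B' p
    rw [weakEquivalence_iff, hweq]
    rfl
  · intro i
    rw [isCofibrant_iff, cofibration_iff, hcof]
    intro B B' p hp
    refine ⟨fun {f g} sq => ?_⟩
    -- The boundary of the zero-dimensional cube is empty.
    obtain ⟨c, -, hc⟩ := (rlp_genCof_iff h1 p).1 hp i 0 (fun _ => 0) continuousOn_const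
      (ContinuousMap.const _ g) fun x ⟨k, _⟩ => k.elim0
    exact ⟨⟨⟨c 0, Limits.initial.hom_ext _ _, hc 0⟩⟩⟩
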